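/- **Setting.** Let $\mathcal T\subset\mathbb R^2$ be a compact convex set with non-empty interior and let $\gamma$ be its boundary, parametrised counter-clockwise (ccw) by arc length and extended periodically with period $L$, the perimeter length; no smoothness is assumed. For $a,b\in\mathbb R$ write $\ell(a,b)=(b-a)\bmod L\in[0,L)$ and $[a,b]=\{s:\ell(a,s)\le \ell(a,b)\}$. Fix $\nu\in(0,1]$. A defender at $\gamma(s_D)$ moves by $\dot s_D=\omega_D$, $|\omega_D|\le 1$; an intruder at $x_A\notin\operatorname{int}\mathcal T$ moves by $\dot x_A=u_A$, $\|u_A\|\le\nu$. For $x\notin\operatorname{int}\mathcal T$ let $S_d(x)$ be the set of $s$ such that the segment from $x$ to $\gamma(s)$ meets $\mathcal T$ only at $\gamma(s)$. Put $$J_L(s;s_D,x)=\ell(s_D,s)-\tfrac{\|\gamma(s)-x\|}{\nu},\qquad J_R(s;s_D,x)=\ell(s,s_D)-\tfrac{\|\gamma(s)-x\|}{\nu}.$$ The left (right) breaching point $s_L(x)$ ($s_R(x)$) is the point of $S_d(x)$ that maximises $J_L(\cdot\,;s_D,x)$ ($J_R(\cdot\,;s_D,x)$) over $S_d(x)$ for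 $s_D\notin S_d(x)$; it is unique modulo $L$ and does not depend on $s_D$. Put $J_L^*(s_D,x)=J_L(s_L(x);s_D,x)$ and $J_R^*(s_D,x)=J_R(s_R(x);s_D,x)$. The singular surface $\{x: J_L^*=J_R^*\}$ consists of the afferent surface $\Gamma_{\rm aff}(s_D)$, where $s_D\in[s_R(x),s_L(x)]$ (the part that extends from $\gamma(s_D)$), and the dispersal surface, where $s_D\notin[s_R(x),s_L(x)]$. These surfaces divide the outside of $\mathcal T$ into a left and a right region; the left region $\Omega_L(s_D)$ consists of the $x$ with $s_D\in[s_R(x),s_L(x)]$ and $J_L^*>J_R^*$, or $s_D\notin[s_R(x),s_L(x)]$ and $J_L^*<J_R^*$. Let $$V(s_D,x)=\begin{cases}J_L^*(s_D,x)&x\in\Omega_L(s_D)\\ J_R^*(s_D,x)&\text{otherwise,}\end{cases}\qquad \mathcal R_A(s_D)=\{x: V(s_D,x)>0\},\qquad d_{\rm bar}(s_D,x)=\inf_{y\in\mathcal R_A(s_D)}\|y-x\|,$$ and let the feedback strategies $\omega_D^*$, $u_A^*$ be: $\omega_D^*=1$ and $u_A^*=\nu\,\frac{\gamma(s_L)-x_A}{\|\gamma(s_L)-x_A\|}$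 if $x_A\in\Omega_L(s_D)$; $\omega_D^*=-1$ and $u_A^*=\nu\,\frac{\gamma(s_R)-x_A}{\|\gamma(s_R)-x_A\|}$ otherwise. **Game.** The intruder is captured at the first time $t_F$ at which $x_A\in\Gamma_{\rm aff}(s_D)$, provided it has not reached $\mathcal T$ before. The payoff, minimised by the defender and maximised by the intruder, is $P_2=-d_{\rm bar}(s_D(t_F),x_A(t_F))$, and $P_2=+\infty$ if there is no capture. Controls are measurable functions of time within the bounds. A player who uses a (possibly discontinuous) feedback of the state applies it at sampling times and holds the control constant in between; payoffs are taken in the limit as the mesh of the sampling tends to $0$ (upper and lower limits, $\overline P_2(\omega_D,u_A)$ and $\underline P_2(\omega_D,u_A)$, over all such plays). **Theorem.** Suppose that the initial state $(s_D,x_A)$ satisfies $x_A\notin\operatorname{int}\mathcal T$ and $x_A\notin\mathcal R_A(s_D)$. Then $(\omega_D^*,u_A^*)$ is an equilibrium: the payoff of the pair $(\omega_D^*,u_A^*)$ is $\nu V(s_D,x_A)$; against $\omega_D^*$ no control of the intruder achieves more than $\nu V(s_D,x_A)$ in the limit, and against $u_A^*$ no control of the defender achieves less in the limit. The value of the game is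 $\nu V(s_D,x_A)$: $$\nu V(s_D,x_A)=\min_{\omega_D}\sup_{u_A}\overline P_2(\omega_D,u_A)=\max_{u_A}\inf_{\omega_D}\underline P_2(\omega_D,u_A),$$ where $\omega_D$ and $u_A$ range over all feedback strategies. -/

import Mathlib

open Set Filter Topology MeasureTheory

noncomputable section

/-- The Euclidean plane. -/
abbrev Plane : Type := EuclideanSpace ℝ (Fin 2)

/-- The cross product of two plane vectors (positive when `w` points to the left of `v`). -/
def planeCross (v w : Plane) : ℝ := v 0 * w 1 - v 1 * w 0

/-- The data of the game: a planar convex body `T` (the target), its counter-clockwise arc-length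
parametrised boundary curve `γ` of total length `L`, extended `L`-periodically to the real line,
and the speed ratio `ν ∈ (0, 1]`. No smoothness of the boundary is required. -/
structure PerimeterGame where
  T : Set Plane
  L : ℝ
  γ : ℝ → Plane
  ν : ℝ
  convex : Convex ℝ T
  compact : IsCompact T
  interior_nonempty : (interior T).Nonempty
  L_pos : 0 < L
  periodic : ∀ s, γ (s + L) = γ s
  injOn : InjOn γ (Ico 0 L)
  image_eq : γ '' Ico 0 L = frontier T
  /-- `γ` is parametrised by arc length. -/
  arclength : ∀ a b, a ≤ b → eVariationOn γ (Icc a b) = ENNReal.ofReal (b - a)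
  /-- `γ` runs counter-clockwise: inscribed triangles are positively oriented. -/
  ccw : ∀ a b c, 0 ≤ a → a < b → b < c → c < L → 0 ≤ planeCross (γ b - γ a) (γ c - γ a)
  ν_pos : 0 < ν
  ν_le_one : ν ≤ 1

namespace PerimeterGame

variable (G : PerimeterGame)

/-- Counter-clockwise arc length from `a` to `b`, i.e. `(b - a) mod L ∈ [0, L)`. -/
def arc (a b : ℝ) : ℝ := G.L * Int.fract ((b - a) / G.L)

/-- The boundary segment `[a, b]` running counter-clockwise from `a` to `b`. -/
def seg (a b : ℝ) : Set ℝ := {s | G.arc a s ≤ G.arc a b}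

/-- The boundary parameters that an intruder at `x` can reach along a straight line, i.e. whose
boundary point is the only point of `T` on the connecting segment. -/
def visible (x : Plane) : Set ℝ := {s | segment ℝ x (G.γ s) ∩ G.T ⊆ {G.γ s}}

/-- The payoff of a counter-clockwise engagement at `b`. -/
def JL (b sD : ℝ) (x : Plane) : ℝ := G.arc sD b - dist (G.γ b) x / G.ν

/-- The payoff of a clockwise engagement at `b`. -/
def JR (b sD : ℝ) (x : Plane) : ℝ := G.arc b sD - dist (G.γ b) x / G.ν

/-- `s` maximises `JL` over the visible part, for defenders off the visible part. -/
def IsLeftBreach (x : Plane) (s : ℝ) : Prop :=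
  s ∈ G.visible x ∧ ∀ sD, sD ∉ G.visible x → ∀ b ∈ G.visible x, G.JL b sD x ≤ G.JL s sD x

/-- `s` maximises `JR` over the visible part, for defenders off the visible part. -/
def IsRightBreach (x : Plane) (s : ℝ) : Prop :=
  s ∈ G.visible x ∧ ∀ sD, sD ∉ G.visible x → ∀ b ∈ G.visible x, G.JR b sD x ≤ G.JR s sD x

/-- The left breaching point (unique modulo `L` when `x` is not interior to `T`). -/
def sL (x : Plane) : ℝ := Classical.epsilon (G.IsLeftBreach x)

/-- The right breaching point (unique modulo `L` when `x` is not interior to `T`). -/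
def sR (x : Plane) : ℝ := Classical.epsilon (G.IsRightBreach x)

/-- The critical value of `JL`. -/
def JLstar (sD : ℝ) (x : Plane) : ℝ := G.JL (G.sL x) sD x

/-- The critical value of `JR`. -/
def JRstar (sD : ℝ) (x : Plane) : ℝ := G.JR (G.sR x) sD x

/-- The singular surface, where both critical values agree. -/
def singularSurface (sD : ℝ) : Set Plane :=
  {x | x ∉ interior G.T ∧ G.JLstar sD x = G.JRstar sD x}

/-- The afferent surface: the part of the singular surface that extends from the defender's own
position, where the defender stands between the two breaching points. -/
def afferentSurface (sD : ℝ) : Set Plane :=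
  {x | x ∈ G.singularSurface sD ∧ sD ∈ G.seg (G.sR x) (G.sL x)}

/-- The left one of the two regions into which the singular surfaces divide the outside of `T`.
When the defender stands between the breaching points, the two regions meet along the afferent
surface and the left side is `JL* > JR*`; otherwise they meet along the dispersal surface (the part
that extends from the point opposite to the defender) and the left side is `JL* < JR*`. -/
def leftRegion (sD : ℝ) : Set Plane :=
  {x | x ∉ interior G.T ∧
    ((sD ∈ G.seg (G.sR x) (G.sL x) ∧ G.JRstar sD x < G.JLstar sD x) ∨
     (sD ∉ G.seg (G.sR x) (G.sL x) ∧ G.JLstar sD x < G.JRstar sD x))}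

open Classical in
/-- The function `V`. -/
def V (sD : ℝ) (x : Plane) : ℝ :=
  if x ∈ G.leftRegion sD then G.JLstar sD x else G.JRstar sD x

/-- The intruder-winning region. -/
def intruderWinning (sD : ℝ) : Set Plane := {x | x ∉ interior G.T ∧ 0 < G.V sD x}

/-- The distance from the intruder to the intruder-winning region. -/
def dbar (sD : ℝ) (x : Plane) : ℝ := Metric.infDist x (G.intruderWinning sD)

/-! ### Strategies -/

/-- A feedback strategy of the defender: a signed speed depending on the state. -/
structure DefenderStrategy where
  toFun : ℝ → Plane → ℝ
  periodic : ∀ s x, toFun (s + G.L) x = toFun s x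
  bound : ∀ s x, |toFun s x| ≤ 1

/-- A feedback strategy of the intruder: a velocity depending on the state. -/
structure IntruderStrategy where
  toFun : ℝ → Plane → Plane
  periodic : ∀ s x, toFun (s + G.L) x = toFun s x
  bound : ∀ s x, ‖toFun s x‖ ≤ G.ν

theorem arc_add_left (a b : ℝ) : G.arc (a + G.L) b = G.arc a b := by
  have h : (b - (a + G.L)) / G.L = (b - a) / G.L - 1 := by
    have := G.L_pos.ne'
    field_simp
    ring
  simp only [arc, h, Int.fract_sub_one]

theorem arc_add_right (a b : ℝ) : G.arc a (b + G.L) = G.arc a b := by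
  have h : (b + G.L - a) / G.L = (b - a) / G.L + 1 := by
    have := G.L_pos.ne'
    field_simp
    ring
  simp only [arc, h, Int.fract_add_one]

theorem mem_leftRegion_add (s : ℝ) (x : Plane) :
    x ∈ G.leftRegion (s + G.L) ↔ x ∈ G.leftRegion s := by
  simp only [leftRegion, seg, JLstar, JRstar, JL, JR, Set.mem_ofPred_eq, arc_add_left, arc_add_right]

theorem norm_unit_le (v : Plane) : ‖G.ν • (‖v‖⁻¹ • v)‖ ≤ G.ν := by
  have h1 : ‖v‖⁻¹ * ‖v‖ ≤ 1 := inv_mul_le_one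
  rw [norm_smul, norm_smul, norm_inv, norm_norm, Real.norm_of_nonneg G.ν_pos.le]
  exact mul_le_of_le_one_right G.ν_pos.le h1

open Classical in
/-- The defender strategy `ω_D*`. -/
def omegaStar : G.DefenderStrategy where
  toFun s x := if x ∈ G.leftRegion s then 1 else -1
  periodic s x := by simp only [mem_leftRegion_add]
  bound s x := by split_ifs <;> simp

open Classical in
/-- The intruder strategy `u_A*`. -/
def uStar : G.IntruderStrategy where
  toFun s x :=
    if x ∈ G.leftRegion s then G.ν • (‖G.γ (G.sL x) - x‖⁻¹ • (G.γ (G.sL x) - x))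
    else G.ν • (‖G.γ (G.sR x) - x‖⁻¹ • (G.γ (G.sR x) - x))
  periodic s x := by simp only [mem_leftRegion_add]
  bound s x := by split_ifs <;> exact G.norm_unit_le _

/-! ### Plays -/

/-- A pair of admissible (measurable, bounded) control functions of time. -/
structure Controls where
  ω : ℝ → ℝ
  u : ℝ → Plane
  measurable_ω : Measurable ω
  measurable_u : Measurable u
  bound_ω : ∀ t, |ω t| ≤ 1
  bound_u : ∀ t, ‖u t‖ ≤ G.ν

variable {G}

/-- The defender's motion: `ṡ_D = ω` with initial position `s₀`. -/
def Controls.s (c : G.Controls) (s₀ t : ℝ) : ℝ := s₀ + ∫ τ in (0 : ℝ)..t, c.ω τ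

/-- The intruder's motion: `ẋ_A = u` with initial position `x₀`. -/
def Controls.x (c : G.Controls) (x₀ : Plane) (t : ℝ) : Plane := x₀ + ∫ τ in (0 : ℝ)..t, c.u τ

/-- The game ends by capture at time `t`: the state reaches the afferent surface for the first time
at `t`, and the intruder has not reached the target before. -/
def Controls.CapturedAt (c : G.Controls) (s₀ : ℝ) (x₀ : Plane) (t : ℝ) : Prop :=
  0 ≤ t ∧ c.x x₀ t ∈ G.afferentSurface (c.s s₀ t) ∧
    ∀ τ, 0 ≤ τ → τ < t → c.x x₀ τ ∉ G.afferentSurface (c.s s₀ τ) ∧ c.x x₀ τ ∉ G.T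

open Classical in
/-- The payoff `P₂`: minus the distance to the intruder-winning region at the time of capture, and
`⊤` (the worst outcome for the minimising defender) when there is no capture. -/
def Controls.payoff (c : G.Controls) (s₀ : ℝ) (x₀ : Plane) : EReal :=
  if h : ∃ t, c.CapturedAt s₀ x₀ t then
    ((-G.dbar (c.s s₀ h.choose) (c.x x₀ h.choose) : ℝ) : EReal)
  else ⊤

/-- A sequence of sampling times of mesh at most `δ`. -/
structure IsSampling (δ : ℝ) (t : ℕ → ℝ) : Prop where
  zero : t 0 = 0
  strictMono : StrictMono t
  mesh : ∀ k, t (k + 1) - t k ≤ δ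
  tendsto : Tendsto t atTop atTop

/-- The defender applies the feedback `F`, sampled with some mesh at most `δ`: the control is held
constant between consecutive sampling times. The intruder's control is arbitrary. -/
def Controls.DefenderFollows (c : G.Controls) (s₀ : ℝ) (x₀ : Plane) (F : G.DefenderStrategy)
    (δ : ℝ) : Prop :=
  ∃ t : ℕ → ℝ, IsSampling δ t ∧
    ∀ k, ∀ τ ∈ Ico (t k) (t (k + 1)), c.ω τ = F.toFun (c.s s₀ (t k)) (c.x x₀ (t k))

/-- The intruder applies the feedback `U`, sampled with some mesh at most `δ`. The defender's
control is arbitrary. -/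
def Controls.IntruderFollows (c : G.Controls) (s₀ : ℝ) (x₀ : Plane) (U : G.IntruderStrategy)
    (δ : ℝ) : Prop :=
  ∃ t : ℕ → ℝ, IsSampling δ t ∧
    ∀ k, ∀ τ ∈ Ico (t k) (t (k + 1)), c.u τ = U.toFun (c.s s₀ (t k)) (c.x x₀ (t k))

variable (G)

/-- The payoff that the feedback `F` guarantees to the defender against every intruder control, in
the limit of fine sampling. -/
def defenderGuarantee (s₀ : ℝ) (x₀ : Plane) (F : G.DefenderStrategy) : EReal :=
  ⨅ (δ : ℝ) (_ : 0 < δ), ⨆ (c : G.Controls) (_ : c.DefenderFollows s₀ x₀ F δ), c.payoff s₀ x₀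

/-- The payoff that the feedback `U` guarantees to the intruder against every defender control, in
the limit of fine sampling. -/
def intruderGuarantee (s₀ : ℝ) (x₀ : Plane) (U : G.IntruderStrategy) : EReal :=
  ⨆ (δ : ℝ) (_ : 0 < δ), ⨅ (c : G.Controls) (_ : c.IntruderFollows s₀ x₀ U δ), c.payoff s₀ x₀

/-- The upper limit, for fine sampling, of the payoff when the players use `F` and `U`. -/
def upperPayoff (s₀ : ℝ) (x₀ : Plane) (F : G.DefenderStrategy) (U : G.IntruderStrategy) : EReal :=
  ⨅ (δ : ℝ) (_ : 0 < δ), ⨆ (c : G.Controls)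
    (_ : c.DefenderFollows s₀ x₀ F δ ∧ c.IntruderFollows s₀ x₀ U δ), c.payoff s₀ x₀

/-- The lower limit, for fine sampling, of the payoff when the players use `F` and `U`. -/
def lowerPayoff (s₀ : ℝ) (x₀ : Plane) (F : G.DefenderStrategy) (U : G.IntruderStrategy) : EReal :=
  ⨆ (δ : ℝ) (_ : 0 < δ), ⨅ (c : G.Controls)
    (_ : c.DefenderFollows s₀ x₀ F δ ∧ c.IntruderFollows s₀ x₀ U δ), c.payoff s₀ x₀

end PerimeterGame

end

noncomputable section

/-! ### The cross product -/

/-! Two functions of the intruder's position carry everything: the point `mid x` of the circle ℝ/Lℤ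
at which a defender makes both engagements equally good, and the common value `cc x` there. Then
V(s, x) = cc x + ‖s - mid x‖ (`V_eq`), capture means s = mid x (`mem_afferentSurface_iff`), and ω_D*
runs along the shorter arc towards mid x.

Geometry. Seen from a boundary point hidden from x, cc + mid and cc - mid are J_L* and J_R* up to
constants (`lift_of_not_visible`). As the boundary need not be smooth, derivatives are replaced by a
one-sided estimate (`JL_sub_le`): going from x to y raises J_L* by at most ⟨y - x, u⟩/ν, where u is
a unit vector from x to some point of T. It holds because a path from x over y to the boundary can
be replaced by a straight line and a boundary arc inside a triangle (`exists_shortcut`). Reflection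
(`mirror`) gives J_R*. Hence V is 1/ν-Lipschitz along segments off T. Moreover, directions to T from
nearby points are never opposite, so that mid x moves at a speed of at most some κ < 1, uniformly at
positive distance from T (`exists_localLift`).

Defender. Until capture the gap to mid x shrinks at rate at least 1 - κ, so ω_D* never switches, and
cc + gap does not increase (`advance`, `omegaStar_gap`). The play ends (`omegaStar_ends`): if cc +
gap becomes negative, the intruder stays away from T, κ is uniform and the gap runs out; if it stays
zero, the intruder has to run straight at T at full speed for ever, which is impossible. Arriving on
T is itself a capture (`omegaStar_first`).

Intruder. Running to a breaching point keeps it a breaching point and raises its J* at the full rate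
(`isLeftBreach_toward`, `exists_toward`). So V does not fall, except that the defender may cross the
antipode of mid x within a sampling interval. This leaves V at least V₀ - 2δ, without accumulation,
because cc never decreases and V₀ ≤ cc + L/2 (`uStar_step`).

At capture off T with V ≤ 0 the distance to the winning region is exactly -νV: the Lipschitz bound
gives one inequality (`neg_le_dbar`), running to a breaching point the other (`dbar_le_neg`). Since
every pair of feedbacks has a sampled joint play (`exists_play`), the two guarantees enclose all the
payoffs in the theorem. -/

theorem planeCross_add_left (u v w : Plane) :
    planeCross (u + v) w = planeCross u w + planeCross v w := by
  simp only [planeCross, PiLp.add_apply]; ring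

theorem planeCross_add_right (u v w : Plane) :
    planeCross u (v + w) = planeCross u v + planeCross u w := by
  simp only [planeCross, PiLp.add_apply]; ring

theorem planeCross_sub_left (u v w : Plane) :
    planeCross (u - v) w = planeCross u w - planeCross v w := by
  simp only [planeCross, PiLp.sub_apply]; ring

theorem planeCross_sub_right (u v w : Plane) :
    planeCross u (v - w) = planeCross u v - planeCross u w := by
  simp only [planeCross, PiLp.sub_apply]; ring

theorem planeCross_smul_left (r : ℝ) (v w : Plane) :
    planeCross (r • v) w = r * planeCross v w := by
  simp only [planeCross, PiLp.smul_apply, smul_eq_mul]; ring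

theorem planeCross_smul_right (r : ℝ) (v w : Plane) :
    planeCross v (r • w) = r * planeCross v w := by
  simp only [planeCross, PiLp.smul_apply, smul_eq_mul]; ring

theorem planeCross_neg_left (v w : Plane) : planeCross (-v) w = -planeCross v w := by
  simp only [planeCross, PiLp.neg_apply]; ring

theorem planeCross_neg_right (v w : Plane) : planeCross v (-w) = -planeCross v w := by
  simp only [planeCross, PiLp.neg_apply]; ring

theorem planeCross_self (v : Plane) : planeCross v v = 0 := by
  simp only [planeCross]; ring

theorem planeCross_zero_left (v : Plane) : planeCross 0 v = 0 := by
  simp [planeCross]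

theorem planeCross_zero_right (v : Plane) : planeCross v 0 = 0 := by
  simp [planeCross]

theorem planeCross_swap (v w : Plane) : planeCross w v = -planeCross v w := by
  simp only [planeCross]; ring

theorem plane_ext {v w : Plane} (h0 : v 0 = w 0) (h1 : v 1 = w 1) : v = w := by
  ext i; fin_cases i
  · exact h0
  · exact h1

/-- Coordinates with respect to a basis of the plane. -/
theorem planeCross_decomp {a b : Plane} (h : planeCross a b ≠ 0) (v : Plane) :
    v = (planeCross v b / planeCross a b) • a + (planeCross a v / planeCross a b) • b := by
  apply plane_ext <;>
  · simp only [PiLp.add_apply, PiLp.smul_apply, smul_eq_mul]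
    field_simp
    simp only [planeCross]; ring

/-- A vector parallel to a non-zero vector is a multiple of it. -/
theorem eq_smul_of_planeCross_eq_zero {a v : Plane} (ha : a ≠ 0) (h : planeCross a v = 0) :
    ∃ r : ℝ, v = r • a := by
  have hn : a 0 ^ 2 + a 1 ^ 2 ≠ 0 := by
    intro h0
    apply ha
    have h1 : a 0 = 0 := by nlinarith [sq_nonneg (a 0), sq_nonneg (a 1)]
    have h2 : a 1 = 0 := by nlinarith [sq_nonneg (a 0), sq_nonneg (a 1)]
    exact plane_ext (by simpa using h1) (by simpa using h2)
  simp only [planeCross] at h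
  refine ⟨(v 0 * a 0 + v 1 * a 1) / (a 0 ^ 2 + a 1 ^ 2), ?_⟩
  apply plane_ext
  · simp only [PiLp.smul_apply, smul_eq_mul]
    field_simp
    linear_combination -(a 1) * h
  · simp only [PiLp.smul_apply, smul_eq_mul]
    field_simp
    linear_combination (a 0) * h

/-- The rotation by a right angle. -/
def planeRot (v : Plane) : Plane := !₂[-(v 1), v 0]

theorem planeCross_eq_inner (v w : Plane) : planeCross v w = inner ℝ (planeRot v) w := by
  simp [planeCross, planeRot, EuclideanSpace.inner_eq_star_dotProduct, dotProduct, Fin.sum_univ_two]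
  ring

theorem norm_planeRot (v : Plane) : ‖planeRot v‖ = ‖v‖ := by
  simp [EuclideanSpace.norm_eq, Fin.sum_univ_two, planeRot, add_comm]

theorem continuous_planeCross (v : Plane) : Continuous (planeCross v) := by
  have : planeCross v = fun w => inner ℝ (planeRot v) w := funext (planeCross_eq_inner v)
  rw [this]; fun_prop

theorem abs_planeCross_le (v w : Plane) : |planeCross v w| ≤ ‖v‖ * ‖w‖ := by
  rw [planeCross_eq_inner, ← norm_planeRot v]
  exact abs_real_inner_le_norm _ _

/-- Every non-zero linear functional on the plane is a cross product. -/
theorem exists_planeCross_eq (f : Plane →L[ℝ] ℝ) : ∃ a : Plane, ∀ v, f v = planeCross a v := by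
  refine ⟨!₂[f (EuclideanSpace.single 1 1), -f (EuclideanSpace.single 0 1)], fun v => ?_⟩
  have hv : v = v 0 • EuclideanSpace.single (0 : Fin 2) (1 : ℝ) +
      v 1 • EuclideanSpace.single (1 : Fin 2) (1 : ℝ) := by
    apply plane_ext <;> simp
  conv_lhs => rw [hv]
  simp [planeCross]
  ring

namespace PerimeterGame

variable (G : PerimeterGame)

/-! ### Arc length modulo the perimeter -/

theorem arc_nonneg (a b : ℝ) : 0 ≤ G.arc a b := mul_nonneg G.L_pos.le (Int.fract_nonneg _)

theorem arc_lt (a b : ℝ) : G.arc a b < G.L := by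
  have := mul_lt_mul_of_pos_left (Int.fract_lt_one ((b - a) / G.L)) G.L_pos
  simpa [arc] using this

theorem exists_arc_eq (a b : ℝ) : ∃ k : ℤ, G.arc a b = b - a + k * G.L := by
  refine ⟨-⌊(b - a) / G.L⌋, ?_⟩
  have := G.L_pos.ne'
  rw [arc, Int.fract]
  push_cast
  field_simp
  ring

/-- A real number has only one representative modulo L in [0, L). The other identities for arcs are
read off from this. -/
theorem arc_eq_of {a b r : ℝ} (k : ℤ) (h0 : 0 ≤ r) (h1 : r < G.L) (h : r = b - a + k * G.L) :
    G.arc a b = r := by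
  obtain ⟨j, hj⟩ := G.exists_arc_eq a b
  have hL := G.L_pos
  have h2 := G.arc_nonneg a b
  have h3 := G.arc_lt a b
  have h4 : G.arc a b - r = ((j - k : ℤ) : ℝ) * G.L := by push_cast; linarith
  have h5 : (j - k : ℤ) < 1 := by
    by_contra hc
    have : (1 : ℝ) ≤ ((j - k : ℤ) : ℝ) := by exact_mod_cast not_lt.mp hc
    nlinarith
  have h6 : (-1 : ℤ) < (j - k : ℤ) := by
    by_contra hc
    have : ((j - k : ℤ) : ℝ) ≤ -1 := by exact_mod_cast not_lt.mp hc
    nlinarith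
  have h7 : (j - k : ℤ) = 0 := by omega
  rw [h7] at h4
  simp at h4
  linarith

theorem arc_congr {a a' b b' : ℝ} (k : ℤ) (h : b' - a' = b - a + k * G.L) :
    G.arc a' b' = G.arc a b := by
  obtain ⟨j, hj⟩ := G.exists_arc_eq a b
  exact G.arc_eq_of (j - k) (G.arc_nonneg _ _) (G.arc_lt _ _) (by push_cast; linarith)

theorem arc_eq_sub {a b : ℝ} (h : a ≤ b) (h' : b < a + G.L) : G.arc a b = b - a :=
  G.arc_eq_of 0 (by linarith) (by linarith) (by simp)

theorem arc_swap {a b : ℝ} (h : G.arc a b ≠ 0) : G.arc b a = G.L - G.arc a b := by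
  obtain ⟨k, hk⟩ := G.exists_arc_eq a b
  have := (G.arc_nonneg a b).lt_of_ne' h
  exact G.arc_eq_of (1 - k) (by linarith [G.arc_lt a b]) (by linarith) (by push_cast; linarith)

theorem arc_swap_of_eq_zero {a b : ℝ} (h : G.arc a b = 0) : G.arc b a = 0 := by
  obtain ⟨k, hk⟩ := G.exists_arc_eq a b
  exact G.arc_eq_of (-k) le_rfl G.L_pos (by push_cast; linarith)

theorem arc_triangle (a b c : ℝ) : G.arc a c ≤ G.arc a b + G.arc b c := by
  obtain ⟨j, hj⟩ := G.exists_arc_eq a b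
  obtain ⟨k, hk⟩ := G.exists_arc_eq b c
  have h1 := G.arc_nonneg a b
  have h2 := G.arc_nonneg b c
  by_cases h : G.arc a b + G.arc b c < G.L
  · rw [G.arc_eq_of (r := G.arc a b + G.arc b c) (j + k) (by linarith) h (by push_cast; linarith)]
  · linarith [G.arc_lt a c]

/-- Arc lengths add up if the intermediate point comes first. -/
theorem arc_of_le {a b c : ℝ} (h : G.arc a b ≤ G.arc a c) : G.arc b c = G.arc a c - G.arc a b := by
  obtain ⟨j, hj⟩ := G.exists_arc_eq a b
  obtain ⟨k, hk⟩ := G.exists_arc_eq a c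
  exact G.arc_eq_of (k - j) (by linarith) (by linarith [G.arc_lt a c, G.arc_nonneg a b])
    (by push_cast; linarith)

/-! ### The boundary curve -/

theorem γ_add_int (s : ℝ) (k : ℤ) : G.γ (s + k * G.L) = G.γ s := by
  have h : Function.Periodic G.γ G.L := G.periodic
  exact h.int_mul k s

theorem γ_add_arc (a b : ℝ) : G.γ (a + G.arc a b) = G.γ b := by
  obtain ⟨k, hk⟩ := G.exists_arc_eq a b
  rw [hk, ← G.γ_add_int b k]
  congr 1; ring

theorem γ_eq_of_arc_eq_zero {a b : ℝ} (h : G.arc a b = 0) : G.γ a = G.γ b := by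
  rw [← G.γ_add_arc a b, h, add_zero]

theorem arc_eq_zero_of_γ_eq {a b : ℝ} (h : G.γ a = G.γ b) : G.arc a b = 0 := by
  have h1 : G.γ (0 + G.arc 0 a) = G.γ (0 + G.arc 0 b) := by
    rw [G.γ_add_arc, G.γ_add_arc, h]
  rw [zero_add, zero_add] at h1
  have h2 := G.injOn ⟨G.arc_nonneg 0 a, G.arc_lt 0 a⟩ ⟨G.arc_nonneg 0 b, G.arc_lt 0 b⟩ h1
  rw [G.arc_of_le h2.le, h2, sub_self]

theorem γ_mem_frontier (s : ℝ) : G.γ s ∈ frontier G.T := by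
  rw [← G.image_eq, ← G.γ_add_arc 0 s, zero_add]
  exact ⟨_, ⟨G.arc_nonneg 0 s, G.arc_lt 0 s⟩, rfl⟩

theorem γ_mem (s : ℝ) : G.γ s ∈ G.T :=
  G.compact.isClosed.frontier_subset (G.γ_mem_frontier s)

theorem γ_notMem_interior (s : ℝ) : G.γ s ∉ interior G.T := by
  have := G.γ_mem_frontier s
  rw [G.compact.isClosed.frontier_eq] at this
  exact this.2

theorem exists_γ_eq {v : Plane} (h : v ∈ G.T) (h' : v ∉ interior G.T) : ∃ s, G.γ s = v := by
  have : v ∈ frontier G.T := by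
    rw [G.compact.isClosed.frontier_eq]; exact ⟨h, h'⟩
  rw [← G.image_eq] at this
  obtain ⟨s, -, hs⟩ := this
  exact ⟨s, hs⟩

theorem dist_γ_le (a b : ℝ) : dist (G.γ a) (G.γ b) ≤ |a - b| := by
  wlog h : a ≤ b generalizing a b
  · rw [dist_comm, abs_sub_comm]; exact this b a (le_of_not_ge h)
  have h1 := eVariationOn.edist_le G.γ (s := Icc a b) (left_mem_Icc.2 h) (right_mem_Icc.2 h)
  rw [G.arclength a b h, edist_dist] at h1
  rw [abs_sub_comm, abs_of_nonneg (by linarith)]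
  exact (ENNReal.ofReal_le_ofReal_iff (by linarith)).1 h1

theorem dist_γ_le_arc (a b : ℝ) : dist (G.γ a) (G.γ b) ≤ G.arc a b := by
  have := G.dist_γ_le a (a + G.arc a b)
  rw [G.γ_add_arc] at this
  simpa [abs_of_nonneg (G.arc_nonneg a b)] using this

theorem continuous_γ : Continuous G.γ := by
  have : LipschitzWith 1 G.γ := LipschitzWith.of_dist_le_mul fun a b => by
    simpa [Real.dist_eq] using G.dist_γ_le a b
  exact this.continuous

theorem planeCross_cyclic (a b c : Plane) :
    planeCross (b - a) (c - a) = planeCross (c - b) (a - b) := by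
  simp only [planeCross, PiLp.sub_apply]; ring

/-- Inscribed triangles are positively oriented, for arbitrary parameters within one period. -/
theorem ccw_of_le {a b c : ℝ} (hab : a ≤ b) (hbc : b ≤ c) (hca : c ≤ a + G.L) :
    0 ≤ planeCross (G.γ b - G.γ a) (G.γ c - G.γ a) := by
  rcases hab.eq_or_lt with rfl | hab
  · simp [planeCross_zero_left]
  rcases hbc.eq_or_lt with rfl | hbc
  · rw [planeCross_self]
  rcases hca.eq_or_lt with rfl | hca
  · rw [G.periodic]; simp [planeCross_zero_right]
  obtain ⟨k, hk⟩ := G.exists_arc_eq 0 a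
  rw [← G.γ_add_int a k, ← G.γ_add_int b k, ← G.γ_add_int c k]
  have h0 := G.arc_nonneg 0 a
  have h1 := G.arc_lt 0 a
  rcases lt_or_ge (c + k * G.L) G.L with h | h
  · exact G.ccw _ _ _ (by linarith) (by linarith) (by linarith) h
  have hc : G.γ (c + k * G.L) = G.γ (c + k * G.L - G.L) := by
    rw [← G.periodic (c + k * G.L - G.L)]; congr 1; ring
  rcases lt_or_ge (b + k * G.L) G.L with h' | h'
  · rw [hc, planeCross_cyclic, planeCross_cyclic]
    exact G.ccw _ _ _ (by linarith) (by linarith) (by linarith) h'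
  have hb : G.γ (b + k * G.L) = G.γ (b + k * G.L - G.L) := by
    rw [← G.periodic (b + k * G.L - G.L)]; congr 1; ring
  rw [hc, hb, planeCross_cyclic]
  exact G.ccw _ _ _ (by linarith) (by linarith) (by linarith) (by linarith)

/-- Orientation determines the cyclic order. -/
theorem arc_lt_of_planeCross_pos {a b c : ℝ}
    (h : 0 < planeCross (G.γ b - G.γ a) (G.γ c - G.γ a)) : G.arc a b < G.arc a c := by
  by_contra hc
  have h1 := G.ccw_of_le (a := a) (b := a + G.arc a c) (c := a + G.arc a b)
    (by linarith [G.arc_nonneg a c]) (by linarith) (by linarith [G.arc_lt a b])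
  rw [G.γ_add_arc, G.γ_add_arc, planeCross_swap] at h1
  linarith

/-- A variation bound for the boundary curve. -/
theorem sub_le_of_dist_le {a b : ℝ} (hab : a ≤ b) (f : ℝ → ℝ)
    (hf : ∀ c d, a ≤ c → c ≤ d → d ≤ b → dist (G.γ c) (G.γ d) ≤ f d - f c) : b - a ≤ f b - f a := by
  have h1 : eVariationOn G.γ (Icc a b) ≤ ENNReal.ofReal (f b - f a) := by
    have hm : MonotoneOn f (Icc a b) := fun c hc d hd hcd => by
      linarith [hf c d hc.1 hcd hd.2, dist_nonneg (x := G.γ c) (y := G.γ d)]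
    have h2 := (hm.eVariationOn_eq (left_mem_Icc.2 hab) (right_mem_Icc.2 hab)).le
    rw [inter_self] at h2
    -- Each polygonal sum of the curve is bounded term by term by that of the monotone function f,
    -- whose variation is f b - f a.
    refine le_trans (iSup_mono fun p => Finset.sum_le_sum fun i _ => ?_) h2
    have h3 := p.2.2.1 (Nat.le_succ i)
    have h4 := hf _ _ (p.2.2.2 i).1 h3 (p.2.2.2 (i + 1)).2
    rw [edist_dist, edist_dist, dist_comm, Real.dist_eq]
    exact ENNReal.ofReal_le_ofReal (h4.trans (le_abs_self _))
  rw [G.arclength a b hab] at h1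
  have h0 : 0 ≤ f b - f a := le_trans dist_nonneg (hf a b le_rfl hab le_rfl)
  exact (ENNReal.ofReal_le_ofReal_iff h0).1 h1

end PerimeterGame

end

noncomputable section

/-! ### Reflection -/

/-- The reflection of the plane in the first coordinate axis. -/
def planeRefl : Plane ≃ₗᵢ[ℝ] Plane where
  toFun v := !₂[v 0, -(v 1)]
  invFun v := !₂[v 0, -(v 1)]
  map_add' v w := by apply plane_ext <;> simp [add_comm]
  map_smul' r v := by apply plane_ext <;> simp
  left_inv v := by apply plane_ext <;> simp
  right_inv v := by apply plane_ext <;> simp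
  norm_map' v := by simp [EuclideanSpace.norm_eq, Fin.sum_univ_two]

theorem planeRefl_planeRefl (v : Plane) : planeRefl (planeRefl v) = v := by
  apply plane_ext <;> simp [planeRefl]

theorem planeCross_planeRefl (v w : Plane) :
    planeCross (planeRefl v) (planeRefl w) = -planeCross v w := by
  simp [planeCross, planeRefl]; ring

namespace PerimeterGame

variable (G : PerimeterGame)

/-- The mirror image of a game. It exchanges the roles of left and right. -/
def mirror : PerimeterGame where
  T := planeRefl '' G.T
  L := G.L
  γ s := planeRefl (G.γ (-s))
  ν := G.ν
  convex := G.convex.linear_image planeRefl.toLinearEquiv.toLinearMap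
  compact := G.compact.image planeRefl.continuous
  interior_nonempty := by
    have := planeRefl.toHomeomorph.image_interior G.T
    simp only [LinearIsometryEquiv.coe_toHomeomorph] at this
    rw [← this]
    exact G.interior_nonempty.image _
  L_pos := G.L_pos
  periodic s := by
    have := G.γ_add_int (-s) (-1)
    rw [← this]
    congr 2; push_cast; ring
  injOn a ha b hb h := by
    have h1 := G.arc_eq_zero_of_γ_eq (planeRefl.injective h)
    obtain ⟨k, hk⟩ := G.exists_arc_eq (-a) (-b)
    rcases le_total a b with hab | hab
    · have h2 := G.arc_swap_of_eq_zero h1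
      rw [G.arc_eq_of (r := b - a) 0 (by linarith) (by linarith [ha.1, hb.2]) (by simp; ring)] at h2
      linarith
    · rw [G.arc_eq_of (r := a - b) 0 (by linarith) (by linarith [hb.1, ha.2]) (by simp; ring)] at h1
      linarith
  image_eq := by
    have := planeRefl.toHomeomorph.image_frontier G.T
    simp only [LinearIsometryEquiv.coe_toHomeomorph] at this
    rw [← this]
    ext v
    constructor
    · rintro ⟨s, -, rfl⟩
      exact ⟨_, G.γ_mem_frontier _, rfl⟩
    · rintro ⟨w, hw, rfl⟩
      rw [← G.image_eq] at hw
      obtain ⟨s, -, rfl⟩ := hw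
      refine ⟨G.arc 0 (-s), ⟨G.arc_nonneg _ _, G.arc_lt _ _⟩, ?_⟩
      obtain ⟨k, hk⟩ := G.exists_arc_eq 0 (-s)
      rw [hk, ← G.γ_add_int s (-k)]
      dsimp only
      congr 2; push_cast; ring
  arclength a b hab := by
    have h1 : eVariationOn (fun s => planeRefl (G.γ (-s))) (Icc a b) =
        eVariationOn (G.γ ∘ fun s => -s) (Icc a b) := by
      simp only [eVariationOn, Function.comp, LinearIsometryEquiv.edist_map]
    have h2 : AntitoneOn (fun s : ℝ => -s) (Icc a b) := fun _ _ _ _ h => neg_le_neg h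
    rw [h1, eVariationOn.comp_eq_of_antitoneOn _ _ h2]
    have h3 : (fun s : ℝ => -s) '' Icc a b = Icc (-b) (-a) := by
      simp
    rw [h3, G.arclength _ _ (by linarith)]
    congr 1; ring
  ccw a b c ha hab hbc hc := by
    -- The reflection changes the sign of the cross product and the reversal of the parameter
    -- changes it back.
    rw [← map_sub, ← map_sub, planeCross_planeRefl, ← planeCross_swap, planeCross_cyclic,
      planeCross_cyclic]
    have h := G.ccw_of_le (a := -c) (b := -b) (c := -a) (by linarith) (by linarith) (by linarith)
    rw [planeCross_cyclic, planeCross_cyclic] at h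
    refine h.trans_eq ?_
    simp only [planeCross, PiLp.sub_apply]
    ring
  ν_pos := G.ν_pos
  ν_le_one := G.ν_le_one

theorem mirror_γ (s : ℝ) : G.mirror.γ s = planeRefl (G.γ (-s)) := rfl
theorem mirror_T : G.mirror.T = planeRefl '' G.T := rfl
theorem mirror_L : G.mirror.L = G.L := rfl
theorem mirror_ν : G.mirror.ν = G.ν := rfl

theorem planeRefl_mem_mirror {v : Plane} : planeRefl v ∈ G.mirror.T ↔ v ∈ G.T :=
  planeRefl.injective.mem_set_image

theorem mirror_arc (a b : ℝ) : G.mirror.arc a b = G.arc (-b) (-a) := by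
  simp only [arc, mirror_L]
  congr 3; ring

theorem mem_visible_mirror {x : Plane} {s : ℝ} :
    s ∈ G.mirror.visible (planeRefl x) ↔ -s ∈ G.visible x := by
  have h : segment ℝ (planeRefl x) (planeRefl (G.γ (-s))) =
      planeRefl '' segment ℝ x (G.γ (-s)) :=
    (image_segment ℝ planeRefl.toLinearEquiv.toLinearMap.toAffineMap x (G.γ (-s))).symm
  simp only [visible, mem_ofPred_eq, mirror_γ, mirror_T, h]
  rw [← image_inter planeRefl.injective, ← image_singleton, image_subset_image_iff planeRefl.injective]

theorem mirror_JL (b s : ℝ) (x : Plane) :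
    G.mirror.JL b s (planeRefl x) = G.JR (-b) (-s) x := by
  simp only [JL, JR, mirror_arc, mirror_γ, mirror_ν, LinearIsometryEquiv.dist_map]

theorem mirror_JR (b s : ℝ) (x : Plane) :
    G.mirror.JR b s (planeRefl x) = G.JL (-b) (-s) x := by
  simp only [JL, JR, mirror_arc, mirror_γ, mirror_ν, LinearIsometryEquiv.dist_map]

theorem isLeftBreach_mirror {x : Plane} {s : ℝ} :
    G.mirror.IsLeftBreach (planeRefl x) s ↔ G.IsRightBreach x (-s) := by
  simp only [IsLeftBreach, IsRightBreach, mem_visible_mirror, mirror_JL]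
  refine and_congr_right fun _ => ⟨fun h sD hD b hb => ?_, fun h sD hD b hb => h _ hD _ hb⟩
  simpa using h (-sD) (by simpa using hD) (-b) (by simpa using hb)

theorem isRightBreach_mirror {x : Plane} {s : ℝ} :
    G.mirror.IsRightBreach (planeRefl x) s ↔ G.IsLeftBreach x (-s) := by
  simp only [IsLeftBreach, IsRightBreach, mem_visible_mirror, mirror_JR]
  refine and_congr_right fun _ => ⟨fun h sD hD b hb => ?_, fun h sD hD b hb => h _ hD _ hb⟩
  simpa using h (-sD) (by simpa using hD) (-b) (by simpa using hb)

end PerimeterGame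

end

/-! ### Visibility, supporting lines and tangents -/

noncomputable section

namespace PerimeterGame

variable (G : PerimeterGame)

theorem mem_visible_iff {x : Plane} (hx : x ∉ G.T) {s : ℝ} :
    s ∈ G.visible x ↔ ∀ t : ℝ, 0 ≤ t → t < 1 → x + t • (G.γ s - x) ∉ G.T := by
  simp only [visible, mem_ofPred_eq, segment_eq_image']
  constructor
  · intro h t h0 h1 ht
    have h2 := h ⟨⟨t, ⟨h0, h1.le⟩, rfl⟩, ht⟩
    have h3 : (1 - t) • (G.γ s - x) = 0 := by
      have h2' : x + t • (G.γ s - x) = G.γ s := h2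
      rw [sub_smul, one_smul, sub_eq_zero]
      exact sub_eq_iff_eq_add'.2 h2'.symm
    rcases smul_eq_zero.1 h3 with h4 | h4
    · linarith
    · rw [sub_eq_zero] at h4
      exact hx (h4 ▸ G.γ_mem s)
  · rintro h v ⟨⟨t, ⟨h0, h1⟩, rfl⟩, ht⟩
    rcases h1.lt_or_eq with h1 | rfl
    · exact absurd ht (h t h0 h1)
    · simp

theorem visible_congr {x : Plane} {a b : ℝ} (h : G.γ a = G.γ b) :
    a ∈ G.visible x ↔ b ∈ G.visible x := by
  simp only [visible, mem_ofPred_eq, h]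

theorem convex_comb_mem {v w : Plane} (hv : v ∈ G.T) (hw : w ∈ G.T) {t : ℝ} (h0 : 0 ≤ t)
    (h1 : t ≤ 1) : v + t • (w - v) ∈ G.T :=
  G.convex.add_smul_sub_mem hv hw ⟨h0, h1⟩

theorem subset_closure_interior : G.T ⊆ closure (interior G.T) := by
  rw [G.convex.closure_interior_eq_closure_of_nonempty_interior G.interior_nonempty]
  exact subset_closure

/-- Supporting lines. -/
theorem exists_support {p : Plane} (hp : p ∉ interior G.T) :
    ∃ a : Plane, (∀ v ∈ G.T, 0 ≤ planeCross a (v - p)) ∧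
      ∀ v ∈ interior G.T, 0 < planeCross a (v - p) := by
  obtain ⟨f, hf⟩ := geometric_hahn_banach_open_point G.convex.interior isOpen_interior hp
  obtain ⟨a, ha⟩ := exists_planeCross_eq f
  refine ⟨-a, fun v hv => ?_, fun v hv => ?_⟩
  · have : f v ≤ f p :=
      closure_minimal (fun w hw => (hf w hw).le) (isClosed_le f.continuous continuous_const)
        (G.subset_closure_interior hv)
    rw [planeCross_neg_left, planeCross_sub_right, ← ha, ← ha]; linarith
  · have := hf v hv
    rw [planeCross_neg_left, planeCross_sub_right, ← ha, ← ha]; linarith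

/-- At a visible point there is a supporting line which separates the target from the observer. -/
theorem exists_support_of_visible {x : Plane} {b : ℝ} (hb : b ∈ G.visible x) :
    ∃ a : Plane, (∀ v ∈ G.T, 0 ≤ planeCross a (v - G.γ b)) ∧
      (∀ v ∈ interior G.T, 0 < planeCross a (v - G.γ b)) ∧ planeCross a (x - G.γ b) ≤ 0 := by
  have hd : Disjoint (interior G.T) (segment ℝ x (G.γ b)) := by
    rw [Set.disjoint_left]
    intro v hv hv'
    have := hb ⟨hv', interior_subset hv⟩
    rw [mem_singleton_iff] at this
    exact G.γ_notMem_interior b (this ▸ hv)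
  obtain ⟨f, u, hf, hu⟩ := geometric_hahn_banach_open G.convex.interior isOpen_interior
    (convex_segment x (G.γ b)) hd
  obtain ⟨a, ha⟩ := exists_planeCross_eq f
  have hT : ∀ v ∈ G.T, f v ≤ u := fun v hv =>
    closure_minimal (fun w hw => (hf w hw).le) (isClosed_le f.continuous continuous_const)
      (G.subset_closure_interior hv)
  have h1 := hT _ (G.γ_mem b)
  have h2 := hu _ (right_mem_segment ℝ x (G.γ b))
  have h3 := hu _ (left_mem_segment ℝ x (G.γ b))
  refine ⟨-a, fun v hv => ?_, fun v hv => ?_, ?_⟩ <;>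
    rw [planeCross_neg_left, planeCross_sub_right, ← ha, ← ha]
  · linarith [hT v hv]
  · linarith [hf v hv]
  · linarith

/-- Some point of T lies strictly before γ b on the way from x. The supporting functional is
nonnegative there, and x lies on the ray from γ b through that point. -/
theorem support_nonneg_of_not_visible {x : Plane} (hx : x ∉ G.T) {b : ℝ} (hb : b ∉ G.visible x)
    {a : Plane} (ha : ∀ v ∈ G.T, 0 ≤ planeCross a (v - G.γ b)) :
    0 ≤ planeCross a (x - G.γ b) := by
  rw [G.mem_visible_iff hx] at hb
  push Not at hb
  obtain ⟨t, h0, h1, ht⟩ := hb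
  have h2 := ha _ ht
  have h3 : x + t • (G.γ b - x) - G.γ b = (1 - t) • (x - G.γ b) := by module
  rw [h3, planeCross_smul_right] at h2
  exact nonneg_of_mul_nonneg_right h2 (by linarith)

theorem exists_pos_add_smul_mem {v : Plane} (hv : v ∈ interior G.T) (d : Plane) :
    ∃ ε : ℝ, 0 < ε ∧ v + ε • d ∈ interior G.T := by
  have h : ∀ᶠ t : ℝ in 𝓝 0, v + t • d ∈ interior G.T := by
    have hc : Continuous fun t : ℝ => v + t • d := by fun_prop
    exact hc.continuousAt.eventually (by simpa using isOpen_interior.mem_nhds hv)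
  obtain ⟨ε, he, h'⟩ := (h.filter_mono nhdsWithin_le_nhds |>.and self_mem_nhdsWithin :
    ∀ᶠ t : ℝ in 𝓝[>] 0, _).exists
  exact ⟨ε, h', he⟩

/-- A ray through an interior point leaves the target at a boundary point behind it. -/
theorem exists_exit {x o : Plane} (ho : o ∈ interior G.T) (hxo : x ≠ o) :
    ∃ (q : ℝ) (k : ℝ), 1 < k ∧ G.γ q = x + k • (o - x) := by
  have hc : Continuous fun t : ℝ => x + t • (o - x) := by fun_prop
  have hne : o - x ≠ 0 := sub_ne_zero.2 hxo.symm
  let K : Set ℝ := {t | x + t • (o - x) ∈ G.T}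
  have hK : IsClosed K := G.compact.isClosed.preimage hc
  have h1 : (1 : ℝ) ∈ K := by
    change x + (1 : ℝ) • (o - x) ∈ G.T
    simpa using interior_subset ho
  have hb : BddAbove K := by
    obtain ⟨R, hR⟩ := G.compact.isBounded.exists_norm_le
    refine ⟨(R + ‖x‖) / ‖o - x‖, fun t ht => ?_⟩
    rw [le_div_iff₀ (norm_pos_iff.2 hne)]
    have h2 := hR _ ht
    have h3 : t • (o - x) = (x + t • (o - x)) - x := by abel
    calc t * ‖o - x‖ ≤ ‖t • (o - x)‖ := by
          rw [norm_smul]; exact mul_le_mul_of_nonneg_right (le_abs_self _) (norm_nonneg _)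
      _ ≤ R + ‖x‖ := by rw [h3]; exact (norm_sub_le _ _).trans (by linarith)
  have hm : sSup K ∈ K := hK.csSup_mem ⟨1, h1⟩ hb
  have hni : ∀ t ∈ K, x + t • (o - x) ∈ interior G.T → ∃ t' ∈ K, t < t' := by
    intro t _ hi
    obtain ⟨ε, he, h⟩ := G.exists_pos_add_smul_mem hi (o - x)
    refine ⟨t + ε, ?_, by linarith⟩
    change x + (t + ε) • (o - x) ∈ G.T
    rw [add_smul, ← add_assoc]
    exact interior_subset h
  obtain ⟨q, hq⟩ := G.exists_γ_eq hm (fun hi => by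
    obtain ⟨t', h, h'⟩ := hni _ hm hi
    exact absurd (le_csSup hb h) (not_le.2 h'))
  refine ⟨q, sSup K, ?_, hq⟩
  obtain ⟨t', h, h'⟩ := hni 1 h1 (by simpa using ho)
  exact h'.trans_le (le_csSup hb h)

/-- The first point of the target on a segment is a visible boundary point. -/
theorem exists_first {x v : Plane} (hx : x ∉ G.T) (hv : v ∈ G.T) :
    ∃ (s : ℝ) (t : ℝ), 0 < t ∧ t ≤ 1 ∧ G.γ s = x + t • (v - x) ∧ s ∈ G.visible x := by
  have hc : Continuous fun t : ℝ => x + t • (v - x) := by fun_prop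
  let K : Set ℝ := {t | x + t • (v - x) ∈ G.T} ∩ Icc 0 1
  have hK : IsCompact K :=
    isCompact_Icc.inter_left (G.compact.isClosed.preimage hc)
  have h1 : (1 : ℝ) ∈ K := by
    refine ⟨?_, by simp⟩
    change x + (1 : ℝ) • (v - x) ∈ G.T
    simpa using hv
  obtain ⟨t, ht, hmin⟩ := hK.exists_isLeast ⟨1, h1⟩
  have hpos : 0 < t := by
    refine ht.2.1.lt_of_ne fun h => hx ?_
    have := ht.1
    rw [← h] at this
    simpa using this
  -- From an interior point one could step back towards x within T, against minimality of t.
  have hni : x + t • (v - x) ∉ interior G.T := by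
    intro hi
    obtain ⟨ε, he, h⟩ := G.exists_pos_add_smul_mem hi (x - v)
    have h2 : x + (t - min ε t) • (v - x) ∈ G.T := by
      have := G.convex_comb_mem (interior_subset hi) (interior_subset h) (t := min ε t / ε)
        (by positivity) (by rw [div_le_one he]; exact min_le_left _ _)
      convert this using 1
      have h3 : (min ε t / ε) * ε = min ε t := by field_simp
      rw [add_sub_cancel_left, smul_smul, h3]
      module
    have h3 := hmin ⟨h2, by linarith [min_le_right ε t], by linarith [ht.2.2, lt_min he hpos]⟩
    linarith [lt_min he hpos]
  obtain ⟨s, hs⟩ := G.exists_γ_eq ht.1 hni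
  refine ⟨s, t, hpos, ht.2.2, hs, ?_⟩
  rw [G.mem_visible_iff hx]
  intro r h0 hr1 hr
  rw [hs, add_sub_cancel_left, smul_smul] at hr
  have := hmin ⟨hr, by positivity, by nlinarith [ht.2.2]⟩
  nlinarith

theorem not_visible_of_interior {x o : Plane} (hx : x ∉ G.T) (ho : o ∈ G.T) {q : ℝ} {k : ℝ}
    (hk : 1 < k) (hq : G.γ q = x + k • (o - x)) : q ∉ G.visible x := by
  rw [G.mem_visible_iff hx]
  intro h
  refine h k⁻¹ (by positivity) (inv_lt_one_of_one_lt₀ hk) ?_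
  rw [hq, add_sub_cancel_left, smul_smul, inv_mul_cancel₀ (by linarith), one_smul]
  simpa using ho

theorem exists_not_visible {x : Plane} (hx : x ∉ G.T) : ∃ q, q ∉ G.visible x := by
  obtain ⟨o, ho⟩ := G.interior_nonempty
  obtain ⟨q, k, hk, hq⟩ := G.exists_exit ho (x := x) (fun h => hx (h ▸ interior_subset ho))
  exact ⟨q, G.not_visible_of_interior hx (interior_subset ho) hk hq⟩

/-- A tangent from an outside point, with the target on its left. -/
theorem exists_tangent {x : Plane} (hx : x ∉ G.T) :
    ∃ s ∈ G.visible x, ∀ v ∈ G.T, 0 ≤ planeCross (G.γ s - x) (v - x) := by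
  obtain ⟨f, u, hu, hf⟩ := geometric_hahn_banach_point_closed G.convex G.compact.isClosed hx
  obtain ⟨a, ha⟩ := exists_planeCross_eq f
  have hpos : ∀ v ∈ G.T, 0 < planeCross a (v - x) := fun v hv => by
    rw [planeCross_sub_right, ← ha, ← ha]; linarith [hf v hv]
  -- The quotient is the cotangent of the angle from a to v - x, which lies in (0, π). Its maximum
  -- is attained in the rightmost direction to T.
  have hcont : ContinuousOn (fun v : Plane => inner ℝ a (v - x) / planeCross a (v - x)) G.T := by
    refine ContinuousOn.div (by fun_prop) ?_ fun v hv => (hpos v hv).ne'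
    exact ((continuous_planeCross a).comp (by fun_prop)).continuousOn
  obtain ⟨p, hp, hmax⟩ := G.compact.exists_isMaxOn
    (G.interior_nonempty.mono interior_subset) hcont
  obtain ⟨s, t, ht, -, hs, hvis⟩ := G.exists_first hx hp
  refine ⟨s, hvis, fun v hv => ?_⟩
  rw [hs, add_sub_cancel_left, planeCross_smul_left]
  refine mul_nonneg ht.le ?_
  have h1 := hmax hv
  simp only [mem_ofPred_eq] at h1
  rw [div_le_div_iff₀ (hpos v hv) (hpos p hp)] at h1
  have ha0 : 0 < inner ℝ a a := by
    rw [real_inner_self_pos]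
    rintro rfl
    have := hpos p hp
    rw [planeCross_zero_left] at this
    exact lt_irrefl _ this
  have key : planeCross (p - x) (v - x) * inner ℝ a a =
      inner ℝ a (p - x) * planeCross a (v - x) - inner ℝ a (v - x) * planeCross a (p - x) := by
    simp only [planeCross, EuclideanSpace.inner_eq_star_dotProduct, dotProduct, Fin.sum_univ_two]
    simp
    ring
  nlinarith

end PerimeterGame

end

/-! ### The order of the visible boundary points by direction -/

noncomputable section

theorem planeCross_comb (a B₁ B₂ : Plane) (α β : ℝ) :
    planeCross a (α • B₁ + β • B₂) = α * planeCross a B₁ + β * planeCross a B₂ := by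
  rw [planeCross_add_right, planeCross_smul_right, planeCross_smul_right]

theorem planeCross_eq_zero_of_basis {a B₁ B₂ : Plane} (hD : planeCross B₁ B₂ ≠ 0)
    (h1 : planeCross a B₁ = 0) (h2 : planeCross a B₂ = 0) (w : Plane) : planeCross a w = 0 := by
  rw [planeCross_decomp hD w, planeCross_comb, h1, h2]; ring

theorem planeCross_sub_sub (a p v x : Plane) :
    planeCross a (v - p) = planeCross a (v - x) - planeCross a (p - x) := by
  rw [← planeCross_sub_right, sub_sub_sub_cancel_right]

namespace PerimeterGame

variable (G : PerimeterGame)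

set_option maxHeartbeats 1000000 in
/-- The boundary between two visible points, run through with the observer on the right, lies in
the triangle that they span with the observer and is visible. -/
theorem visible_of_between {x : Plane} (hx : x ∉ G.T) {b₁ b₂ b : ℝ} (h1 : b₁ ∈ G.visible x)
    (h2 : b₂ ∈ G.visible x) (hD : planeCross (G.γ b₁ - x) (G.γ b₂ - x) < 0) (hb1 : b₁ ≤ b)
    (hb2 : b ≤ b₂) (hL : b₂ ≤ b₁ + G.L) :
    b ∈ G.visible x ∧ ∃ α β : ℝ, 0 ≤ α ∧ 0 ≤ β ∧ α + β ≤ 1 ∧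
      G.γ b - x = α • (G.γ b₁ - x) + β • (G.γ b₂ - x) := by
  obtain ⟨o, ho⟩ := G.interior_nonempty
  obtain ⟨B₁, hB1⟩ : ∃ v, v = G.γ b₁ - x := ⟨_, rfl⟩
  obtain ⟨B₂, hB2⟩ : ∃ v, v = G.γ b₂ - x := ⟨_, rfl⟩
  obtain ⟨C, hC⟩ : ∃ v, v = G.γ b - x := ⟨_, rfl⟩
  obtain ⟨α, β, hαβ⟩ : ∃ α β : ℝ, C = α • B₁ + β • B₂ := by
    rw [← hB1, ← hB2] at hD
    exact ⟨_, _, planeCross_decomp hD.ne C⟩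
  have hL' : b₂ < b₁ + G.L := by
    refine hL.lt_of_ne fun h => ?_
    rw [h, G.periodic, planeCross_self] at hD
    exact lt_irrefl _ hD
  have d1 : G.γ b - G.γ b₁ = C - B₁ := by rw [hC, hB1]; abel
  have d2 : G.γ b - G.γ b₂ = C - B₂ := by rw [hC, hB2]; abel
  have d3 : G.γ b₂ - G.γ b₁ = B₂ - B₁ := by rw [hB2, hB1]; abel
  rw [← hB1, ← hB2] at hD ⊢
  rw [← hC]
  -- The oriented triangle b₁, b, b₂ puts γ b on the observer's side of the chord, or on its line.
  have hsum : α + β ≤ 1 := by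
    have := G.ccw_of_le hb1 hb2 hL
    rw [d1, d3, hαβ] at this
    have e : planeCross (α • B₁ + β • B₂ - B₁) (B₂ - B₁) = (α + β - 1) * planeCross B₁ B₂ := by
      simp only [planeCross, PiLp.sub_apply, PiLp.add_apply, PiLp.smul_apply, smul_eq_mul]; ring
    rw [e] at this
    by_contra hc
    nlinarith
  -- a boundary point strictly to the left of a non-degenerate line through a boundary point
  have hleft : ∀ p a : Plane, 0 < planeCross a (o - p) → ∃ r, 0 < planeCross a (G.γ r - p) := by
    intro p a ha
    obtain ⟨q, k, hk, hq⟩ := G.exists_exit ho (x := p) (fun h => by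
      rw [h, sub_self, planeCross_zero_right] at ha; exact lt_irrefl _ ha)
    refine ⟨q, ?_⟩
    rw [hq, add_sub_cancel_left, planeCross_smul_right]
    nlinarith
  -- On the line of the chord the orientation of the three points is void. A boundary point r behind
  -- the chord restores it: r comes after b₂, and the triangles with r order γ b on the line.
  have hchord : α + β = 1 → 0 < planeCross (B₂ - B₁) (o - G.γ b₁) → 0 ≤ α ∧ 0 ≤ β := by
    intro hs hpos
    obtain ⟨r, hr⟩ := hleft _ _ hpos
    rw [← d3] at hr
    have hlt := G.arc_lt_of_planeCross_pos hr
    rw [G.arc_eq_sub (hb1.trans hb2) hL'] at hlt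
    have hrL := G.arc_lt b₁ r
    constructor
    · have := G.ccw_of_le hb2 (by linarith : b₂ ≤ b₁ + G.arc b₁ r) (by linarith)
      rw [G.γ_add_arc, show G.γ b₂ - G.γ b = α • (G.γ b₂ - G.γ b₁) by
        rw [← neg_sub, d2, d3, hαβ, show α = 1 - β by linarith]; module,
        planeCross_smul_left, planeCross_sub_sub _ _ _ (G.γ b₁)] at this
      have e : planeCross (G.γ b₂ - G.γ b₁) (G.γ b - G.γ b₁) = 0 := by
        rw [d1, d3, hαβ, show α = 1 - β by linarith]
        simp only [planeCross, PiLp.sub_apply, PiLp.add_apply, PiLp.smul_apply, smul_eq_mul]; ring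
      rw [e, sub_zero] at this
      exact nonneg_of_mul_nonneg_left this hr
    · have := G.ccw_of_le hb1 (by linarith : b ≤ b₁ + G.arc b₁ r) (by linarith)
      rw [G.γ_add_arc, d1, hαβ, show α • B₁ + β • B₂ - B₁ = β • (B₂ - B₁) by
        rw [show α = 1 - β by linarith]; module, planeCross_smul_left, ← d3] at this
      exact nonneg_of_mul_nonneg_left this hr
  have hx1 : planeCross (B₂ - B₁) (x - G.γ b₁) < 0 := by
    rw [show x - G.γ b₁ = -B₁ by rw [hB1]; abel]
    have e : planeCross (B₂ - B₁) (-B₁) = planeCross B₁ B₂ := by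
      simp only [planeCross, PiLp.sub_apply, PiLp.neg_apply]; ring
    rwa [e]
  -- a functional which is constant on the chord
  have hconst : ∀ a : Plane, planeCross a B₁ = planeCross a B₂ → 0 < planeCross a B₁ →
      0 < planeCross a (o - G.γ b₁) → 0 < planeCross (B₂ - B₁) (o - G.γ b₁) := by
    intro a he hp hpo
    have key : planeCross a (o - G.γ b₁) * planeCross (B₂ - B₁) (x - G.γ b₁) =
        planeCross a (x - G.γ b₁) * planeCross (B₂ - B₁) (o - G.γ b₁) +
        planeCross a (B₂ - B₁) * planeCross (x - G.γ b₁) (o - G.γ b₁) * (-1) := by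
      simp only [planeCross, PiLp.sub_apply]; ring
    rw [planeCross_sub_right a B₂ B₁, he, show planeCross a (x - G.γ b₁) = -planeCross a B₁ by
      rw [hB1, ← planeCross_neg_right, neg_sub], he] at key
    rw [he] at hp
    nlinarith
  obtain ⟨a₁, ha1, ha1o, ha1x⟩ := G.exists_support_of_visible h1
  obtain ⟨a₂, ha2, ha2o, ha2x⟩ := G.exists_support_of_visible h2
  -- The supporting line at b₁ has x on its far side. With β < 0 and α + β ≤ 1, γ b can be on the
  -- side of T only if the supporting functional takes equal values at both ends of the chord, which
  -- is the degenerate case treated by `hchord`.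
  have hβ : 0 ≤ β := by
    by_contra hneg
    push Not at hneg
    have e1 := ha1 _ (G.γ_mem b)
    have e2 := ha1 _ (G.γ_mem b₂)
    have e3 : 0 ≤ planeCross a₁ B₁ := by
      rw [hB1, ← neg_sub, planeCross_neg_right]; linarith
    rw [d1, planeCross_sub_right, hαβ, planeCross_comb] at e1
    rw [d3, planeCross_sub_right] at e2
    have e4 : planeCross a₁ B₁ = planeCross a₁ B₂ := by nlinarith
    rcases e3.eq_or_lt with e5 | e5
    · have := planeCross_eq_zero_of_basis hD.ne e5.symm (e4 ▸ e5.symm) (o - G.γ b₁)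
      linarith [ha1o o ho]
    · have hs : α + β = 1 := by
        rw [← e4] at e1
        nlinarith
      exact absurd (hchord hs (hconst a₁ e4 e5 (ha1o o ho))).2 (not_le.2 hneg)
  have hα : 0 ≤ α := by
    by_contra hneg
    push Not at hneg
    have e1 := ha2 _ (G.γ_mem b)
    have e2 := ha2 _ (G.γ_mem b₁)
    have e3 : 0 ≤ planeCross a₂ B₂ := by
      rw [hB2, ← neg_sub, planeCross_neg_right]; linarith
    rw [d2, planeCross_sub_right, hαβ, planeCross_comb] at e1
    rw [show G.γ b₁ - G.γ b₂ = B₁ - B₂ by rw [hB2, hB1]; abel, planeCross_sub_right] at e2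
    have e4 : planeCross a₂ B₁ = planeCross a₂ B₂ := by nlinarith
    have e6 := ha2o o ho
    rcases e3.eq_or_lt with e5 | e5
    · have := planeCross_eq_zero_of_basis hD.ne (e4.trans e5.symm) e5.symm (o - G.γ b₂)
      linarith
    · have hs : α + β = 1 := by
        rw [e4] at e1
        nlinarith
      have e7 : planeCross a₂ (o - G.γ b₁) = planeCross a₂ (o - G.γ b₂) := by
        rw [planeCross_sub_sub _ _ _ x, planeCross_sub_sub a₂ (G.γ b₂) _ x, ← hB1, ← hB2, e4]
      exact absurd (hchord hs (hconst a₂ e4 (by rw [e4]; exact e5) (by rw [e7]; exact e6))).1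
        (not_le.2 hneg)
  refine ⟨?_, α, β, hα, hβ, hsum, hαβ⟩
  -- If b were hidden, a supporting line at γ b would have x, γ b₁ and γ b₂ all on its nonnegative
  -- side. But γ b is a convex combination of these, so the line contains every one of them that has
  -- positive weight. Either the functional vanishes, or T lies on the observer's side of the chord,
  -- against the orientation.
  by_contra hvis
  have hvis' := hvis
  obtain ⟨a, ha, hao⟩ := G.exists_support (G.γ_notMem_interior b)
  have e0 := G.support_nonneg_of_not_visible hx hvis ha
  have e1 := ha _ (G.γ_mem b₁)
  have e2 := ha _ (G.γ_mem b₂)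
  rw [show x - G.γ b = -C by rw [hC]; abel, planeCross_neg_right] at e0
  rw [← neg_sub, d1, planeCross_neg_right, planeCross_sub_right] at e1
  rw [← neg_sub, d2, planeCross_neg_right, planeCross_sub_right] at e2
  have e3 : planeCross a C = α * planeCross a B₁ + β * planeCross a B₂ := by
    rw [hαβ, planeCross_comb]
  have hCne : C ≠ 0 := by
    rw [hC, sub_ne_zero]
    intro h
    exact hx (h ▸ G.γ_mem b)
  rcases hα.eq_or_lt with hα0 | hα0
  · rw [← hα0, zero_smul, zero_add] at hαβ
    rcases eq_or_lt_of_le (show β ≤ 1 by linarith) with hβ1 | hβ1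
    · rw [hβ1, one_smul, hC, hB2, sub_left_inj] at hαβ
      exact hvis ((G.visible_congr hαβ).2 h2)
    · refine (G.mem_visible_iff hx).1 h2 β hβ hβ1 ?_
      rw [← hB2, ← hαβ, hC, add_sub_cancel]
      exact G.γ_mem b
  rcases hβ.eq_or_lt with hβ0 | hβ0
  · rw [← hβ0, zero_smul, add_zero] at hαβ
    rcases eq_or_lt_of_le (show α ≤ 1 by linarith) with hα1 | hα1
    · rw [hα1, one_smul, hC, hB1, sub_left_inj] at hαβ
      exact hvis ((G.visible_congr hαβ).2 h1)
    · refine (G.mem_visible_iff hx).1 h1 α hα hα1 ?_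
      rw [← hB1, ← hαβ, hC, add_sub_cancel]
      exact G.γ_mem b
  rcases hsum.lt_or_eq with hs | hs
  · have e4 : planeCross a C = 0 := by
      apply le_antisymm (by linarith)
      nlinarith
    rw [e4] at e1 e2 e3
    have e5 : planeCross a B₁ = 0 := by nlinarith
    have e6 : planeCross a B₂ = 0 := by nlinarith
    have := planeCross_eq_zero_of_basis hD.ne e5 e6 (o - G.γ b)
    linarith [hao o ho]
  · have e5 : planeCross a B₁ = planeCross a C := by nlinarith
    have e6 : planeCross a B₂ = planeCross a C := by nlinarith
    have e7 : planeCross a C < 0 := by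
      refine lt_of_le_of_ne (by linarith) fun h => ?_
      have := planeCross_eq_zero_of_basis hD.ne (e5.trans h) (e6.trans h) (o - G.γ b)
      linarith [hao o ho]
    have e8 : 0 < planeCross (-(B₂ - B₁)) (o - G.γ b) := by
      have key : planeCross a (o - G.γ b) * planeCross (B₂ - B₁) (-C) =
          planeCross a (-C) * planeCross (B₂ - B₁) (o - G.γ b) +
          planeCross a (B₂ - B₁) * planeCross (-C) (o - G.γ b) * (-1) := by
        simp only [planeCross, PiLp.sub_apply, PiLp.neg_apply]; ring
      have e9 : planeCross (B₂ - B₁) (-C) = planeCross B₁ B₂ := by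
        rw [hαβ, show α = 1 - β by linarith]
        simp only [planeCross, PiLp.sub_apply, PiLp.neg_apply, PiLp.add_apply, PiLp.smul_apply,
          smul_eq_mul]
        ring
      rw [e9, planeCross_sub_right a B₂, e5, e6, planeCross_neg_right] at key
      rw [planeCross_neg_left]
      have := hao o ho
      nlinarith
    obtain ⟨r, hr⟩ := hleft _ _ e8
    rw [planeCross_neg_left] at hr
    have f1 : G.γ b - G.γ b₁ = β • (B₂ - B₁) := by
      rw [d1, hαβ, show α = 1 - β by linarith]; module
    have f2 : G.γ b₂ - G.γ b = α • (B₂ - B₁) := by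
      rw [← neg_sub, d2, hαβ, show α = 1 - β by linarith]; module
    have hlt : G.arc b₁ r < G.arc b₁ b₂ := by
      apply G.arc_lt_of_planeCross_pos
      rw [d3, planeCross_swap, planeCross_sub_sub _ _ _ (G.γ b)]
      rw [show G.γ b₁ - G.γ b = -(β • (B₂ - B₁)) by rw [← f1]; abel, planeCross_neg_right,
        planeCross_smul_right, planeCross_self]
      linarith
    rw [G.arc_eq_sub (hb1.trans hb2) hL'] at hlt
    have hr0 := G.arc_nonneg b₁ r
    rcases le_total (b₁ + G.arc b₁ r) b with h | h
    · have := G.ccw_of_le h hb2 (by linarith)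
      rw [G.γ_add_arc, planeCross_cyclic, f2, planeCross_smul_left] at this
      nlinarith
    · have := G.ccw_of_le hb1 h (by linarith)
      rw [G.γ_add_arc, planeCross_sub_sub _ _ _ (G.γ b), f1] at this
      rw [show G.γ b₁ - G.γ b = -(β • (B₂ - B₁)) by rw [← f1]; abel, planeCross_neg_right,
        planeCross_self, planeCross_smul_left] at this
      nlinarith

/-- Two visible points on the same line through the observer agree. -/
theorem γ_eq_of_planeCross_eq_zero {x : Plane} (hx : x ∉ G.T) {b₁ b₂ : ℝ} (h1 : b₁ ∈ G.visible x)
    (h2 : b₂ ∈ G.visible x) (h : planeCross (G.γ b₁ - x) (G.γ b₂ - x) = 0) : G.γ b₁ = G.γ b₂ := by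
  have hne : G.γ b₁ - x ≠ 0 := sub_ne_zero.2 fun h => hx (h ▸ G.γ_mem b₁)
  obtain ⟨r, hr⟩ := eq_smul_of_planeCross_eq_zero hne h
  have e : G.γ b₂ = x + r • (G.γ b₁ - x) := by rw [← hr]; abel
  have hr0 : 0 < r := by
    by_contra hc
    push Not at hc
    apply hx
    have := G.convex_comb_mem (G.γ_mem b₂) (G.γ_mem b₁) (t := -r / (1 - r))
      (div_nonneg (by linarith) (by linarith)) (by rw [div_le_one (by linarith)]; linarith)
    convert this using 1
    have h1r : (1 - r) ≠ 0 := by linarith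
    have e3 : G.γ b₁ - G.γ b₂ = (1 - r) • (G.γ b₁ - x) := by rw [e]; module
    rw [e3, smul_smul, div_mul_cancel₀ _ h1r, e]
    module
  rcases lt_trichotomy r 1 with hr1 | hr1 | hr1
  · exact absurd (e ▸ G.γ_mem b₂) ((G.mem_visible_iff hx).1 h1 r hr0.le hr1)
  · rw [e, hr1, one_smul]; abel
  · refine absurd ?_ ((G.mem_visible_iff hx).1 h2 r⁻¹ (by positivity) (inv_lt_one_of_one_lt₀ hr1))
    rw [hr, smul_smul, inv_mul_cancel₀ hr0.ne', one_smul, add_sub_cancel]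
    exact G.γ_mem b₁

theorem arc_pos_of_not_visible {x : Plane} {q b : ℝ} (hq : q ∉ G.visible x) (hb : b ∈ G.visible x) :
    0 < G.arc q b := by
  refine (G.arc_nonneg q b).lt_of_ne' fun h => hq ?_
  exact (G.visible_congr (G.γ_eq_of_arc_eq_zero h)).2 hb

theorem arc_to_not_visible {x : Plane} {q b : ℝ} (hq : q ∉ G.visible x) (hb : b ∈ G.visible x) :
    G.arc b q = G.L - G.arc q b :=
  G.arc_swap (G.arc_pos_of_not_visible hq hb).ne'

/-- Seen from a hidden boundary point, the visible points are ordered by their directions. -/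
theorem arc_le_of_planeCross_neg {x : Plane} (hx : x ∉ G.T) {q b₁ b₂ : ℝ} (hq : q ∉ G.visible x)
    (h1 : b₁ ∈ G.visible x) (h2 : b₂ ∈ G.visible x)
    (hD : planeCross (G.γ b₁ - x) (G.γ b₂ - x) < 0) : G.arc q b₁ ≤ G.arc q b₂ := by
  by_contra hc
  push Not at hc
  refine hq ?_
  have e1 := G.arc_of_le hc.le
  have e2 : G.arc b₁ b₂ = G.L - G.arc b₂ b₁ := G.arc_swap (by rw [e1]; linarith)
  have e3 := G.arc_to_not_visible hq h1
  have h2' : b₁ + G.arc b₁ b₂ ∈ G.visible x := (G.visible_congr (G.γ_add_arc b₁ b₂)).2 h2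
  have := (G.visible_of_between hx h1 h2' (b := b₁ + G.arc b₁ q) (by rwa [G.γ_add_arc])
    (by linarith [G.arc_nonneg b₁ q])
    (by linarith [G.arc_nonneg q b₂]) (by linarith [G.arc_lt b₁ b₂])).1
  exact (G.visible_congr (G.γ_add_arc b₁ q)).1 this

theorem planeCross_neg_of_arc_lt {x : Plane} (hx : x ∉ G.T) {q b₁ b₂ : ℝ} (hq : q ∉ G.visible x)
    (h1 : b₁ ∈ G.visible x) (h2 : b₂ ∈ G.visible x) (h : G.arc q b₁ < G.arc q b₂) :
    planeCross (G.γ b₁ - x) (G.γ b₂ - x) < 0 := by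
  rcases lt_trichotomy (planeCross (G.γ b₁ - x) (G.γ b₂ - x)) 0 with h3 | h3 | h3
  · exact h3
  · have h4 := G.arc_eq_zero_of_γ_eq (G.γ_eq_of_planeCross_eq_zero hx h1 h2 h3)
    rw [G.arc_of_le h.le] at h4
    linarith
  · rw [planeCross_swap, Left.neg_pos_iff] at h3
    linarith [G.arc_le_of_planeCross_neg hx hq h2 h1 h3]

/-- Differences of positions of visible points do not depend on the hidden base point. -/
theorem arc_sub_arc {x : Plane} (hx : x ∉ G.T) {q q' b₁ b₂ : ℝ} (hq : q ∉ G.visible x)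
    (hq' : q' ∉ G.visible x) (h1 : b₁ ∈ G.visible x) (h2 : b₂ ∈ G.visible x) :
    G.arc q b₂ - G.arc q b₁ = G.arc q' b₂ - G.arc q' b₁ := by
  wlog h : planeCross (G.γ b₁ - x) (G.γ b₂ - x) ≤ 0 generalizing b₁ b₂
  · have := this h2 h1 (by rw [planeCross_swap]; linarith)
    linarith
  rcases h.lt_or_eq with h | h
  · rw [← G.arc_of_le (G.arc_le_of_planeCross_neg hx hq h1 h2 h),
      ← G.arc_of_le (G.arc_le_of_planeCross_neg hx hq' h1 h2 h)]
  · have h4 := G.arc_eq_zero_of_γ_eq (G.γ_eq_of_planeCross_eq_zero hx h1 h2 h)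
    have h5 : ∀ p, G.arc p b₂ = G.arc p b₁ := fun p => by
      obtain ⟨k, hk⟩ := G.exists_arc_eq b₁ b₂
      exact G.arc_congr (-k) (by push_cast; linarith)
    rw [h5, h5, sub_self, sub_self]

end PerimeterGame

end

/-! ### Existence of breaching points -/

noncomputable section

theorem planeCross_planeRot_pos {v : Plane} (hv : v ≠ 0) : 0 < planeCross v (planeRot v) := by
  rw [planeCross_eq_inner, real_inner_self_pos, ← norm_ne_zero_iff, norm_planeRot]
  exact norm_ne_zero_iff.2 hv

namespace PerimeterGame

variable (G : PerimeterGame)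

/-- The boundary parameters visible from an outside point form a closed set. -/
theorem isClosed_visible {x : Plane} (hx : x ∉ G.T) : IsClosed (G.visible x) := by
  rw [← isOpen_compl_iff, isOpen_iff_mem_nhds]
  intro b hb
  have hb' := hb
  rw [mem_compl_iff, G.mem_visible_iff hx] at hb'
  push Not at hb'
  obtain ⟨t, ht0, ht1, ht⟩ := hb'
  have htpos : 0 < t := ht0.lt_of_ne fun h => hx (by rw [← h] at ht; simpa using ht)
  have hne : G.γ b - x ≠ 0 := sub_ne_zero.2 fun h => hx (h ▸ G.γ_mem b)
  -- A point of T blocks the view of γ b. The segment of T from it to v also blocks all nearby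
  -- boundary points whose direction deviates to the side of v: in the basis of blocking point and v
  -- their coordinates have sum greater than 1.
  have key : ∀ v ∈ G.T, planeCross (G.γ b - x) (v - x) ≠ 0 → ∀ᶠ b' in 𝓝 b,
      0 ≤ planeCross (G.γ b - x) (G.γ b' - x) / planeCross (G.γ b - x) (v - x) →
      b' ∉ G.visible x := by
    intro v hv hcv
    have hD : planeCross (t • (G.γ b - x)) (v - x) ≠ 0 := by
      rw [planeCross_smul_left]; exact mul_ne_zero htpos.ne' hcv
    have c1 : Continuous fun b' : ℝ => planeCross (G.γ b' - x) (v - x) := by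
      have : (fun b' : ℝ => planeCross (G.γ b' - x) (v - x)) =
          fun b' => -planeCross (v - x) (G.γ b' - x) := by
        ext b'; rw [planeCross_swap]
      rw [this]
      exact ((continuous_planeCross (v - x)).comp (G.continuous_γ.sub continuous_const)).neg
    have c2 : Continuous fun b' : ℝ => planeCross (t • (G.γ b - x)) (G.γ b' - x) :=
      (continuous_planeCross _).comp (G.continuous_γ.sub continuous_const)
    have e1 : ∀ᶠ b' in 𝓝 b, 1 < planeCross (G.γ b' - x) (v - x) /
        planeCross (t • (G.γ b - x)) (v - x) + planeCross (t • (G.γ b - x)) (G.γ b' - x) /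
        planeCross (t • (G.γ b - x)) (v - x) := by
      refine ((c1.div_const _).add (c2.div_const _)).continuousAt.eventually
        (lt_mem_nhds (a := 1) ?_)
      change 1 < planeCross (G.γ b - x) (v - x) / planeCross (t • (G.γ b - x)) (v - x) +
        planeCross (t • (G.γ b - x)) (G.γ b - x) / planeCross (t • (G.γ b - x)) (v - x)
      rw [planeCross_smul_left, planeCross_smul_left, planeCross_self, mul_zero, zero_div, add_zero,
        div_mul_cancel_right₀ hcv]
      exact (one_lt_inv₀ htpos).2 ht1
    have e2 : ∀ᶠ b' in 𝓝 b, 0 < planeCross (G.γ b' - x) (v - x) /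
        planeCross (t • (G.γ b - x)) (v - x) := by
      refine (c1.div_const _).continuousAt.eventually (lt_mem_nhds (a := 0) ?_)
      change 0 < planeCross (G.γ b - x) (v - x) / planeCross (t • (G.γ b - x)) (v - x)
      rw [planeCross_smul_left, div_mul_cancel_right₀ hcv]
      positivity
    filter_upwards [e1, e2] with b' h1 h2 h3 hvis
    have h4 : 0 ≤ planeCross (t • (G.γ b - x)) (G.γ b' - x) /
        planeCross (t • (G.γ b - x)) (v - x) := by
      rwa [planeCross_smul_left, planeCross_smul_left, mul_div_mul_left _ _ htpos.ne']
    have h5 := planeCross_decomp hD (G.γ b' - x)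
    generalize planeCross (G.γ b' - x) (v - x) / planeCross (t • (G.γ b - x)) (v - x) = α at *
    generalize planeCross (t • (G.γ b - x)) (G.γ b' - x) /
      planeCross (t • (G.γ b - x)) (v - x) = β at *
    have hpos : 0 < α + β := by linarith
    refine (G.mem_visible_iff hx).1 hvis (α + β)⁻¹ (by positivity) (inv_lt_one_of_one_lt₀ h1) ?_
    have := G.convex_comb_mem ht hv (t := β / (α + β)) (by positivity)
      (by rw [div_le_one hpos]; linarith)
    convert this using 1
    rw [h5]
    have e3 : (α + β)⁻¹ * α = 1 - β / (α + β) := by field_simp; ring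
    rw [smul_add, smul_smul, smul_smul, e3, div_eq_inv_mul]
    module
  by_cases hp : ∃ v ∈ G.T, 0 < planeCross (G.γ b - x) (v - x)
  · obtain ⟨v, hv, hpv⟩ := hp
    by_cases hn : ∃ v ∈ G.T, planeCross (G.γ b - x) (v - x) < 0
    · obtain ⟨u, hu, hnu⟩ := hn
      filter_upwards [key v hv hpv.ne', key u hu hnu.ne] with b' h1 h2
      rcases le_total 0 (planeCross (G.γ b - x) (G.γ b' - x)) with h | h
      · exact h1 (div_nonneg h hpv.le)
      · exact h2 (div_nonneg_of_nonpos h hnu.le)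
    · push Not at hn
      filter_upwards [key v hv hpv.ne'] with b' h1
      exact h1 (div_nonneg (hn _ (G.γ_mem b')) hpv.le)
  · push Not at hp
    obtain ⟨o, ho⟩ := G.interior_nonempty
    -- No point of T is to the left of the sight line. Shifting an interior point to the right gives
    -- one strictly to its right.
    obtain ⟨ε, hε, h⟩ := G.exists_pos_add_smul_mem ho (-planeRot (G.γ b - x))
    have hv : planeCross (G.γ b - x) (o + ε • -planeRot (G.γ b - x) - x) < 0 := by
      have h1 := hp _ (interior_subset ho)
      have h2 := planeCross_planeRot_pos hne
      rw [show o + ε • -planeRot (G.γ b - x) - x = (o - x) + (-ε) • planeRot (G.γ b - x) by module,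
        planeCross_add_right, planeCross_smul_right]
      nlinarith
    filter_upwards [key _ (interior_subset h) hv.ne] with b' h1
    exact h1 (div_nonneg_of_nonpos (hp _ (G.γ_mem b')) hv.le)

/-- By `arc_sub_arc`, changing the hidden base point changes J_L by the same constant at all visible
points, so one base point suffices. -/
theorem isLeftBreach_of_maximal {x : Plane} (hx : x ∉ G.T) {q s : ℝ} (hq : q ∉ G.visible x)
    (hs : s ∈ G.visible x) (h : ∀ b ∈ G.visible x, G.JL b q x ≤ G.JL s q x) :
    G.IsLeftBreach x s := by
  refine ⟨hs, fun q' hq' b hb => ?_⟩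
  have h1 := G.arc_sub_arc hx hq hq' hb hs
  have h2 := h b hb
  simp only [JL] at *
  linarith

theorem exists_isLeftBreach_of_notMem {x : Plane} (hx : x ∉ G.T) : ∃ s, G.IsLeftBreach x s := by
  obtain ⟨q, hq⟩ := G.exists_not_visible hx
  obtain ⟨b₀, hb₀, -⟩ := G.exists_tangent hx
  have hmem : ∀ b ∈ G.visible x, q + G.arc q b ∈ G.visible x ∩ Icc q (q + G.L) := fun b hb =>
    ⟨(G.visible_congr (G.γ_add_arc q b)).2 hb, by linarith [G.arc_nonneg q b],
      by linarith [G.arc_lt q b]⟩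
  have hK : IsCompact (G.visible x ∩ Icc q (q + G.L)) :=
    isCompact_Icc.inter_left (G.isClosed_visible hx)
  have hc : Continuous fun b : ℝ => b - q - dist (G.γ b) x / G.ν :=
    (continuous_id.sub continuous_const).sub
      ((G.continuous_γ.dist continuous_const).div_const _)
  obtain ⟨s, hs, hmax⟩ := hK.exists_isMaxOn ⟨_, hmem b₀ hb₀⟩ hc.continuousOn
  refine ⟨s, G.isLeftBreach_of_maximal hx hq hs.1 fun b hb => ?_⟩
  have h1 := hmax (hmem b hb)
  simp only [mem_ofPred_eq, G.γ_add_arc] at h1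
  -- The end q + L of the compact interval is the hidden point q again, so that arcs from q are
  -- plain differences.
  have h2 : s < q + G.L := hs.2.2.lt_of_ne fun h => hq ((G.visible_congr (by
    rw [h, G.periodic])).1 hs.1)
  simp only [JL, G.arc_eq_sub hs.2.1 h2]
  linarith

theorem visible_of_mem {x : Plane} (hx : x ∈ G.T) {b : ℝ} :
    b ∈ G.visible x ↔ G.γ b = x := by
  constructor
  · intro h
    have := h ⟨left_mem_segment ℝ _ _, hx⟩
    exact (mem_singleton_iff.1 this).symm
  · rintro rfl v hv
    simpa using hv.1

theorem isLeftBreach_of_mem {x : Plane} (hx : x ∈ G.T) {b : ℝ} :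
    G.IsLeftBreach x b ↔ G.γ b = x := by
  refine ⟨fun h => (G.visible_of_mem hx).1 h.1, fun h => ⟨(G.visible_of_mem hx).2 h, ?_⟩⟩
  intro sD _ c hc
  rw [G.visible_of_mem hx] at hc
  have h1 := G.arc_eq_zero_of_γ_eq (hc.trans h.symm)
  obtain ⟨k, hk⟩ := G.exists_arc_eq c b
  have h2 : G.arc sD b = G.arc sD c := G.arc_congr (-k) (by push_cast; linarith)
  simp only [JL, h2, h, hc, le_refl]

theorem exists_isLeftBreach {x : Plane} (hx : x ∉ interior G.T) : ∃ s, G.IsLeftBreach x s := by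
  by_cases h : x ∈ G.T
  · obtain ⟨s, hs⟩ := G.exists_γ_eq h hx
    exact ⟨s, (G.isLeftBreach_of_mem h).2 hs⟩
  · exact G.exists_isLeftBreach_of_notMem h

theorem planeRefl_mem_interior_mirror {x : Plane} :
    planeRefl x ∈ interior G.mirror.T ↔ x ∈ interior G.T := by
  have := planeRefl.toHomeomorph.image_interior G.T
  simp only [LinearIsometryEquiv.coe_toHomeomorph] at this
  rw [mirror_T, ← this, planeRefl.injective.mem_set_image]

theorem exists_isRightBreach {x : Plane} (hx : x ∉ interior G.T) : ∃ s, G.IsRightBreach x s := by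
  obtain ⟨s, hs⟩ := G.mirror.exists_isLeftBreach (G.planeRefl_mem_interior_mirror.not.2 hx)
  exact ⟨-s, G.isLeftBreach_mirror.1 hs⟩

theorem isRightBreach_of_mem {x : Plane} (hx : x ∈ G.T) {b : ℝ} :
    G.IsRightBreach x b ↔ G.γ b = x := by
  have h1 := G.isLeftBreach_mirror (x := x) (s := -b)
  rw [neg_neg] at h1
  rw [← h1, G.mirror.isLeftBreach_of_mem (G.planeRefl_mem_mirror.2 hx), mirror_γ, neg_neg]
  exact planeRefl.injective.eq_iff

theorem sL_spec {x : Plane} (hx : x ∉ interior G.T) : G.IsLeftBreach x (G.sL x) :=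
  Classical.epsilon_spec (G.exists_isLeftBreach hx)

theorem sR_spec {x : Plane} (hx : x ∉ interior G.T) : G.IsRightBreach x (G.sR x) :=
  Classical.epsilon_spec (G.exists_isRightBreach hx)

/-! ### Lengths of boundary arcs -/

/-- The boundary in a triangle `p z γ(s)` over the chord from `p = γ(s₁)` to `γ(s)`. -/
theorem arc_cone {s₁ s w : ℝ} {z : Plane} (hD : 0 < planeCross (z - G.γ s₁) (G.γ s - z))
    (hT : ∀ v ∈ G.T, 0 ≤ planeCross (z - G.γ s₁) (v - G.γ s₁))
    (hz : ∀ t : ℝ, 0 ≤ t → t < 1 → z + t • (G.γ s - z) ∉ G.T)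
    (hw : 0 < planeCross (G.γ s - G.γ s₁) (G.γ w - G.γ s₁)) (hs : s₁ ≤ s) (hsL : s < s₁ + G.L)
    {c : ℝ} (hc : s₁ ≤ c) (hcs : c ≤ s) :
    ∃ P Q : ℝ, 0 ≤ P ∧ 0 ≤ Q ∧ G.γ s - G.γ c = P • (z - G.γ s₁) + Q • (G.γ s - z) ∧
      s - c ≤ P * ‖z - G.γ s₁‖ + Q * ‖G.γ s - z‖ := by
  obtain ⟨a, ha⟩ : ∃ a, a = z - G.γ s₁ := ⟨_, rfl⟩
  obtain ⟨b, hb⟩ : ∃ b, b = G.γ s - z := ⟨_, rfl⟩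
  rw [← ha] at hD hT ⊢
  rw [← hb] at hD hz ⊢
  -- X and Y are the coordinates about z in the directions of the two sides: γ s₁ is (-1, 0) and γ s
  -- is (0, 1). Both turn out to be monotone along the arc, so its length is at most ΔX‖a‖ + ΔY‖b‖.
  obtain ⟨X, hX⟩ : ∃ X : ℝ → ℝ, ∀ c, X c = planeCross (G.γ c - z) b / planeCross a b :=
    ⟨_, fun _ => rfl⟩
  obtain ⟨Y, hY⟩ : ∃ Y : ℝ → ℝ, ∀ c, Y c = planeCross a (G.γ c - z) / planeCross a b :=
    ⟨_, fun _ => rfl⟩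
  have hdec : ∀ c, G.γ c - z = X c • a + Y c • b := fun c => by
    rw [hX, hY]; exact planeCross_decomp hD.ne' _
  have hXp : X s₁ = -1 := by
    rw [hX, show G.γ s₁ - z = -a by rw [ha]; abel, planeCross_neg_left, neg_div,
      div_self hD.ne']
  have hYp : Y s₁ = 0 := by
    rw [hY, show G.γ s₁ - z = -a by rw [ha]; abel, planeCross_neg_right, planeCross_self, neg_zero,
      zero_div]
  have hXs : X s = 0 := by rw [hX, ← hb, planeCross_self, zero_div]
  have hYs : Y s = 1 := by rw [hY, ← hb, div_self hD.ne']
  have hcross : ∀ c d e, planeCross (G.γ c - G.γ d) (G.γ e - G.γ d) =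
      ((X c - X d) * (Y e - Y d) - (Y c - Y d) * (X e - X d)) * planeCross a b := by
    intro c d e
    rw [show G.γ c - G.γ d = (G.γ c - z) - (G.γ d - z) by abel,
      show G.γ e - G.γ d = (G.γ e - z) - (G.γ d - z) by abel, hdec c, hdec d, hdec e]
    simp only [planeCross, PiLp.sub_apply, PiLp.add_apply, PiLp.smul_apply, smul_eq_mul]; ring
  have hccw : ∀ c d e, c ≤ d → d ≤ e → e ≤ c + G.L →
      0 ≤ (X d - X c) * (Y e - Y c) - (Y d - Y c) * (X e - X c) := by
    intro c d e h1 h2 h3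
    have := G.ccw_of_le h1 h2 h3
    rw [hcross] at this
    exact nonneg_of_mul_nonneg_left this hD
  obtain ⟨w', hw', hw1, hw2⟩ : ∃ w', G.γ w' = G.γ w ∧ s ≤ w' ∧ w' ≤ s₁ + G.L := by
    refine ⟨s₁ + G.arc s₁ w, G.γ_add_arc _ _, ?_, by linarith [G.arc_lt s₁ w]⟩
    have := G.arc_lt_of_planeCross_pos hw
    rw [G.arc_eq_sub hs hsL] at this
    linarith
  rw [← hw', hcross, hXs, hYs, hXp, hYp] at hw
  have hw := pos_of_mul_pos_left hw hD.le
  have hY0 : ∀ c, 0 ≤ Y c := by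
    intro c
    have h1 := hT _ (G.γ_mem c)
    rw [show G.γ c - G.γ s₁ = (G.γ c - z) + a by rw [ha]; abel, planeCross_add_right,
      planeCross_self, add_zero] at h1
    rw [hY]; exact div_nonneg h1 hD.le
  have hA : ∀ c, s₁ ≤ c → c ≤ s → Y c ≤ X c + 1 := by
    intro c h1 h2
    have := hccw s₁ c s h1 h2 hsL.le
    rw [hXs, hYs, hXp, hYp] at this
    linarith
  -- If X c > 0, the chord from γ s₁ to γ c crosses the line of the second side in a point of T.
  -- This must not lie before γ s, so γ c is on the line of the chord beyond γ s, and the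
  -- orientation against w excludes that.
  have hX0 : ∀ c, s₁ ≤ c → c ≤ s → X c ≤ 0 := by
    intro c h1 h2
    by_contra hpos
    push Not at hpos
    have hk : 0 < X c + 1 := by linarith
    have hmem := G.convex_comb_mem (G.γ_mem s₁) (G.γ_mem c) (t := (X c + 1)⁻¹) (by positivity)
      (inv_le_one_of_one_le₀ (by linarith))
    have e : G.γ s₁ + (X c + 1)⁻¹ • (G.γ c - G.γ s₁) = z + (Y c / (X c + 1)) • b := by
      rw [show G.γ c - G.γ s₁ = (G.γ c - z) + a by rw [ha]; abel, hdec c,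
        show X c • a + Y c • b + a = (X c + 1) • a + Y c • b by module, smul_add, smul_smul,
        smul_smul, inv_mul_cancel₀ hk.ne', one_smul, div_eq_inv_mul, ha]
      abel
    rw [e] at hmem
    have h3 : ¬ Y c / (X c + 1) < 1 := fun h => hz _ (div_nonneg (hY0 c) hk.le) h hmem
    rw [div_lt_one hk] at h3
    have h4 : Y c = X c + 1 := le_antisymm (hA c h1 h2) (not_lt.1 h3)
    have h5 := hccw c s w' h2 hw1 (by linarith)
    rw [hXs, hYs, h4] at h5
    nlinarith
  -- The oriented triangles (s₁, c, d) and (c, d, s) give two bilinear inequalities, whose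
  -- combinations carry the factor X c + 1 - Y c. It vanishes only if γ c is on the chord, where w
  -- supplies the order.
  have hmono : ∀ c d, s₁ ≤ c → c ≤ d → d ≤ s → X c ≤ X d ∧ Y c ≤ Y d := by
    intro c d h1 h2 h3
    have e1 := hccw s₁ c d h1 h2 (by linarith)
    have e2 := hccw c d s h2 h3 (by linarith)
    rw [hXp, hYp] at e1
    rw [hXs, hYs] at e2
    have e3 := hA c h1 (by linarith)
    have e4 := hX0 c h1 (by linarith)
    have e5 := hY0 c
    rcases e3.lt_or_eq with h | h
    · constructor
      · have : 0 ≤ (X c + 1 - Y c) * (X d - X c) := by nlinarith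
        linarith [nonneg_of_mul_nonneg_right this (by linarith)]
      · have : 0 ≤ (X c + 1 - Y c) * (Y d - Y c) := by nlinarith
        linarith [nonneg_of_mul_nonneg_right this (by linarith)]
    · rcases e5.eq_or_lt with h0 | h0
      · have h6 := hA d (by linarith) h3
        have h7 := hY0 d
        constructor <;> linarith
      · rcases e4.lt_or_eq with h8 | h8
        · have h9 : X d - X c = Y d - Y c := by
            have f1 : 0 ≤ Y c * ((Y d - Y c) - (X d - X c)) := by
              rw [show X c = Y c - 1 by linarith] at e1 ⊢; linarith
            have f2 : 0 ≤ (-X c) * ((X d - X c) - (Y d - Y c)) := by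
              rw [h] at e2 ⊢; linarith
            have f3 := nonneg_of_mul_nonneg_right f1 h0
            have f4 := nonneg_of_mul_nonneg_right f2 (by linarith)
            linarith
          have h10 := hccw c d w' h2 (by linarith) (by linarith)
          have h11 : 0 ≤ (X d - X c) * ((0 - -1) * (Y w' - 0) - (1 - 0) * (X w' - -1)) := by
            rw [← h9, h] at h10; linarith
          have := nonneg_of_mul_nonneg_left h11 hw
          constructor <;> linarith
        · have h9 : G.γ c = G.γ s := by
            have := hdec c
            rw [h8, h, h8, zero_smul, zero_add, zero_add, one_smul, hb] at this
            exact sub_left_inj.1 this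
          have h12 := G.arc_eq_zero_of_γ_eq h9
          rw [G.arc_eq_sub (by linarith) (by linarith)] at h12
          have : d = c := by linarith
          rw [this]; exact ⟨le_rfl, le_rfl⟩
  obtain ⟨m1, m2⟩ := hmono c s hc hcs le_rfl
  refine ⟨-X c, 1 - Y c, by linarith, by linarith, ?_, ?_⟩
  · rw [show G.γ s - G.γ c = (G.γ s - z) - (G.γ c - z) by abel, hdec c, ← hb]; module
  · have := G.sub_le_of_dist_le hcs (fun c => X c * ‖a‖ + Y c * ‖b‖) fun d e hd hde he => by
      obtain ⟨n1, n2⟩ := hmono d e (by linarith) hde he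
      rw [dist_comm, dist_eq_norm, show G.γ e - G.γ d = (X e - X d) • a + (Y e - Y d) • b by
        rw [show G.γ e - G.γ d = (G.γ e - z) - (G.γ d - z) by abel, hdec d, hdec e]; module]
      refine (norm_add_le _ _).trans ?_
      rw [norm_smul, norm_smul, Real.norm_of_nonneg (by linarith), Real.norm_of_nonneg (by linarith)]
      linarith
    simp only [hXs, hYs] at this
    linarith

/-- The length of a straight piece of the boundary. -/
theorem arc_le_of_left {s₁ s : ℝ} (hT : ∀ v ∈ G.T, 0 ≤ planeCross (G.γ s - G.γ s₁) (v - G.γ s₁)) :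
    G.arc s₁ s ≤ ‖G.γ s - G.γ s₁‖ := by
  by_cases hne : G.γ s = G.γ s₁
  · rw [G.arc_eq_zero_of_γ_eq hne.symm]; exact norm_nonneg _
  obtain ⟨a, ha⟩ : ∃ a, a = G.γ s - G.γ s₁ := ⟨_, rfl⟩
  have ha0 : a ≠ 0 := by rw [ha]; exact sub_ne_zero.2 hne
  rw [← ha] at hT ⊢
  obtain ⟨w, hw⟩ : ∃ w, 0 < planeCross a (G.γ w - G.γ s₁) := by
    obtain ⟨o, ho⟩ := G.interior_nonempty
    have hpos : 0 < planeCross a (o - G.γ s₁) := by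
      obtain ⟨ε, hε, h⟩ := G.exists_pos_add_smul_mem ho (-planeRot a)
      have h1 := hT _ (interior_subset h)
      rw [show o + ε • -planeRot a - G.γ s₁ = (o - G.γ s₁) + (-ε) • planeRot a by module,
        planeCross_add_right, planeCross_smul_right] at h1
      nlinarith [planeCross_planeRot_pos ha0]
    obtain ⟨q, k, hk, hq⟩ := G.exists_exit ho (x := G.γ s₁) (fun h => by
      rw [← h, sub_self, planeCross_zero_right] at hpos; exact lt_irrefl _ hpos)
    refine ⟨q, ?_⟩
    rw [hq, add_sub_cancel_left, planeCross_smul_right]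
    nlinarith
  have hlt : G.arc s₁ s < G.arc s₁ w := G.arc_lt_of_planeCross_pos (ha ▸ hw)
  have hL := G.arc_lt s₁ w
  have hγs : G.γ (s₁ + G.arc s₁ s) = G.γ s := G.γ_add_arc _ _
  have h0 := G.arc_nonneg s₁ s
  have haa : 0 < inner ℝ a a := real_inner_self_pos.2 ha0
  -- The orientation puts the arc on the right of the chord and the hypothesis puts T on its left.
  have hline : ∀ c, s₁ ≤ c → c ≤ s₁ + G.arc s₁ s → ∃ r : ℝ, G.γ c - G.γ s₁ = r • a := by
    intro c h1 h2
    have e1 := G.ccw_of_le h1 h2 (by linarith)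
    rw [hγs, ← ha, planeCross_swap] at e1
    exact eq_smul_of_planeCross_eq_zero ha0 (le_antisymm (by linarith) (hT _ (G.γ_mem c)))
  have := G.sub_le_of_dist_le (b := s₁ + G.arc s₁ s) (by linarith)
    (fun c => inner ℝ a (G.γ c - G.γ s₁) / ‖a‖) fun c d h1 h2 h3 => by
      obtain ⟨r, hr⟩ := hline c h1 (h2.trans h3)
      obtain ⟨r', hr'⟩ := hline d (h1.trans h2) h3
      have e1 : G.γ d - G.γ c = (r' - r) • a := by
        rw [show G.γ d - G.γ c = (G.γ d - G.γ s₁) - (G.γ c - G.γ s₁) by abel, hr, hr']; module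
      have e2 := G.ccw_of_le h2 (by linarith : d ≤ s₁ + G.arc s₁ w) (by linarith)
      rw [G.γ_add_arc, e1, planeCross_smul_left, planeCross_sub_sub _ _ _ (G.γ s₁), hr,
        planeCross_smul_right, planeCross_self, mul_zero, sub_zero] at e2
      have e3 := nonneg_of_mul_nonneg_left e2 hw
      rw [dist_comm, dist_eq_norm, e1, norm_smul, Real.norm_of_nonneg e3, hr, hr', inner_smul_right,
        inner_smul_right, real_inner_self_eq_norm_sq]
      have : ‖a‖ ≠ 0 := norm_ne_zero_iff.2 ha0
      apply le_of_eq
      field_simp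
  rw [hγs, ← ha, sub_self, inner_zero_right, zero_div, real_inner_self_eq_norm_sq, sub_zero,
    sq, mul_self_div_self] at this
  linarith

end PerimeterGame

end

/-! ### Short cuts and the first-order estimate -/

noncomputable section

namespace PerimeterGame

variable (G : PerimeterGame)

/-- An arc inside a triangle is shorter than the two other sides of the triangle. -/
theorem arc_le_of_cone {s₁ s w : ℝ} {z : Plane} (hD : 0 < planeCross (z - G.γ s₁) (G.γ s - z))
    (hT : ∀ v ∈ G.T, 0 ≤ planeCross (z - G.γ s₁) (v - G.γ s₁))
    (hz : ∀ t : ℝ, 0 ≤ t → t < 1 → z + t • (G.γ s - z) ∉ G.T)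
    (hw : 0 < planeCross (G.γ s - G.γ s₁) (G.γ w - G.γ s₁)) :
    G.arc s₁ s ≤ ‖z - G.γ s₁‖ + ‖G.γ s - z‖ := by
  have e := G.γ_add_arc s₁ s
  have h0 := G.arc_nonneg s₁ s
  rw [← e] at hD hz hw
  obtain ⟨P, Q, -, -, h1, h2⟩ := G.arc_cone hD hT hz hw (by linarith)
    (by linarith [G.arc_lt s₁ s]) le_rfl (by linarith)
  rw [e] at hD h1 h2
  rw [show G.γ s - G.γ s₁ = (1 : ℝ) • (z - G.γ s₁) + (1 : ℝ) • (G.γ s - z) by module] at h1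
  have hP : P = 1 := by
    have := congrArg (fun v => planeCross v (G.γ s - z)) h1
    simp only [planeCross_add_left, planeCross_smul_left, planeCross_self, mul_zero, add_zero] at this
    exact (mul_right_cancel₀ hD.ne' this).symm
  have hQ : Q = 1 := by
    have := congrArg (planeCross (z - G.γ s₁)) h1
    simp only [planeCross_comb, planeCross_self, mul_zero, zero_add] at this
    exact (mul_right_cancel₀ hD.ne' this).symm
  rw [hP, hQ] at h2
  linarith

set_option maxHeartbeats 1000000 in
/-- A path from `x` over `y` to a point visible from `y` can be cut short by going to a point
visible from `x` and along the boundary. -/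
theorem exists_shortcut {x y o : Plane} {q s k ρ : ℝ}
    (hxy : ∀ t : ℝ, 0 ≤ t → t ≤ 1 → x + t • (y - x) ∉ G.T) (ho : Metric.ball o ρ ⊆ G.T)
    (hd : dist x y < ρ) (hk : 1 < k) (hq : G.γ q = x + k • (o - x)) (hs : s ∈ G.visible y) :
    ∃ s' ∈ G.visible x, ∃ z : Plane, ∃ r t : ℝ, 0 ≤ r ∧ r ≤ 1 ∧ z = y + r • (G.γ s - y) ∧
      0 ≤ t ∧ x + t • (z - x) ∈ G.T ∧
      G.arc q s - G.arc q s' ≤ (‖z - x‖ + ‖G.γ s - z‖ - ‖G.γ s' - x‖) / G.ν := by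
  have hx : x ∉ G.T := by simpa using hxy 0 le_rfl zero_le_one
  have hy : y ∉ G.T := by simpa using hxy 1 zero_le_one le_rfl
  have hν := G.ν_pos
  by_cases hsx : s ∈ G.visible x
  · refine ⟨s, hsx, G.γ s, 1, 1, zero_le_one, le_rfl, by simp, zero_le_one, ?_, by simp⟩
    simpa using G.γ_mem s
  obtain ⟨E, hE⟩ : ∃ E, E = G.γ s - x := ⟨_, rfl⟩
  obtain ⟨Y, hY⟩ : ∃ Y, Y = y - x := ⟨_, rfl⟩
  have hγs : G.γ s = x + E := by rw [hE]; abel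
  have hyx : y = x + Y := by rw [hY]; abel
  -- As γ s is hidden from x, the line to it enters T earlier, at the visible point γ s₁.
  obtain ⟨s₁, τ, hτ0, hτ1, hs1, hs1v⟩ : ∃ s₁ τ : ℝ, 0 < τ ∧ τ < 1 ∧ G.γ s₁ = x + τ • E ∧
      s₁ ∈ G.visible x := by
    rw [G.mem_visible_iff hx] at hsx
    push Not at hsx
    obtain ⟨t₀, h0, h1, h2⟩ := hsx
    obtain ⟨s₁, t, ht0, ht1, h3, h4⟩ := G.exists_first hx h2
    have hpos : 0 < t₀ := h0.lt_of_ne fun h => hx (by rw [← h] at h2; simpa using h2)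
    refine ⟨s₁, t * t₀, by positivity, by nlinarith, ?_, h4⟩
    rw [h3, add_sub_cancel_left, smul_smul, hE]
  have hp1 : x + τ • E ∈ G.T := hs1 ▸ G.γ_mem s₁
  rw [← hY] at hxy
  have hsy : ∀ r : ℝ, 0 ≤ r → r < 1 → x + ((1 - r) • Y + r • E) ∉ G.T := by
    intro r h0 h1 h2
    refine (G.mem_visible_iff hy).1 hs r h0 h1 ?_
    convert h2 using 1
    rw [hγs, hyx]; module
  have hE0 : E ≠ 0 := by
    rintro rfl
    exact hx (by simpa using hp1)
  have hEn : 0 < ‖E‖ := norm_pos_iff.2 hE0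
  -- If y were on the line through x and γ s, then γ s₁ would lie on one of the two legs of the
  -- path, which avoid T.
  have hDne : planeCross E Y ≠ 0 := by
    intro h
    obtain ⟨r, hr⟩ := eq_smul_of_planeCross_eq_zero hE0 h
    rcases le_or_gt τ r with h1 | h1
    · have hr0 : 0 < r := hτ0.trans_le h1
      refine hxy (τ / r) (by positivity) (by rw [div_le_one hr0]; exact h1) ?_
      rwa [hr, smul_smul, div_mul_cancel₀ _ hr0.ne']
    · have h2 : 0 < 1 - r := by linarith
      refine hsy ((τ - r) / (1 - r)) (div_nonneg (by linarith) h2.le)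
        (by rw [div_lt_one h2]; linarith) ?_
      convert hp1 using 2
      rw [hr, smul_smul, ← add_smul]
      congr 1
      field_simp
      ring
  have hcoord : ∀ v : Plane, ∃ α β : ℝ, v - x = α • Y + β • E := fun v =>
    ⟨_, _, planeCross_decomp (by rwa [planeCross_swap, neg_ne_zero]) _⟩
  -- On the side of y, T stays inside the triangle x, y, γ s: a point of T beyond one of the legs,
  -- joined to γ s₁, would produce a point of T on a leg.
  have tri₁ : ∀ (v : Plane) (α β : ℝ), v ∈ G.T → v - x = α • Y + β • E → 0 < α → 0 ≤ β →
      α + β ≤ 1 := by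
    intro v α β hv he hα hβ
    by_contra hc
    push Not at hc
    have hden : 0 < α + β - τ := by linarith
    obtain ⟨κ, hκ⟩ : ∃ κ, κ = (1 - τ) / (α + β - τ) := ⟨_, rfl⟩
    have hκ0 : 0 < κ := by rw [hκ]; exact div_pos (by linarith) hden
    have hκ1 : κ < 1 := by rw [hκ, div_lt_one hden]; linarith
    have hκe : κ * (α + β - τ) = 1 - τ := by rw [hκ]; field_simp
    have hmem := G.convex_comb_mem hp1 hv hκ0.le hκ1.le
    refine hsy (1 - κ * α) ?_ (by nlinarith) ?_
    · nlinarith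
    · convert hmem using 1
      rw [show v = x + (α • Y + β • E) by rw [← he]; abel]
      have h5 : 1 - κ * α = τ + κ * (β - τ) := by linarith
      rw [show (1 - (1 - κ * α)) = κ * α by ring, h5]
      module
  have tri₂ : ∀ (v : Plane) (α β : ℝ), v ∈ G.T → v - x = α • Y + β • E → 0 < α → 0 < β := by
    intro v α β hv he hα
    by_contra hc
    push Not at hc
    have hden : 0 < τ - β := by linarith
    obtain ⟨κ, hκ⟩ : ∃ κ, κ = τ / (τ - β) := ⟨_, rfl⟩
    have hκ0 : 0 < κ := by rw [hκ]; exact div_pos hτ0 hden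
    have hκ1 : κ ≤ 1 := by rw [hκ, div_le_one hden]; linarith
    have hκe : κ * (τ - β) = τ := by rw [hκ]; field_simp
    have hmem := G.convex_comb_mem hp1 hv hκ0.le hκ1
    have e : x + τ • E + κ • (v - (x + τ • E)) - x = (κ * α) • Y + (0 : ℝ) • E := by
      rw [show v = x + (α • Y + β • E) by rw [← he]; abel]
      rw [show (0 : ℝ) = τ + κ * (β - τ) by linarith]
      module
    have h6 := tri₁ _ _ _ hmem e (by positivity) le_rfl
    refine hxy (κ * α) (by positivity) (by linarith) ?_
    convert hmem using 1
    rw [zero_smul, add_zero] at e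
    rw [← e]; abel
  obtain ⟨αo, βo, hoc⟩ := hcoord o
  -- The centre of the disc lies across the line from y. Otherwise it would be in the triangle,
  -- within ‖Y‖ < ρ of the leg from y to γ s in the direction Y, and the disc would meet that leg.
  have hαo : αo < 0 := by
    by_contra hc
    push Not at hc
    have hYn : ‖Y‖ < ρ := by rwa [hY, ← dist_eq_norm, dist_comm]
    obtain ⟨ε, hε, hε'⟩ : ∃ ε : ℝ, 0 < ε ∧ ε * ‖Y‖ + ‖Y‖ < ρ := by
      refine ⟨(ρ - ‖Y‖) / (2 * (‖Y‖ + 1)), by have := norm_nonneg Y; apply div_pos <;> linarith, ?_⟩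
      have : 0 < ‖Y‖ + 1 := by positivity
      have h7 : (ρ - ‖Y‖) / (2 * (‖Y‖ + 1)) * ‖Y‖ ≤ (ρ - ‖Y‖) / 2 := by
        rw [div_mul_eq_mul_div, div_le_div_iff₀ (by positivity) (by norm_num)]
        nlinarith [norm_nonneg Y]
      linarith
    have hmem : o + ε • Y ∈ G.T := ho (by
      rw [Metric.mem_ball, dist_eq_norm, add_sub_cancel_left, norm_smul, Real.norm_of_nonneg hε.le]
      linarith [norm_nonneg Y])
    have e : o + ε • Y - x = (αo + ε) • Y + βo • E := by
      rw [add_sub_right_comm, hoc]; module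
    have h8 := tri₂ _ _ _ hmem e (by linarith)
    have h9 := tri₁ _ _ _ hmem e (by linarith) h8.le
    refine hsy βo h8.le (by linarith) (ho ?_)
    rw [Metric.mem_ball, dist_eq_norm]
    have h10 : x + ((1 - βo) • Y + βo • E) - o = (1 - βo - αo) • Y := by
      rw [show o = x + (αo • Y + βo • E) by rw [← hoc]; abel]; module
    rw [h10, norm_smul, Real.norm_of_nonneg (by linarith)]
    nlinarith [norm_nonneg Y]
  have hcq : planeCross E (G.γ q - x) = k * (αo * planeCross E Y) := by
    rw [hq, add_sub_cancel_left, planeCross_smul_right, hoc, planeCross_comb, planeCross_self]; ring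
  have hn1 : ‖G.γ s₁ - x‖ = τ * ‖E‖ := by
    rw [hs1, add_sub_cancel_left, norm_smul, Real.norm_of_nonneg hτ0.le]
  -- If y is on the right of the line of sight, the path passes round the tangent with T on its
  -- left, and s' is the tangent point. If y is on the left, s comes before s₁ counted from q, so s₁
  -- is closer and also further along the boundary.
  rcases lt_or_gt_of_ne hDne with hD | hD
  · obtain ⟨s', hs'v, hs'⟩ := G.exists_tangent hx
    obtain ⟨α, β, hp⟩ := hcoord (G.γ s')
    have hp' : G.γ s' = x + (α • Y + β • E) := by rw [← hp]; abel
    have hα : 0 ≤ α := by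
      have := hs' _ (G.γ_mem s)
      rw [← hE, hp, planeCross_add_left, planeCross_smul_left, planeCross_smul_left,
        planeCross_self, planeCross_swap E Y] at this
      nlinarith
    have htri := G.arc_triangle q s' s
    rcases hα.eq_or_lt with hα | hα
    · have h1 : G.γ s' = G.γ s₁ := by
        refine G.γ_eq_of_planeCross_eq_zero hx hs'v hs1v ?_
        rw [hp, hs1, ← hα, zero_smul, zero_add, add_sub_cancel_left, planeCross_smul_left,
          planeCross_smul_right, planeCross_self]
        ring
      have h2 : G.γ s - G.γ s' = (1 - τ) • E := by rw [h1, hs1, hγs]; module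
      have h3 : G.arc s' s ≤ ‖G.γ s - G.γ s'‖ := by
        refine G.arc_le_of_left fun v hv => ?_
        have h4 := hs' v hv
        rw [h1, hs1, add_sub_cancel_left, planeCross_smul_left] at h4
        rw [h2, planeCross_smul_left, planeCross_sub_sub _ _ _ x, h1, hs1, add_sub_cancel_left,
          planeCross_smul_right, planeCross_self, mul_zero, sub_zero]
        exact mul_nonneg (by linarith) (nonneg_of_mul_nonneg_right h4 hτ0)
      rw [h2, norm_smul, Real.norm_of_nonneg (by linarith)] at h3
      refine ⟨s', hs'v, G.γ s, 1, 1, zero_le_one, le_rfl, by simp, zero_le_one,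
        by simpa using G.γ_mem s, ?_⟩
      rw [sub_self, norm_zero, add_zero, h1, hn1, ← hE, le_div_iff₀ hν]
      have h5 : 0 ≤ (1 - τ) * ‖E‖ := by nlinarith
      nlinarith [G.ν_le_one]
    · have hβ := tri₂ _ _ _ (G.γ_mem s') hp hα
      have hm := tri₁ _ _ _ (G.γ_mem s') hp hα hβ.le
      have hm1 : α + β < 1 := by
        refine hm.lt_of_ne fun h => hsy β hβ.le (by linarith) ?_
        rw [show 1 - β = α by linarith, ← hp']
        exact G.γ_mem s'
      obtain ⟨m, hmd⟩ : ∃ m, m = α + β := ⟨_, rfl⟩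
      rw [← hmd] at hm1
      have hm0 : 0 < m := by linarith
      -- The point where the tangent ray leaves the triangle, on the leg from y to γ s. The arc from
      -- s' to s lies in the triangle γ s', z, γ s.
      obtain ⟨z, hz⟩ : ∃ z, z = x + m⁻¹ • (G.γ s' - x) := ⟨_, rfl⟩
      have hzr : z = y + (β / m) • (G.γ s - y) := by
        rw [hz, hp, hyx, hγs]
        have e1 : m⁻¹ * α = 1 - β / m := by rw [hmd]; field_simp; ring
        rw [smul_add, smul_smul, smul_smul, e1, div_eq_inv_mul]
        module
      have e2 : z - G.γ s' = (m⁻¹ - 1) • (G.γ s' - x) := by rw [hz]; module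
      have e3 : G.γ s - z = (α / m) • (E - Y) := by
        rw [hzr, hyx, hγs]
        have e1 : α / m = 1 - β / m := by rw [hmd]; field_simp; ring
        rw [e1]; module
      have hm2 : 0 < m⁻¹ - 1 := by
        have := (one_lt_inv₀ hm0).2 hm1
        linarith
      have hr1 : β / m < 1 := by rw [div_lt_one hm0]; linarith
      have harc : G.arc s' s ≤ ‖z - G.γ s'‖ + ‖G.γ s - z‖ := by
        refine G.arc_le_of_cone (w := s₁) ?_ ?_ ?_ ?_
        · rw [e2, e3, planeCross_smul_left, planeCross_smul_right, hp]
          have : planeCross (α • Y + β • E) (E - Y) = m * (-planeCross E Y) := by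
            rw [hmd]
            simp only [planeCross, PiLp.sub_apply, PiLp.add_apply, PiLp.smul_apply, smul_eq_mul]
            ring
          rw [this]
          have : 0 < -planeCross E Y := by linarith
          positivity
        · intro v hv
          rw [e2, planeCross_smul_left, planeCross_sub_sub _ _ _ x, planeCross_self, sub_zero]
          exact mul_nonneg hm2.le (hs' v hv)
        · intro t h0 h1 h2
          have h3 : 0 ≤ β / m := by positivity
          refine hsy (β / m + t * (1 - β / m)) (by nlinarith) (by nlinarith) ?_
          convert h2 using 1
          rw [hzr, hyx, hγs]; module
        · have : planeCross (G.γ s - G.γ s') (G.γ s₁ - G.γ s') = α * (τ - 1) * planeCross E Y := by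
            rw [hγs, hs1, hp']
            simp only [planeCross, PiLp.sub_apply, PiLp.add_apply, PiLp.smul_apply, smul_eq_mul]
            ring
          rw [this]
          exact mul_pos_of_neg_of_neg (by nlinarith) hD
      refine ⟨s', hs'v, z, β / m, m, by positivity, hr1.le, hzr, hm0.le, ?_, ?_⟩
      · rw [hz, add_sub_cancel_left, smul_smul, mul_inv_cancel₀ hm0.ne', one_smul, add_sub_cancel]
        exact G.γ_mem s'
      · have h5 : ‖z - x‖ - ‖G.γ s' - x‖ = ‖z - G.γ s'‖ := by
          rw [e2, norm_smul, Real.norm_of_nonneg hm2.le, hz, add_sub_cancel_left, norm_smul,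
            Real.norm_of_nonneg (by positivity)]
          ring
        rw [le_div_iff₀ hν]
        have h6 := norm_nonneg (z - G.γ s')
        have h7 := norm_nonneg (G.γ s - z)
        nlinarith [G.ν_le_one]
  · have hlt : G.arc q s < G.arc q s₁ := by
      apply G.arc_lt_of_planeCross_pos
      rw [planeCross_cyclic, show G.γ s₁ - G.γ s = (τ - 1) • E by rw [hs1, hγs]; module,
        planeCross_smul_left, planeCross_sub_sub _ _ _ x, hcq, ← hE, planeCross_self, sub_zero]
      have : 0 < k * (-αo * planeCross E Y) := mul_pos (by linarith) (mul_pos (by linarith) hD)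
      nlinarith
    refine ⟨s₁, hs1v, G.γ s, 1, 1, zero_le_one, le_rfl, by simp, zero_le_one,
        by simpa using G.γ_mem s, ?_⟩
    refine (sub_nonpos.2 hlt.le).trans (div_nonneg ?_ hν.le)
    rw [sub_self, norm_zero, add_zero, hn1, ← hE]
    nlinarith

/-- The fundamental first-order estimate for the value of counter-clockwise engagements. -/
theorem JL_sub_le {x y o : Plane} {q sx sy k ρ : ℝ}
    (hxy : ∀ t : ℝ, 0 ≤ t → t ≤ 1 → x + t • (y - x) ∉ G.T) (ho : Metric.ball o ρ ⊆ G.T)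
    (hd : dist x y < ρ) (hk : 1 < k) (hq : G.γ q = x + k • (o - x))
    (hqx : q ∉ G.visible x) (hsx : G.IsLeftBreach x sx) (hsy : sy ∈ G.visible y) :
    ∃ v ∈ G.T, G.JL sy q y - G.JL sx q x ≤ inner ℝ (y - x) (‖v - x‖⁻¹ • (v - x)) / G.ν := by
  obtain ⟨s', hs', z, r, t, hr0, hr1, hz, ht0, ht, harc⟩ :=
    G.exists_shortcut hxy ho hd hk hq hsy
  have hx : x ∉ G.T := by simpa using hxy 0 le_rfl zero_le_one
  refine ⟨_, ht, ?_⟩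
  have hν := G.ν_pos
  have h1 := hsx.2 q hqx s' hs'
  have htz : t • (z - x) ≠ 0 := fun h => hx (by rw [h, add_zero] at ht; exact ht)
  have ht' : 0 < t := ht0.lt_of_ne fun h => htz (by rw [← h, zero_smul])
  have hzx : z - x ≠ 0 := fun h => htz (by rw [h, smul_zero])
  have hzn : 0 < ‖z - x‖ := norm_pos_iff.2 hzx
  have hunit : ‖t • (z - x)‖⁻¹ • t • (z - x) = ‖z - x‖⁻¹ • (z - x) := by
    rw [norm_smul, Real.norm_of_nonneg ht0, smul_smul]
    congr 1; field_simp
  rw [add_sub_cancel_left, hunit]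
  -- The distance to z is convex and lies above its tangent at x.
  have h2 : ‖z - x‖ - ‖z - y‖ ≤ inner ℝ (y - x) (‖z - x‖⁻¹ • (z - x)) := by
    have h3 : inner ℝ (z - y) (‖z - x‖⁻¹ • (z - x)) ≤ ‖z - y‖ := by
      refine (real_inner_le_norm _ _).trans ?_
      rw [norm_smul, norm_inv, norm_norm, inv_mul_cancel₀ hzn.ne', mul_one]
    have h4 : inner ℝ (z - x) (‖z - x‖⁻¹ • (z - x)) = ‖z - x‖ := by
      rw [inner_smul_right, real_inner_self_eq_norm_sq]; field_simp
    have h5 : y - x = (z - x) - (z - y) := by abel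
    rw [h5, inner_sub_left, h4]
    linarith
  have h6 : ‖G.γ sy - y‖ = ‖z - y‖ + ‖G.γ sy - z‖ := by
    rw [show z - y = r • (G.γ sy - y) by rw [hz]; abel,
      show G.γ sy - z = (1 - r) • (G.γ sy - y) by rw [hz]; module, norm_smul, norm_smul,
      Real.norm_of_nonneg hr0, Real.norm_of_nonneg (by linarith)]
    ring
  simp only [JL, dist_eq_norm] at h1 ⊢
  rw [le_div_iff₀ hν] at harc ⊢
  have e1 : (G.arc q s' - ‖G.γ s' - x‖ / G.ν) * G.ν = G.arc q s' * G.ν - ‖G.γ s' - x‖ := by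
    field_simp
  have e2 : (G.arc q sx - ‖G.γ sx - x‖ / G.ν) * G.ν = G.arc q sx * G.ν - ‖G.γ sx - x‖ := by
    field_simp
  have e3 : (G.arc q sy - ‖G.γ sy - y‖ / G.ν) * G.ν = G.arc q sy * G.ν - ‖G.γ sy - y‖ := by
    field_simp
  have h7 := mul_le_mul_of_nonneg_right h1 hν.le
  rw [sub_mul, e2, e3]
  rw [e1, e2] at h7
  linarith

/-- Running towards the left breaching point does not change it. -/
theorem isLeftBreach_toward {x : Plane} (hx : x ∉ G.T) {s : ℝ} (hs : G.IsLeftBreach x s) {t : ℝ}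
    (h0 : 0 ≤ t) (h1 : t < 1) :
    x + t • (G.γ s - x) ∉ G.T ∧ G.visible (x + t • (G.γ s - x)) ⊆ G.visible x ∧
      G.IsLeftBreach (x + t • (G.γ s - x)) s := by
  have hy := (G.mem_visible_iff hx).1 hs.1 t h0 h1
  obtain ⟨y, hyd⟩ : ∃ y, y = x + t • (G.γ s - x) := ⟨_, rfl⟩
  rw [← hyd] at hy ⊢
  have hsub : G.visible y ⊆ G.visible x := by
    intro b hb
    by_contra hbx
    rw [G.mem_visible_iff hx] at hbx
    push Not at hbx
    obtain ⟨t₀, ht0, ht1, ht⟩ := hbx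
    have hden : 0 < 1 - t * t₀ := by nlinarith
    -- The parameter at which the segment from y to γ b crosses the segment from the blocking point
    -- to γ s, which lies in T.
    obtain ⟨r, hr⟩ : ∃ r, r = (1 - t) * t₀ / (1 - t * t₀) := ⟨_, rfl⟩
    have hr0 : 0 ≤ r := by rw [hr]; exact div_nonneg (mul_nonneg (by linarith) ht0) hden.le
    have hr1 : r < 1 := by rw [hr, div_lt_one hden]; linarith
    have hre : r = (1 - (1 - r) * t) * t₀ := by
      rw [hr]; field_simp; ring
    refine (G.mem_visible_iff hy).1 hb r hr0 hr1 ?_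
    have := G.convex_comb_mem ht (G.γ_mem s) (t := (1 - r) * t) (by nlinarith) (by nlinarith)
    convert this using 1
    rw [hyd]
    have e : x + t • (G.γ s - x) + r • (G.γ b - (x + t • (G.γ s - x))) =
        x + ((1 - r) * t) • (G.γ s - x) + r • (G.γ b - x) := by module
    rw [e]
    nth_rewrite 2 [hre]
    module
  refine ⟨hy, hsub, ?_⟩
  obtain ⟨q, hq⟩ := G.exists_not_visible hx
  have hsy : s ∈ G.visible y := by
    rw [G.mem_visible_iff hy]
    intro r hr0 hr1
    have := (G.mem_visible_iff hx).1 hs.1 (t + r * (1 - t)) (by nlinarith) (by nlinarith)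
    convert this using 2
    rw [hyd]; module
  refine G.isLeftBreach_of_maximal hy (fun h => hq (hsub h)) hsy fun b hb => ?_
  have h2 := hs.2 q hq b (hsub hb)
  -- The distance to γ s falls by the whole length of the step, and no other distance falls by more.
  have h3 : dist (G.γ s) y = dist (G.γ s) x - dist x y := by
    rw [dist_eq_norm, dist_eq_norm, dist_comm, dist_eq_norm, hyd, add_sub_cancel_left,
      show G.γ s - (x + t • (G.γ s - x)) = (1 - t) • (G.γ s - x) by module, norm_smul, norm_smul,
      Real.norm_of_nonneg h0, Real.norm_of_nonneg (by linarith)]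
    ring
  have h4 : dist (G.γ b) x - dist x y ≤ dist (G.γ b) y := by
    linarith [dist_triangle_right (G.γ b) x y]
  simp only [JL, h3] at h2 ⊢
  have h5 := div_le_div_of_nonneg_right h4 G.ν_pos.le
  rw [sub_div] at h5 ⊢
  linarith

end PerimeterGame

end

/-! ### Distances to the two breaching points -/

noncomputable section

namespace PerimeterGame

variable (G : PerimeterGame)

/-- Each breaching point competes with the other one: l is at least as good as r for J_L, and r at
least as good as l for J_R. Seen from a hidden q these are the two signs of the bound. -/
theorem arc_sR_le_arc_sL {x : Plane} {q l r : ℝ} (hq : q ∉ G.visible x) (hl : G.IsLeftBreach x l)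
    (hr : G.IsRightBreach x r) :
    |dist (G.γ l) x - dist (G.γ r) x| / G.ν ≤ G.arc q l - G.arc q r ∧
      G.arc r l = G.arc q l - G.arc q r := by
  have h1 := hl.2 q hq r hr.1
  have h2 := hr.2 q hq l hl.1
  simp only [JL, JR, G.arc_to_not_visible hq hl.1, G.arc_to_not_visible hq hr.1] at h1 h2
  have hν := G.ν_pos
  have h3 : |dist (G.γ l) x - dist (G.γ r) x| / G.ν ≤ G.arc q l - G.arc q r := by
    rw [show |dist (G.γ l) x - dist (G.γ r) x| / G.ν = |(dist (G.γ l) x - dist (G.γ r) x) / G.ν| by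
      rw [abs_div, abs_of_pos hν], abs_le, sub_div]
    constructor <;> linarith
  refine ⟨h3, G.arc_of_le ?_⟩
  have : 0 ≤ |dist (G.γ l) x - dist (G.γ r) x| / G.ν := by positivity
  linarith

/-- A short displacement p at an angle with cosine κ > ν reduces the distance A by more than νp.
Squaring A - νp ≤ d would give 2A(κ - ν) ≤ p(1 - ν²), which fails for p small compared with A. -/
theorem false_of_law_of_cosines {F A p ν κ d : ℝ} (hF : 0 < F) (hν : 0 < ν) (hκν : ν < κ)
    (hκ : κ ≤ 1) (hA : F / 2 ≤ A) (hp : 0 < p) (hpF : p ≤ F * (κ - ν) / 2)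
    (hd : d ^ 2 = A ^ 2 - 2 * A * p * κ + p ^ 2) (hle : A - ν * p ≤ d) : False := by
  have h0 : F * (κ - ν) ≤ F := mul_le_of_le_one_right hF.le (by linarith)
  have h1 : ν * p ≤ p := mul_le_of_le_one_left hp.le (by linarith)
  have h2 := pow_le_pow_left₀ (by linarith) hle 2
  rw [hd] at h2
  have h3 : 0 ≤ p * (p * (1 - ν ^ 2) - 2 * A * (κ - ν)) := by linarith
  have h4 := nonneg_of_mul_nonneg_right h3 hp
  have h5 : p * (1 - ν ^ 2) ≤ p := mul_le_of_le_one_right hp.le (by linarith [sq_nonneg ν])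
  have h6 : F * (κ - ν) ≤ 2 * A * (κ - ν) :=
    mul_le_mul_of_nonneg_right (by linarith) (by linarith)
  have h7 : 0 < F * (κ - ν) := mul_pos hF (by linarith)
  linarith

set_option maxHeartbeats 2000000 in
/-- The hidden side of the boundary between the breaching points is never a short cut. -/
theorem dist_sub_dist_le {x : Plane} (hx : x ∉ G.T) {l r : ℝ} (hl : G.IsLeftBreach x l)
    (hr : G.IsRightBreach x r) :
    dist (G.γ l) x - dist (G.γ r) x ≤ G.ν * (G.L - G.arc r l) := by
  by_contra hcon
  push Not at hcon
  have hν := G.ν_pos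
  have hν1 := G.ν_le_one
  obtain ⟨q, hq⟩ := G.exists_not_visible hx
  obtain ⟨hfree, harc⟩ := G.arc_sR_le_arc_sL hq hl hr
  have hdist : dist (G.γ l) x - dist (G.γ r) x ≤ G.ν * G.arc r l := by
    rw [harc, mul_comm, ← div_le_iff₀ hν]
    exact (div_le_div_of_nonneg_right (le_abs_self _) hν.le).trans hfree
  have hℓ0 : G.arc r l ≠ 0 := fun h => by
    rw [h] at hdist hcon
    nlinarith [G.L_pos]
  have hℓpos : 0 < G.arc r l := (G.arc_nonneg r l).lt_of_ne' hℓ0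
  have hchord : ‖G.γ l - G.γ r‖ ≤ G.L - G.arc r l := by
    rw [← G.arc_swap hℓ0, ← dist_eq_norm]; exact G.dist_γ_le_arc l r
  -- Under the assumption to be refuted the complementary arc is the shorter one.
  have hlt : G.L - G.arc r l < G.arc r l := by nlinarith
  obtain ⟨a, ha⟩ : ∃ a, a = G.γ l - G.γ r := ⟨_, rfl⟩
  rw [← ha] at hchord
  have ha0 : a ≠ 0 := by
    rw [ha, sub_ne_zero]
    intro h
    exact hℓ0 (G.arc_eq_zero_of_γ_eq h.symm)
  have han : 0 < ‖a‖ := norm_pos_iff.2 ha0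
  -- the boundary point farthest in front of the chord
  obtain ⟨p, hp, hmin⟩ := G.compact.exists_isMinOn (G.interior_nonempty.mono interior_subset)
    (continuous_planeCross a).continuousOn
  have hminT : ∀ v ∈ G.T, 0 ≤ planeCross a (v - p) := fun v hv => by
    rw [planeCross_sub_right]; linarith [show planeCross a p ≤ planeCross a v from hmin hv]
  -- Otherwise the arc from r to l is the chord itself, whose length is at most that of the
  -- complementary, shorter arc.
  have hpneg : planeCross a (p - G.γ r) < 0 := by
    by_contra hc
    push Not at hc
    have : G.arc r l ≤ ‖G.γ l - G.γ r‖ := by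
      refine G.arc_le_of_left fun v hv => ?_
      have := hminT v hv
      rw [planeCross_sub_sub _ _ _ (G.γ r)] at this
      rw [← ha]; linarith
    rw [← ha] at this
    linarith
  obtain ⟨b₀', hb0⟩ := G.exists_γ_eq hp fun hi => by
    obtain ⟨ε, hε, h⟩ := G.exists_pos_add_smul_mem hi (-planeRot a)
    have := hminT _ (interior_subset h)
    rw [add_sub_cancel_left, planeCross_smul_right, planeCross_neg_right] at this
    nlinarith [planeCross_planeRot_pos ha0]
  have hb0l : G.arc r b₀' < G.arc r l := by
    apply G.arc_lt_of_planeCross_pos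
    rw [← ha, planeCross_swap, hb0]; linarith
  obtain ⟨b₀, hb₀⟩ : ∃ b₀, b₀ = r + G.arc r b₀' := ⟨_, rfl⟩
  obtain ⟨l₀, hl₀⟩ : ∃ l₀, l₀ = r + G.arc r l := ⟨_, rfl⟩
  have hγb : G.γ b₀ = p := by rw [hb₀, G.γ_add_arc, hb0]
  have hγl : G.γ l₀ = G.γ l := by rw [hl₀, G.γ_add_arc]
  have hrb : r ≤ b₀ := by linarith [G.arc_nonneg r b₀']
  have hbl : b₀ < l₀ := by linarith
  have hlL : l₀ < r + G.L := by linarith [G.arc_lt r l]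
  have hl₀v : l₀ ∈ G.visible x := (G.visible_congr hγl).2 hl.1
  have hDx : planeCross (G.γ r - x) (G.γ l₀ - x) < 0 := by
    rw [hγl]
    exact G.planeCross_neg_of_arc_lt hx hq hr.1 hl.1 (by linarith)
  obtain ⟨-, α, β, hα, hβ, hαβ, hpx⟩ :=
    G.visible_of_between hx hr.1 hl₀v hDx hrb hbl.le hlL.le
  obtain ⟨R, hR⟩ : ∃ R, R = G.γ r - x := ⟨_, rfl⟩
  obtain ⟨F, hF⟩ : ∃ F, F = G.γ l - x := ⟨_, rfl⟩
  rw [hγl, ← hR, ← hF] at hDx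
  rw [hγl, hγb, ← hR, ← hF] at hpx
  have haF : a = F - R := by rw [ha, hF, hR]; abel
  have hp' : p = x + (α • R + β • F) := by rw [← hpx]; abel
  have hγr : G.γ r = x + R := by rw [hR]; abel
  have hγl' : G.γ l = x + F := by rw [hF]; abel
  have hFn : 0 < ‖F‖ := by
    rw [norm_pos_iff]
    rintro rfl
    rw [planeCross_zero_right] at hDx
    exact lt_irrefl _ hDx
  obtain ⟨K, hK⟩ : ∃ K, K = planeCross a F := ⟨_, rfl⟩
  have hKD : K = -planeCross R F := by
    rw [hK, haF, planeCross_sub_left, planeCross_self, zero_sub]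
  have hKpos : 0 < K := by linarith
  have hcx : planeCross a (p - G.γ r) = -(1 - α - β) * K := by
    rw [hp', hγr, hKD, haF]
    simp only [planeCross, PiLp.sub_apply, PiLp.add_apply, PiLp.smul_apply, smul_eq_mul]; ring
  have hm0 : 0 < 1 - α - β := by
    rw [hcx] at hpneg
    by_contra hc
    nlinarith
  have hlvis := (G.mem_visible_iff hx).1 hl.1
  rw [← hF] at hlvis
  have hα0 : 0 < α := by
    refine hα.lt_of_ne fun h => hlvis β hβ (by linarith) ?_
    rw [← h, zero_smul, zero_add] at hp'
    rw [← hp']; exact hp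
  obtain ⟨m, hm⟩ : ∃ m, m = 1 - α - β := ⟨_, rfl⟩
  rw [← hm] at hm0
  -- The point of the sight line to γ l on the parallel to the chord through p. The arc from p to γ
  -- l lies in the triangle p, z, γ l, so pieces of it are measured in the directions a and F.
  obtain ⟨z, hz⟩ : ∃ z, z = x + (α + β) • F := ⟨_, rfl⟩
  have hzp : z - p = α • a := by rw [hz, hp', haF]; module
  have hlz : G.γ l₀ - z = m • F := by rw [hγl, hγl', hz, hm]; module
  have hcone := fun (c : ℝ) (h1 : b₀ ≤ c) (h2 : c ≤ l₀) => G.arc_cone (s₁ := b₀) (s := l₀) (w := r)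
    (z := z) (by
      rw [hγb, hzp, hlz, planeCross_smul_left, planeCross_smul_right, ← hK]; positivity)
    (by
      intro v hv
      rw [hγb, hzp, planeCross_smul_left]
      exact mul_nonneg hα (hminT v hv))
    (by
      intro t h0 h1 h2
      refine hlvis (α + β + t * m) (by positivity) (by rw [hm] at *; nlinarith) ?_
      convert h2 using 1
      rw [hlz, hz]; module)
    (by
      have : planeCross (G.γ l₀ - G.γ b₀) (G.γ r - G.γ b₀) = -planeCross a (p - G.γ r) := by
        rw [hγl, hγb, ha]
        simp only [planeCross, PiLp.sub_apply]; ring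
      rw [this]; linarith)
    hbl.le (by linarith) h1 h2
  rw [hγb, hzp, hlz] at hcone
  obtain ⟨κ, hκ⟩ : ∃ κ, κ = inner ℝ F a / (‖F‖ * ‖a‖) := ⟨_, rfl⟩
  have hκe : inner ℝ F a = κ * (‖F‖ * ‖a‖) := by
    rw [hκ, div_mul_cancel₀ _ (by positivity)]
  have hκ1 : κ ≤ 1 := by
    rw [hκ, div_le_one (by positivity)]; exact real_inner_le_norm _ _
  have hdl : dist (G.γ l) x = ‖F‖ := by rw [dist_eq_norm, hF]
  have hdr : dist (G.γ r) x = ‖F - a‖ := by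
    rw [dist_eq_norm, ← hR, haF, sub_sub_cancel]
  -- κ is the cosine of the angle at γ l between the directions to x and to γ r. The assumption says
  -- that the chord changes the distance to x by more than ν‖a‖, and this change is at most κ‖a‖.
  have hκν : G.ν < κ := by
    have h1 : inner ℝ F (F - a) ≤ ‖F‖ * ‖F - a‖ := real_inner_le_norm _ _
    rw [inner_sub_right, real_inner_self_eq_norm_sq, hκe] at h1
    rw [hdl, hdr] at hcon
    have h2 : G.ν * ‖a‖ < ‖F‖ - ‖F - a‖ := by nlinarith
    have h3 : ‖F‖ - ‖F - a‖ ≤ κ * ‖a‖ := by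
      by_contra hc
      push Not at hc
      have := mul_lt_mul_of_pos_left hc hFn
      nlinarith
    exact lt_of_mul_lt_mul_right (h2.trans_le h3) han.le
  -- a point of the arc close to the left breaching point
  obtain ⟨η, hη0, hη1, hη2, hη3⟩ : ∃ η : ℝ, 0 < η ∧ η ≤ l₀ - b₀ ∧
      ‖F‖ * ‖a‖ * η ≤ K * (‖F‖ * (κ - G.ν) / 2) ∧ ‖a‖ * η ≤ K * (1 / 2) := by
    refine ⟨min (l₀ - b₀) (min (K * (‖F‖ * (κ - G.ν) / 2) / (‖F‖ * ‖a‖)) (K * (1 / 2) / ‖a‖)),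
      ?_, min_le_left _ _, ?_, ?_⟩
    · have : 0 < κ - G.ν := by linarith
      exact lt_min (by linarith) (lt_min (by positivity) (by positivity))
    · have h1 := (min_le_right (l₀ - b₀) (min (K * (‖F‖ * (κ - G.ν) / 2) / (‖F‖ * ‖a‖))
        (K * (1 / 2) / ‖a‖))).trans (min_le_left _ _)
      rw [le_div_iff₀ (by positivity)] at h1
      linarith
    · have h1 := (min_le_right (l₀ - b₀) (min (K * (‖F‖ * (κ - G.ν) / 2) / (‖F‖ * ‖a‖))
        (K * (1 / 2) / ‖a‖))).trans (min_le_right _ _)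
      rw [le_div_iff₀ (by positivity)] at h1
      linarith
  obtain ⟨b, hb⟩ : ∃ b, b = l₀ - η := ⟨_, rfl⟩
  obtain ⟨P', Q', hP', hQ', hdec, hlen⟩ := hcone b (by linarith) (by linarith)
  obtain ⟨P, hP⟩ : ∃ P, P = P' * α := ⟨_, rfl⟩
  obtain ⟨Q, hQ⟩ : ∃ Q, Q = Q' * m := ⟨_, rfl⟩
  have hP0 : 0 ≤ P := by rw [hP]; positivity
  have hQ0 : 0 ≤ Q := by rw [hQ]; positivity
  rw [smul_smul, smul_smul, ← hP, ← hQ] at hdec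
  rw [norm_smul, norm_smul, Real.norm_of_nonneg hα, Real.norm_of_nonneg hm0.le, ← mul_assoc,
    ← mul_assoc, ← hP, ← hQ] at hlen
  have hnear : ‖G.γ l₀ - G.γ b‖ ≤ η := by
    rw [← dist_eq_norm]
    refine (G.dist_γ_le _ _).trans ?_
    rw [hb, sub_sub_cancel, abs_of_pos hη0]
  have hPK : P * K ≤ η * ‖F‖ := by
    have h1 := congrArg (fun v => planeCross v F) hdec
    simp only [planeCross_add_left, planeCross_smul_left, planeCross_self, mul_zero, add_zero,
      ← hK] at h1
    rw [← h1]
    refine ((le_abs_self _).trans (abs_planeCross_le _ _)).trans ?_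
    gcongr
  have hQK : Q * K ≤ ‖a‖ * η := by
    have h1 := congrArg (planeCross a) hdec
    simp only [planeCross_comb, planeCross_self, mul_zero, zero_add, ← hK] at h1
    rw [← h1]
    refine ((le_abs_self _).trans (abs_planeCross_le _ _)).trans ?_
    gcongr
  have hQ1 : Q ≤ 1 / 2 := by
    have : Q * K ≤ 1 / 2 * K := by linarith
    exact le_of_mul_le_mul_right this hKpos
  have hP1 : P * ‖a‖ ≤ ‖F‖ * (κ - G.ν) / 2 := by
    have h1 : (P * ‖a‖) * K ≤ (‖F‖ * (κ - G.ν) / 2) * K := by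
      have := mul_le_mul_of_nonneg_right hPK han.le
      linarith
    exact le_of_mul_le_mul_right h1 hKpos
  have hγb' : G.γ b - x = (1 - Q) • F - P • a := by
    have : G.γ b = G.γ l₀ - (P • a + Q • F) := by rw [← hdec]; abel
    rw [this, hγl, hγl']; module
  -- Without a component along the chord, γ b would coincide with γ l or block the view of it.
  have hPpos : 0 < P := by
    refine hP0.lt_of_ne fun h => ?_
    rw [← h, zero_smul, sub_zero] at hγb'
    have hmem : x + (1 - Q) • F ∈ G.T := by
      rw [← hγb', add_sub_cancel]; exact G.γ_mem b
    rcases hQ0.eq_or_lt with h0 | h0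
    · have h2 : G.γ b = G.γ l₀ := by
        rw [← h, ← h0, zero_smul, zero_smul, add_zero, sub_eq_zero] at hdec
        exact hdec.symm
      have h3 := G.arc_eq_zero_of_γ_eq h2
      rw [G.arc_eq_sub (by linarith) (by linarith)] at h3
      linarith
    · exact hlvis (1 - Q) (by linarith) (by linarith) hmem
  have hbvis : b ∈ G.visible x := by
    have hDx' : planeCross (G.γ r - x) (G.γ l₀ - x) < 0 := by rw [hγl, ← hR, ← hF]; exact hDx
    exact (G.visible_of_between hx hr.1 hl₀v hDx' (by linarith) (by linarith) hlL.le).1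
  -- Optimality of l for J_L against b, which lies back by an arc of at most P‖a‖ + Q‖F‖. The law of
  -- cosines contradicts it.
  have hopt : ‖F‖ - ‖G.γ b - x‖ ≤ G.ν * (P * ‖a‖ + Q * ‖F‖) := by
    have h1 := hl.2 q hq b hbvis
    have h2 := G.arc_triangle q b l₀
    rw [G.arc_eq_sub (by linarith : b ≤ l₀) (by linarith)] at h2
    have h3 : G.arc q l₀ = G.arc q l := by
      obtain ⟨k, hk⟩ := G.exists_arc_eq r l
      exact G.arc_congr k (by rw [hl₀, hk]; ring)
    simp only [JL, dist_eq_norm, ← hF] at h1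
    have h4 : (‖F‖ - ‖G.γ b - x‖) / G.ν ≤ P * ‖a‖ + Q * ‖F‖ := by
      rw [sub_div]; linarith
    rw [div_le_iff₀ hν] at h4
    linarith
  have hsq : ‖G.γ b - x‖ ^ 2 = ((1 - Q) * ‖F‖) ^ 2 - 2 * ((1 - Q) * ‖F‖) * (P * ‖a‖) * κ +
      (P * ‖a‖) ^ 2 := by
    rw [hγb', norm_sub_sq_real, norm_smul, norm_smul, Real.norm_of_nonneg (by linarith),
      Real.norm_of_nonneg hP0, inner_smul_left, inner_smul_right, hκe]
    simp
    ring
  obtain ⟨A, hA⟩ : ∃ A, A = (1 - Q) * ‖F‖ := ⟨_, rfl⟩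
  obtain ⟨p₁, hp₁⟩ : ∃ p₁, p₁ = P * ‖a‖ := ⟨_, rfl⟩
  rw [← hA, ← hp₁] at hsq
  rw [← hp₁] at hP1 hopt
  have hA2 : ‖F‖ / 2 ≤ A := by rw [hA]; nlinarith
  have hp1 : 0 < p₁ := by rw [hp₁]; positivity
  have hge : A - G.ν * p₁ ≤ ‖G.γ b - x‖ := by
    rw [hA]
    have : G.ν * (Q * ‖F‖) ≤ Q * ‖F‖ := by
      have : 0 ≤ Q * ‖F‖ := by positivity
      nlinarith
    linarith
  exact false_of_law_of_cosines hFn hν hκν hκ1 hA2 hp1 hP1 hsq hge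

/-- The distances to the breaching points of a point off the interior of the target. -/
theorem abs_dist_sub_dist_le {x : Plane} {l r : ℝ}
    (hl : G.IsLeftBreach x l) (hr : G.IsRightBreach x r) :
    |dist (G.γ l) x - dist (G.γ r) x| / G.ν ≤ G.arc r l ∧
      |dist (G.γ l) x - dist (G.γ r) x| / G.ν ≤ G.L - G.arc r l := by
  by_cases hxT : x ∈ G.T
  · rw [G.isLeftBreach_of_mem hxT] at hl
    rw [G.isRightBreach_of_mem hxT] at hr
    rw [hl, hr]
    simp only [dist_self, sub_self, abs_zero, zero_div]
    exact ⟨G.arc_nonneg _ _, by linarith [G.arc_lt r l]⟩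
  obtain ⟨q, hq⟩ := G.exists_not_visible hxT
  obtain ⟨h1, h2⟩ := G.arc_sR_le_arc_sL hq hl hr
  refine ⟨by rwa [h2], ?_⟩
  rw [div_le_iff₀ G.ν_pos, mul_comm, abs_le]
  refine ⟨?_, G.dist_sub_dist_le hxT hl hr⟩
  -- Reflection exchanges the two breaching points and yields the opposite inequality.
  have hl' : G.mirror.IsRightBreach (planeRefl x) (-l) := by
    rw [isRightBreach_mirror, neg_neg]; exact hl
  have hr' : G.mirror.IsLeftBreach (planeRefl x) (-r) := by
    rw [isLeftBreach_mirror, neg_neg]; exact hr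
  have := G.mirror.dist_sub_dist_le (G.planeRefl_mem_mirror.not.2 hxT) hr' hl'
  simp only [mirror_γ, mirror_ν, mirror_L, mirror_arc, neg_neg, LinearIsometryEquiv.dist_map] at this
  linarith

end PerimeterGame

end

noncomputable section

namespace PerimeterGame

variable (G : PerimeterGame)

/-! ### The boundary as a circle -/

theorem coe_arc (a b : ℝ) : ((G.arc a b : ℝ) : AddCircle G.L) = (b : AddCircle G.L) - a := by
  obtain ⟨k, hk⟩ := G.exists_arc_eq a b
  rw [hk, AddCircle.coe_add, AddCircle.coe_sub, add_eq_left, AddCircle.coe_eq_zero_iff]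
  exact ⟨k, by rw [zsmul_eq_mul]⟩

theorem circle_eq_iff {a b : ℝ} :
    (a : AddCircle G.L) = b ↔ ∃ k : ℤ, a = b + k * G.L := by
  rw [← sub_eq_zero, ← AddCircle.coe_sub, AddCircle.coe_eq_zero_iff]
  constructor
  · rintro ⟨k, hk⟩
    exact ⟨k, by rw [zsmul_eq_mul] at hk; linarith⟩
  · rintro ⟨k, hk⟩
    exact ⟨k, by rw [zsmul_eq_mul]; linarith⟩

theorem γ_eq_of_circle_eq {a b : ℝ} (h : (a : AddCircle G.L) = b) : G.γ a = G.γ b := by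
  obtain ⟨k, rfl⟩ := G.circle_eq_iff.1 h
  exact G.γ_add_int _ _

theorem circle_eq_of_γ_eq {a b : ℝ} (h : G.γ a = G.γ b) : (a : AddCircle G.L) = b := by
  have := G.coe_arc a b
  rw [G.arc_eq_zero_of_γ_eq h, AddCircle.coe_zero] at this
  exact (sub_eq_zero.1 this.symm).symm

theorem norm_circle {t : ℝ} (h : |t| ≤ G.L / 2) : ‖(t : AddCircle G.L)‖ = |t| := by
  rwa [AddCircle.norm_coe_eq_abs_iff G.L G.L_pos.ne', abs_of_pos G.L_pos]

theorem norm_circle_of_nonneg {t : ℝ} (h0 : 0 ≤ t) (h : t ≤ G.L / 2) :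
    ‖(t : AddCircle G.L)‖ = t := by
  rw [G.norm_circle (by rwa [abs_of_nonneg h0]), abs_of_nonneg h0]

theorem exists_circle_rep (θ : AddCircle G.L) :
    ∃ g : ℝ, (g : AddCircle G.L) = θ ∧ ‖θ‖ = |g| ∧ |g| ≤ G.L / 2 := by
  obtain ⟨x, rfl⟩ := QuotientAddGroup.mk_surjective θ
  have h1 : ‖(x : AddCircle G.L)‖ = |x - round (G.L⁻¹ * x) * G.L| :=
    AddCircle.norm_eq G.L
  refine ⟨x - round (G.L⁻¹ * x) * G.L, ?_, h1, ?_⟩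
  · exact G.circle_eq_iff.2 ⟨-round (G.L⁻¹ * x), by push_cast; ring⟩
  · rw [← h1]
    have := AddCircle.norm_le_half_period G.L (x := (x : AddCircle G.L)) G.L_pos.ne'
    rwa [abs_of_pos G.L_pos] at this

theorem norm_circle_le (t : ℝ) : ‖(t : AddCircle G.L)‖ ≤ |t| := by
  rcases le_total |t| (G.L / 2) with h | h
  · exact (G.norm_circle h).le
  · have := AddCircle.norm_le_half_period G.L (x := (t : AddCircle G.L)) G.L_pos.ne'
    rw [abs_of_pos G.L_pos] at this
    exact this.trans h

theorem norm_circle_le_half (θ : AddCircle G.L) : ‖θ‖ ≤ G.L / 2 := by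
  have := AddCircle.norm_le_half_period G.L (x := θ) G.L_pos.ne'
  rwa [abs_of_pos G.L_pos] at this

theorem dist_γ_le_norm (a b : ℝ) : dist (G.γ a) (G.γ b) ≤ ‖(a : AddCircle G.L) - b‖ := by
  obtain ⟨g, hg, hn, -⟩ := G.exists_circle_rep ((a : AddCircle G.L) - b)
  rw [hn, G.γ_eq_of_circle_eq (a := a) (b := b + g) (by rw [AddCircle.coe_add, hg]; abel)]
  refine (G.dist_γ_le _ _).trans ?_
  rw [add_sub_cancel_left]

/-! ### The midpoint of an engagement and the cost of reaching it -/

/-- The defender position for which both breaching points are equally good. -/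
def mid (x : Plane) : AddCircle G.L :=
  (G.sR x + (G.arc (G.sR x) (G.sL x) +
    (dist (G.γ (G.sR x)) x - dist (G.γ (G.sL x)) x) / G.ν) / 2 : ℝ)

/-- The value against a defender at the midpoint. -/
def cc (x : Plane) : ℝ :=
  (G.arc (G.sR x) (G.sL x) - (dist (G.γ (G.sL x)) x + dist (G.γ (G.sR x)) x) / G.ν) / 2

/-- The first bound places the midpoint on the arc from s_R to s_L, the second places its antipode
on the complementary arc. Therefore both clauses in the definition of the left region say that the
midpoint is ahead of the defender by less than half a turn counter-clockwise. -/
theorem offset_bounds {x : Plane} (hx : x ∉ interior G.T) :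
    |(dist (G.γ (G.sR x)) x - dist (G.γ (G.sL x)) x) / G.ν| ≤ G.arc (G.sR x) (G.sL x) ∧
      |(dist (G.γ (G.sR x)) x - dist (G.γ (G.sL x)) x) / G.ν| ≤
        G.L - G.arc (G.sR x) (G.sL x) := by
  have := G.abs_dist_sub_dist_le (G.sL_spec hx) (G.sR_spec hx)
  rwa [abs_sub_comm, show |dist (G.γ (G.sR x)) x - dist (G.γ (G.sL x)) x| / G.ν =
    |(dist (G.γ (G.sR x)) x - dist (G.γ (G.sL x)) x) / G.ν| by
      rw [abs_div, abs_of_pos G.ν_pos]] at this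

open Classical in
/-- The two cases for the relative position of defender and midpoint. -/
theorem state_cases {x : Plane} (hx : x ∉ interior G.T) (s : ℝ) :
    (x ∈ G.leftRegion s ∧ ∃ g, 0 < g ∧ g ≤ G.L / 2 ∧ G.mid x = s + (g : ℝ) ∧
        G.V s x = G.cc x + g) ∨
      (x ∉ G.leftRegion s ∧ ∃ g, 0 ≤ g ∧ g ≤ G.L / 2 ∧ G.mid x = s - (g : ℝ) ∧
        G.V s x = G.cc x + g ∧ (g = 0 → x ∈ G.afferentSurface s)) := by
  obtain ⟨h1, h2⟩ := G.offset_bounds hx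
  have hV : G.V s x = if x ∈ G.leftRegion s then G.JLstar s x else G.JRstar s x := by
    rw [V]
  have hL : x ∈ G.leftRegion s ↔ ((G.arc (G.sR x) s ≤ G.arc (G.sR x) (G.sL x) ∧
      G.JRstar s x < G.JLstar s x) ∨ (¬ G.arc (G.sR x) s ≤ G.arc (G.sR x) (G.sL x) ∧
      G.JLstar s x < G.JRstar s x)) := by
    simp only [leftRegion, seg, mem_ofPred_eq, hx, not_false_eq_true, true_and]
  have hA : G.JLstar s x = G.JRstar s x → G.arc (G.sR x) s ≤ G.arc (G.sR x) (G.sL x) →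
      x ∈ G.afferentSurface s := fun h3 h4 => ⟨⟨hx, h3⟩, h4⟩
  have hs : (s : AddCircle G.L) = (G.sR x + G.arc (G.sR x) s : ℝ) := by
    rw [AddCircle.coe_add, coe_arc]; abel
  have e1 : G.JRstar s x = G.arc (G.sR x) s - dist (G.γ (G.sR x)) x / G.ν := rfl
  have e2 : G.JLstar s x = G.arc s (G.sL x) - dist (G.γ (G.sL x)) x / G.ν := rfl
  have hh0 := G.arc_nonneg (G.sR x) s
  have hhL := G.arc_lt (G.sR x) s
  have harc : (G.arc (G.sR x) s ≤ G.arc (G.sR x) (G.sL x) →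
        G.arc s (G.sL x) = G.arc (G.sR x) (G.sL x) - G.arc (G.sR x) s) ∧
      (¬ G.arc (G.sR x) s ≤ G.arc (G.sR x) (G.sL x) →
        G.arc s (G.sL x) = G.L - (G.arc (G.sR x) s - G.arc (G.sR x) (G.sL x))) := by
    refine ⟨fun h => G.arc_of_le h, fun h => ?_⟩
    push Not at h
    rw [← G.arc_of_le h.le, G.arc_swap]
    rw [G.arc_of_le h.le]; linarith
  have hmid : G.mid x = (G.sR x + (G.arc (G.sR x) (G.sL x) +
    (dist (G.γ (G.sR x)) x - dist (G.γ (G.sL x)) x) / G.ν) / 2 : ℝ) := rfl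
  have hcc : G.cc x = (G.arc (G.sR x) (G.sL x) - (dist (G.γ (G.sL x)) x +
    dist (G.γ (G.sR x)) x) / G.ν) / 2 := rfl
  rw [hV, hL, hmid, hs, hcc]
  rw [e1, e2] at hA ⊢
  -- What remains is arithmetic with ℓ = arc from s_R to s_L, h = arc from s_R to the defender, and
  -- the two running times a = d_R/ν, b = d_L/ν.
  clear hV hL hmid hcc hs e1 e2
  revert h1 h2 hA hh0 hhL harc
  generalize G.arc (G.sR x) (G.sL x) = ℓ
  generalize G.arc (G.sR x) s = h
  generalize G.arc s (G.sL x) = e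
  generalize dist (G.γ (G.sR x)) x = dR
  generalize dist (G.γ (G.sL x)) x = dL
  rw [sub_div dR dL, add_div dL dR]
  generalize dR / G.ν = a
  generalize dL / G.ν = b
  intro h1 h2 hA hh0 hhL harc
  rw [abs_le] at h1 h2
  by_cases hle : h ≤ ℓ
  · rw [harc.1 hle] at hA ⊢
    simp only [hle, true_and, not_true_eq_false, false_and, or_false]
    by_cases hlt : h - a < ℓ - h - b
    · simp only [hlt, true_and, if_true, not_true_eq_false, false_and, or_false]
      refine ⟨(ℓ + (a - b)) / 2 - h, by linarith, by linarith, ?_, by ring⟩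
      rw [← AddCircle.coe_add]; congr 1; ring
    · simp only [hlt, false_and, if_false, not_false_eq_true, true_and, false_or]
      refine ⟨h - (ℓ + (a - b)) / 2, by linarith, by linarith, ?_, by ring, fun h0 => hA ?_ hle⟩
      · rw [← AddCircle.coe_sub]; congr 1; ring
      · linarith
  · rw [harc.2 hle]
    simp only [hle, false_and, not_false_eq_true, true_and, false_or]
    push Not at hle
    by_cases hlt : G.L - (h - ℓ) - b < h - a
    · simp only [hlt, true_and, if_true, not_true_eq_false, false_and, or_false]
      -- The defender is past s_L and reaches the midpoint counter-clockwise by way of s_R, hence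
      -- the extra turn.
      refine ⟨(ℓ + (a - b)) / 2 - h + G.L, by linarith, by linarith, ?_, by ring⟩
      rw [← AddCircle.coe_add]
      exact G.circle_eq_iff.2 ⟨-1, by push_cast; ring⟩
    · simp only [hlt, false_and, if_false, not_false_eq_true, true_and, false_or]
      refine ⟨h - (ℓ + (a - b)) / 2, by linarith, by linarith, ?_, by ring, fun h0 => ?_⟩
      · rw [← AddCircle.coe_sub]; congr 1; ring
      · exfalso; linarith

/-- This separates the state: the defender enters only through its circular distance from the
midpoint. -/
theorem V_eq {x : Plane} (hx : x ∉ interior G.T) (s : ℝ) :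
    G.V s x = G.cc x + ‖(s : AddCircle G.L) - G.mid x‖ := by
  rcases G.state_cases hx s with ⟨-, g, h0, h1, h2, h3⟩ | ⟨-, g, h0, h1, h2, h3, -⟩
  · rw [h2, h3, sub_add_cancel_left, norm_neg, G.norm_circle_of_nonneg h0.le h1]
  · rw [h2, h3, sub_sub_cancel, G.norm_circle_of_nonneg h0 h1]

theorem mem_afferentSurface_iff {x : Plane} {s : ℝ} :
    x ∈ G.afferentSurface s ↔ x ∉ interior G.T ∧ (s : AddCircle G.L) = G.mid x := by
  constructor
  · rintro ⟨⟨hx, he⟩, hs⟩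
    refine ⟨hx, ?_⟩
    have h1 : G.arc s (G.sL x) = G.arc (G.sR x) (G.sL x) - G.arc (G.sR x) s := G.arc_of_le hs
    simp only [JLstar, JRstar, JL, JR, h1] at he
    have hs : (s : AddCircle G.L) = (G.sR x + G.arc (G.sR x) s : ℝ) := by
      rw [AddCircle.coe_add, coe_arc]; abel
    rw [hs, mid]
    congr 2
    rw [sub_div]
    linarith
  · rintro ⟨hx, he⟩
    rcases G.state_cases hx s with ⟨-, g, h0, h1, h2, -⟩ | ⟨-, g, h0, h1, h2, -, h4⟩
    · rw [← he, left_eq_add] at h2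
      have := G.norm_circle_of_nonneg h0.le h1
      rw [h2, norm_zero] at this
      linarith
    · rw [← he, eq_sub_iff_add_eq, add_eq_left] at h2
      have := G.norm_circle_of_nonneg h0 h1
      rw [h2, norm_zero] at this
      exact h4 this.symm

/-- Away from coincidence and from the antipode, the side on which the midpoint lies within half a
turn is unique. -/
theorem mem_leftRegion_of_lt {x : Plane} (hx : x ∉ interior G.T) {s g : ℝ} (h0 : 0 < g)
    (h1 : g < G.L / 2) (h2 : G.mid x = s + (g : ℝ)) : x ∈ G.leftRegion s := by
  rcases G.state_cases hx s with ⟨h, -⟩ | ⟨-, g', h0', h1', h2', -⟩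
  · exact h
  · rw [h2, sub_eq_add_neg, add_right_inj, ← AddCircle.coe_neg, G.circle_eq_iff] at h2'
    obtain ⟨k, hk⟩ := h2'
    have hL := G.L_pos
    have h3 : (0 : ℝ) < k := by
      by_contra hc
      push Not at hc
      nlinarith
    have h4 : (1 : ℝ) ≤ k := by exact_mod_cast h3
    nlinarith

theorem notMem_leftRegion_of_lt {x : Plane} (hx : x ∉ interior G.T) {s g : ℝ} (h0 : 0 < g)
    (h1 : g < G.L / 2) (h2 : G.mid x = s - (g : ℝ)) : x ∉ G.leftRegion s := by
  rcases G.state_cases hx s with ⟨-, g', h0', h1', h2', -⟩ | ⟨h, -⟩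
  · rw [h2, sub_eq_add_neg, add_right_inj, ← AddCircle.coe_neg, G.circle_eq_iff] at h2'
    obtain ⟨k, hk⟩ := h2'
    have hL := G.L_pos
    have h3 : (k : ℝ) < 0 := by
      by_contra hc
      push Not at hc
      nlinarith
    have h4 : (k : ℝ) ≤ -1 := by
      have : k < 0 := by exact_mod_cast h3
      exact_mod_cast Int.le_sub_one_of_lt this
    nlinarith
  · exact h

/-! ### The midpoint seen from a hidden boundary point -/

/-- Adding and subtracting, cc + mid and cc - mid become J_L* and J_R* up to constants as long as q
stays hidden. So estimates for the two critical values control cc and mid together. -/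
theorem lift_of_not_visible {x : Plane} (hx : x ∉ interior G.T) {q : ℝ} (hq : q ∉ G.visible x) :
    G.mid x = (q + (G.JLstar q x - G.JRstar q x + G.L) / 2 : ℝ) ∧
      G.cc x = (G.JLstar q x + G.JRstar q x - G.L) / 2 := by
  have hl := G.sL_spec hx
  have hr := G.sR_spec hx
  obtain ⟨-, h1⟩ := G.arc_sR_le_arc_sL hq hl hr
  have e1 : G.JRstar q x = G.arc (G.sR x) q - dist (G.γ (G.sR x)) x / G.ν := rfl
  have e2 : G.JLstar q x = G.arc q (G.sL x) - dist (G.γ (G.sL x)) x / G.ν := rfl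
  rw [mid, cc, e1, e2, h1, G.arc_to_not_visible hq hr.1]
  constructor
  · have h2 : (G.sR x : AddCircle G.L) = (q + G.arc q (G.sR x) : ℝ) := by
      rw [AddCircle.coe_add, coe_arc]; abel
    rw [AddCircle.coe_add, h2, ← AddCircle.coe_add]
    congr 1
    ring
  · ring

theorem JL_le_JLstar {x : Plane} (hx : x ∉ interior G.T) {q b : ℝ} (hq : q ∉ G.visible x)
    (hb : b ∈ G.visible x) : G.arc q b - dist (G.γ b) x / G.ν ≤ G.JLstar q x :=
  (G.sL_spec hx).2 q hq b hb

theorem JR_le_JRstar {x : Plane} (hx : x ∉ interior G.T) {q b : ℝ} (hq : q ∉ G.visible x)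
    (hb : b ∈ G.visible x) : G.L - G.arc q b - dist (G.γ b) x / G.ν ≤ G.JRstar q x := by
  rw [← G.arc_to_not_visible hq hb]
  exact (G.sR_spec hx).2 q hq b hb

theorem neg_dist_le_cc {x : Plane} (hx : x ∉ G.T) {b : ℝ} (hb : b ∈ G.visible x) :
    -(dist (G.γ b) x / G.ν) ≤ G.cc x := by
  have hx' : x ∉ interior G.T := fun h => hx (interior_subset h)
  obtain ⟨q, hq⟩ := G.exists_not_visible hx
  rw [(G.lift_of_not_visible hx' hq).2]
  linarith [G.JL_le_JLstar hx' hq hb, G.JR_le_JRstar hx' hq hb]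

/-- Comparing b with both breaching points shows |mid - b| ≤ cc + d/ν in the lift, where d is the
distance to γ b. -/
theorem norm_mid_sub_le {x : Plane} (hx : x ∉ G.T) {b : ℝ} (hb : b ∈ G.visible x)
    (hc : G.cc x ≤ 0) : ‖G.mid x - b‖ ≤ dist (G.γ b) x / G.ν := by
  have hx' : x ∉ interior G.T := fun h => hx (interior_subset h)
  obtain ⟨q, hq⟩ := G.exists_not_visible hx
  obtain ⟨h1, h2⟩ := G.lift_of_not_visible hx' hq
  have h3 : (b : AddCircle G.L) = (q + G.arc q b : ℝ) := by
    rw [AddCircle.coe_add, coe_arc]; abel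
  rw [h1, h3, ← AddCircle.coe_sub]
  refine (G.norm_circle_le _).trans ?_
  rw [abs_le]
  constructor <;> linarith [G.JL_le_JLstar hx' hq hb, G.JR_le_JRstar hx' hq hb]

theorem frontier_values {x : Plane} (hx : x ∉ interior G.T) (hxT : x ∈ G.T) {b : ℝ}
    (hb : G.γ b = x) : G.cc x = 0 ∧ G.mid x = b := by
  have hl := (G.isLeftBreach_of_mem hxT).1 (G.sL_spec hx)
  have hr := (G.isRightBreach_of_mem hxT).1 (G.sR_spec hx)
  have h0 : G.arc (G.sR x) (G.sL x) = 0 := G.arc_eq_zero_of_γ_eq (hr.trans hl.symm)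
  rw [cc, mid, h0, hl, hr]
  simp only [dist_self, sub_zero, add_zero, zero_div, true_and]
  exact G.circle_eq_of_γ_eq (hr.trans hb.symm)

theorem V_γ (s b : ℝ) : G.V s (G.γ b) = ‖(s : AddCircle G.L) - b‖ := by
  obtain ⟨h1, h2⟩ := G.frontier_values (G.γ_notMem_interior b) (G.γ_mem b) rfl
  rw [G.V_eq (G.γ_notMem_interior b), h1, h2, zero_add]

end PerimeterGame

end

/-! ### Hidden base points and local lifts of the midpoint -/

noncomputable section

namespace PerimeterGame

variable (G : PerimeterGame)

/-- The breaching point selected by `Classical.epsilon` may be replaced by any other when the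
defender is hidden. -/
theorem JLstar_eq {x : Plane} {q l : ℝ} (hq : q ∉ G.visible x) (hl : G.IsLeftBreach x l) :
    G.JLstar q x = G.JL l q x :=
  have hx : G.IsLeftBreach x (G.sL x) := Classical.epsilon_spec ⟨l, hl⟩
  le_antisymm (hl.2 q hq _ hx.1) (hx.2 q hq _ hl.1)

theorem JRstar_eq {x : Plane} {q r : ℝ} (hq : q ∉ G.visible x) (hr : G.IsRightBreach x r) :
    G.JRstar q x = G.JR r q x :=
  have hx : G.IsRightBreach x (G.sR x) := Classical.epsilon_spec ⟨r, hr⟩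
  le_antisymm (hr.2 q hq _ hx.1) (hx.2 q hq _ hr.1)

theorem notMem_visible_mirror {x : Plane} {q : ℝ} :
    -q ∉ G.mirror.visible (planeRefl x) ↔ q ∉ G.visible x := by
  rw [mem_visible_mirror, neg_neg]

theorem mirror_JLstar {x : Plane} (hx : x ∉ interior G.T) {q : ℝ} (hq : q ∉ G.visible x) :
    G.mirror.JLstar (-q) (planeRefl x) = G.JRstar q x := by
  have h := G.sR_spec hx
  rw [G.mirror.JLstar_eq (G.notMem_visible_mirror.2 hq) (l := -G.sR x)
    (by rw [isLeftBreach_mirror, neg_neg]; exact h), mirror_JL, neg_neg, neg_neg]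
  rfl

/-- The ray from `x` through the boundary point `q` has met the interior of the target before, at
the centre of a disc of radius `ρ` in the target. -/
def Deep (ρ : ℝ) (x : Plane) (q : ℝ) : Prop :=
  ∃ (o : Plane) (k : ℝ), 1 < k ∧ G.γ q = x + k • (o - x) ∧ Metric.ball o ρ ⊆ G.T

variable {G}

theorem Deep.notMem_visible {ρ : ℝ} {x : Plane} {q : ℝ} (h : G.Deep ρ x q) (hρ : 0 < ρ)
    (hx : x ∉ G.T) : q ∉ G.visible x := by
  obtain ⟨o, k, hk, hq, ho⟩ := h
  exact G.not_visible_of_interior hx (ho (Metric.mem_ball_self hρ)) hk hq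

theorem Deep.mirror {ρ : ℝ} {x : Plane} {q : ℝ} (h : G.Deep ρ x q) :
    G.mirror.Deep ρ (planeRefl x) (-q) := by
  obtain ⟨o, k, hk, hq, ho⟩ := h
  refine ⟨planeRefl o, k, hk, ?_, fun v hv => ?_⟩
  · rw [mirror_γ, neg_neg, hq, map_add, map_smul, map_sub]
  · rw [← planeRefl_planeRefl v] at hv ⊢
    rw [planeRefl_mem_mirror]
    rw [Metric.mem_ball, LinearIsometryEquiv.dist_map] at hv
    exact ho hv

/-- The centre is the image of the observer under the homothety with centre γ q and ratio 1 - 1/k,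
so it moves less than the observer. -/
theorem Deep.of_dist_le {ρ r : ℝ} {x y : Plane} {q : ℝ} (h : G.Deep ρ x q) (hr : dist y x ≤ r) :
    G.Deep (ρ - r) y q := by
  obtain ⟨o, k, hk, hq, ho⟩ := h
  have hk0 : k ≠ 0 := by positivity
  refine ⟨y + k⁻¹ • (G.γ q - y), k, hk, ?_, fun v hv => ho ?_⟩
  · rw [add_sub_cancel_left, smul_smul, mul_inv_cancel₀ hk0, one_smul, add_sub_cancel]
  · rw [Metric.mem_ball] at hv ⊢
    have e : y + k⁻¹ • (G.γ q - y) - o = (1 - k⁻¹) • (y - x) := by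
      have : k⁻¹ • G.γ q = k⁻¹ • x + (o - x) := by
        rw [hq, smul_add, smul_smul, inv_mul_cancel₀ hk0, one_smul]
      rw [smul_sub, this]; module
    have h1 : dist (y + k⁻¹ • (G.γ q - y)) o ≤ r := by
      rw [dist_eq_norm, e, norm_smul]
      have h2 : k⁻¹ ≤ 1 := inv_le_one_of_one_le₀ hk.le
      have h3 : 0 < k⁻¹ := by positivity
      rw [Real.norm_of_nonneg (by linarith), ← dist_eq_norm]
      have : (1 - k⁻¹) * dist y x ≤ 1 * dist y x := by gcongr; linarith
      linarith
    linarith [dist_triangle v (y + k⁻¹ • (G.γ q - y)) o]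

/-- Moving towards a boundary point keeps the depth. -/
theorem Deep.toward {ρ : ℝ} {x v : Plane} {q : ℝ} (h : G.Deep ρ x q) (hρ : 0 < ρ) (hv : v ∈ G.T)
    {t : ℝ} (h0 : 0 ≤ t) (h1 : t < 1) : ∃ ρ', 0 < ρ' ∧ G.Deep ρ' (x + t • (v - x)) q := by
  obtain ⟨o, k, hk, hq, ho⟩ := h
  -- Chosen so that w, a point of the segment from o to v, lies on the line from the new position to
  -- γ q.
  obtain ⟨ε, hε⟩ : ∃ ε, ε = (k - 1) / (k - t) := ⟨_, rfl⟩
  have hkt : 0 < k - t := by linarith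
  have hε1 : ε ≤ 1 := by rw [hε, div_le_one hkt]; linarith
  have hε0 : 0 < ε := by rw [hε]; exact div_pos (by linarith) hkt
  have heq : ε * (k - t) = k - 1 := by rw [hε, div_mul_cancel₀ _ hkt.ne']
  have ho' : o ∈ interior G.T := interior_maximal ho Metric.isOpen_ball (Metric.mem_ball_self hρ)
  have hεt : 0 < 1 - ε * t := by nlinarith
  obtain ⟨w, hw⟩ : ∃ w, w = (1 - ε * t) • o + (ε * t) • v := ⟨_, rfl⟩
  have hwi : w ∈ interior G.T := by
    rw [hw]
    exact G.convex.combo_interior_self_mem_interior ho' hv hεt (by positivity) (by ring)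
  obtain ⟨ρ', hρ', hb⟩ := Metric.isOpen_iff.1 isOpen_interior w hwi
  have hε1' : ε < 1 ∨ ε = 1 := hε1.lt_or_eq
  have hlt : 0 < 1 - ε := by
    rcases hε1' with h | h
    · linarith
    · rw [h] at heq; linarith
  refine ⟨ρ', hρ', w, (1 - ε)⁻¹, ?_, ?_, hb.trans interior_subset⟩
  · exact (one_lt_inv₀ hlt).2 (by linarith)
  · have key : (1 - ε) • G.γ q = (1 - ε) • (x + t • (v - x)) + (w - (x + t • (v - x))) := by
      have e1 : (1 - ε) * k = 1 - ε * t := by linarith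
      rw [hq, hw, smul_add, smul_smul, e1]
      module
    rw [← inv_smul_smul₀ hlt.ne' (G.γ q), key, smul_add, inv_smul_smul₀ hlt.ne']

variable (G)

theorem exists_deep {x : Plane} (hx : x ∉ G.T) : ∃ ρ q, 0 < ρ ∧ G.Deep ρ x q := by
  obtain ⟨o, ho⟩ := G.interior_nonempty
  obtain ⟨ρ, hρ, hb⟩ := Metric.isOpen_iff.1 isOpen_interior o ho
  obtain ⟨q, k, hk, hq⟩ := G.exists_exit ho (x := x) (fun h => hx (h ▸ interior_subset ho))
  exact ⟨ρ, q, hρ, o, k, hk, hq, hb.trans interior_subset⟩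

variable {G}

theorem notMem_interior {x : Plane} (h : x ∉ G.T) : x ∉ interior G.T :=
  fun h' => h (interior_subset h')

theorem Deep.JLstar_sub_le {ρ : ℝ} {x y : Plane} {q : ℝ} (h : G.Deep ρ x q) (hd : dist x y < ρ)
    (hxy : ∀ t : ℝ, 0 ≤ t → t ≤ 1 → x + t • (y - x) ∉ G.T) :
    ∃ v ∈ G.T, G.JLstar q y - G.JLstar q x ≤
      inner ℝ (y - x) (‖v - x‖⁻¹ • (v - x)) / G.ν := by
  have hx : x ∉ G.T := by simpa using hxy 0 le_rfl zero_le_one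
  have hy : y ∉ G.T := by simpa using hxy 1 zero_le_one le_rfl
  have hq := h.notMem_visible (dist_nonneg.trans_lt hd) hx
  obtain ⟨o, k, hk, hqo, ho⟩ := h
  exact G.JL_sub_le hxy ho hd hk hqo hq (G.sL_spec (notMem_interior hx))
    (G.sL_spec (notMem_interior hy)).1

theorem Deep.JRstar_sub_le {ρ : ℝ} {x y : Plane} {q : ℝ} (h : G.Deep ρ x q) (hd : dist x y < ρ)
    (hxy : ∀ t : ℝ, 0 ≤ t → t ≤ 1 → x + t • (y - x) ∉ G.T) (hq : q ∉ G.visible y) :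
    ∃ v ∈ G.T, G.JRstar q y - G.JRstar q x ≤
      inner ℝ (y - x) (‖v - x‖⁻¹ • (v - x)) / G.ν := by
  have hx : x ∉ G.T := by simpa using hxy 0 le_rfl zero_le_one
  have hy : y ∉ G.T := by simpa using hxy 1 zero_le_one le_rfl
  obtain ⟨v, hv, hle⟩ := h.mirror.JLstar_sub_le (y := planeRefl y)
    (by rwa [LinearIsometryEquiv.dist_map]) (fun t h0 h1 => by
      rw [← map_sub, ← map_smul, ← map_add, planeRefl_mem_mirror]; exact hxy t h0 h1)
  rw [G.mirror_JLstar (notMem_interior hx) (h.notMem_visible (dist_nonneg.trans_lt hd) hx),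
    G.mirror_JLstar (notMem_interior hy) hq, ← planeRefl_planeRefl v, ← map_sub, ← map_sub,
    LinearIsometryEquiv.norm_map, ← map_smul, LinearIsometryEquiv.inner_map_map] at hle
  refine ⟨planeRefl v, ?_, hle⟩
  rwa [← planeRefl_mem_mirror, planeRefl_planeRefl]

variable (G)

/-- Two directions from near `x₀` to the target are not opposite. -/
theorem norm_unit_sub_unit_le {x₀ y z v w : Plane} {D : ℝ} (hD : 0 < D)
    (hx : D ≤ Metric.infDist x₀ G.T) (hy : dist y x₀ ≤ Metric.infDist x₀ G.T / 2)
    (hz : dist z x₀ ≤ Metric.infDist x₀ G.T / 2) (hv : v ∈ G.T) (hw : w ∈ G.T) :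
    ‖‖v - y‖⁻¹ • (v - y) - ‖w - z‖⁻¹ • (w - z)‖ ≤
      2 * √(1 - (D / (3 * D + 2 * Metric.diam G.T)) ^ 2) := by
  obtain ⟨E, hE⟩ : ∃ E, E = Metric.infDist x₀ G.T := ⟨_, rfl⟩
  rw [← hE] at hx hy hz
  have hE0 : 0 < E := by linarith
  have hdiam : 0 ≤ Metric.diam G.T := Metric.diam_nonneg
  obtain ⟨p, hp, hpE⟩ := G.compact.exists_infDist_eq_dist ⟨v, hv⟩ x₀
  rw [← hE] at hpE
  have hfar : ∀ u ∈ G.T, ∀ a, dist a x₀ ≤ E / 2 → 0 < ‖u - a‖ ∧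
      ‖u - a‖ ≤ 3 * E / 2 + Metric.diam G.T := by
    intro u hu a ha
    rw [← dist_eq_norm]
    have h1 : E ≤ dist x₀ u := hE ▸ Metric.infDist_le_dist_of_mem hu
    have h2 := Metric.dist_le_diam_of_mem G.compact.isBounded hu hp
    constructor
    · linarith [dist_triangle x₀ a u, dist_comm x₀ a, dist_comm u a]
    · linarith [dist_triangle u p x₀, dist_triangle u x₀ a, dist_comm x₀ a, dist_comm p x₀]
  obtain ⟨ha0, ha1⟩ := hfar v hv y hy
  obtain ⟨hb0, hb1⟩ := hfar w hw z hz
  obtain ⟨a, ha⟩ : ∃ a, a = ‖v - y‖ := ⟨_, rfl⟩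
  obtain ⟨b, hb⟩ : ∃ b, b = ‖w - z‖ := ⟨_, rfl⟩
  rw [← ha] at ha0 ha1
  rw [← hb] at hb0 hb1
  rw [← ha, ← hb]
  obtain ⟨S, hS⟩ : ∃ S, S = a⁻¹ + b⁻¹ := ⟨_, rfl⟩
  have hS0 : 0 < S := by rw [hS]; positivity
  obtain ⟨B, hB⟩ : ∃ B, B = 3 * E / 2 + Metric.diam G.T := ⟨_, rfl⟩
  rw [← hB] at ha1 hb1
  have hB0 : 0 < B := ha0.trans_le ha1
  have hSB : 2 * B⁻¹ ≤ S := by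
    rw [hS]
    have h1 : B⁻¹ ≤ a⁻¹ := by gcongr
    have h2 : B⁻¹ ≤ b⁻¹ := by gcongr
    linarith
  -- With these weights the sum of the unit vectors is S times one vector, from a point between y
  -- and z to a point of T between v and w. Hence its norm is at least S·E/2.
  obtain ⟨θ, hθ⟩ : ∃ θ, θ = b⁻¹ / S := ⟨_, rfl⟩
  have hθ0 : 0 ≤ θ := by rw [hθ]; positivity
  have hbθ : b⁻¹ = S * θ := by rw [hθ, mul_div_cancel₀ _ hS0.ne']
  have haθ : a⁻¹ = S * (1 - θ) := by rw [mul_sub, ← hbθ, hS]; ring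
  have hθ1 : θ ≤ 1 := by
    have : 0 < S * (1 - θ) := by rw [← haθ]; positivity
    linarith [pos_of_mul_pos_right this hS0.le]
  have hm := G.convex_comb_mem hv hw hθ0 hθ1
  have hm0 : dist (y + θ • (z - y)) x₀ ≤ E / 2 := by
    have h := (convex_closedBall x₀ (E / 2)).add_smul_sub_mem
      (Metric.mem_closedBall.2 hy) (Metric.mem_closedBall.2 hz) ⟨hθ0, hθ1⟩
    exact Metric.mem_closedBall.1 h
  have hfar' : E / 2 ≤ ‖(v + θ • (w - v)) - (y + θ • (z - y))‖ := by
    rw [← dist_eq_norm]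
    have h1 : E ≤ dist x₀ (v + θ • (w - v)) := hE ▸ Metric.infDist_le_dist_of_mem hm
    linarith [dist_triangle x₀ (y + θ • (z - y)) (v + θ • (w - v)),
      dist_comm x₀ (y + θ • (z - y)), dist_comm (y + θ • (z - y)) (v + θ • (w - v))]
  have hsum : a⁻¹ • (v - y) + b⁻¹ • (w - z) =
      S • ((v + θ • (w - v)) - (y + θ • (z - y))) := by
    rw [haθ, hbθ]; module
  have hn : E * B⁻¹ ≤ ‖a⁻¹ • (v - y) + b⁻¹ • (w - z)‖ := by
    rw [hsum, norm_smul, Real.norm_of_nonneg hS0.le]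
    have := mul_le_mul hSB hfar' (by positivity) hS0.le
    linarith
  have hκ : 2 * (D / (3 * D + 2 * Metric.diam G.T)) ≤ E * B⁻¹ := by
    rw [← div_eq_mul_inv, hB, ← mul_div_assoc, div_le_div_iff₀ (by positivity) (by positivity)]
    have := mul_le_mul_of_nonneg_right hx hdiam
    nlinarith
  -- The parallelogram law turns the lower bound for the sum into an upper bound for the difference.
  have hpar := parallelogram_law_with_norm ℝ (a⁻¹ • (v - y)) (b⁻¹ • (w - z))
  have hu1 : ‖a⁻¹ • (v - y)‖ = 1 := by
    rw [norm_smul, ← ha, Real.norm_of_nonneg (by positivity), inv_mul_cancel₀ ha0.ne']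
  have hu2 : ‖b⁻¹ • (w - z)‖ = 1 := by
    rw [norm_smul, ← hb, Real.norm_of_nonneg (by positivity), inv_mul_cancel₀ hb0.ne']
  rw [hu1, hu2] at hpar
  have h0 : 0 ≤ D / (3 * D + 2 * Metric.diam G.T) := by positivity
  have hge := pow_le_pow_left₀ (by positivity) (hκ.trans hn) 2
  rw [← div_le_iff₀' (by norm_num : (0 : ℝ) < 2)]
  refine Real.le_sqrt_of_sq_le ?_
  nlinarith

/-- A lift of the midpoint to the real line on a disc outside of the target. -/
structure LocalLift (c r : ℝ) (x₀ : Plane) (M : Plane → ℝ) : Prop where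
  notMem : ∀ y, dist y x₀ < r → y ∉ G.T
  lift : ∀ y, dist y x₀ < r → G.mid y = (M y : ℝ)
  contr : ∀ y z, dist y x₀ < r → dist z x₀ < r → |M z - M y| ≤ c * (dist z y / G.ν)
  slope : ∀ σ : ℝ, σ = 1 ∨ σ = -1 → ∀ y z, dist y x₀ < r → dist z x₀ < r →
    ∃ v ∈ G.T, (G.cc z + σ * M z) - (G.cc y + σ * M y) ≤
      inner ℝ (z - y) (‖v - y‖⁻¹ • (v - y)) / G.ν

/-- The contraction constant depends only on the distance D from the target, while the radius may
depend on the point. This uniformity makes the gap run out in finite time when the intruder stays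
away from T. -/
theorem exists_localLift {D : ℝ} (hD : 0 < D) : ∃ c : ℝ, 0 ≤ c ∧ c < 1 ∧
    ∀ x₀, D ≤ Metric.infDist x₀ G.T → ∃ r M, 0 < r ∧ G.LocalLift c r x₀ M := by
  have hdiam : 0 ≤ Metric.diam G.T := Metric.diam_nonneg
  refine ⟨√(1 - (D / (3 * D + 2 * Metric.diam G.T)) ^ 2), Real.sqrt_nonneg _, ?_, ?_⟩
  · rw [Real.sqrt_lt' one_pos]
    have : 0 < D / (3 * D + 2 * Metric.diam G.T) := by positivity
    nlinarith
  intro x₀ hx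
  have hx₀ : x₀ ∉ G.T := fun h => by
    rw [Metric.infDist_zero_of_mem h] at hx; linarith
  obtain ⟨ρ, q, hρ, hdeep⟩ := G.exists_deep hx₀
  -- The first bound keeps the disc off T, the second keeps its diameter below the depth ρ - r that
  -- remains.
  obtain ⟨r, hr⟩ : ∃ r, r = min (Metric.infDist x₀ G.T / 2) (ρ / 4) := ⟨_, rfl⟩
  have hr1 : r ≤ Metric.infDist x₀ G.T / 2 := hr ▸ min_le_left _ _
  have hr2 : r ≤ ρ / 4 := hr ▸ min_le_right _ _
  have hr0 : 0 < r := by rw [hr]; exact lt_min (by linarith) (by linarith)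
  have hnot : ∀ y, dist y x₀ < r → y ∉ G.T := fun y hy hyT => by
    have := Metric.infDist_le_dist_of_mem (x := x₀) hyT
    rw [dist_comm] at this
    linarith
  have hdp : ∀ y, dist y x₀ < r → G.Deep (ρ - r) y q := fun y hy => hdeep.of_dist_le hy.le
  have hhid : ∀ y, dist y x₀ < r → q ∉ G.visible y := fun y hy =>
    (hdp y hy).notMem_visible (by linarith) (hnot y hy)
  have hseg : ∀ y z, dist y x₀ < r → dist z x₀ < r → ∀ t : ℝ, 0 ≤ t → t ≤ 1 →
      y + t • (z - y) ∉ G.T := fun y z hy hz t h0 h1 =>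
    hnot _ (Metric.mem_ball.1 ((convex_ball x₀ r).add_smul_sub_mem
      (Metric.mem_ball.2 hy) (Metric.mem_ball.2 hz) ⟨h0, h1⟩))
  have hyz : ∀ y z, dist y x₀ < r → dist z x₀ < r → dist y z < ρ - r := fun y z hy hz => by
    linarith [dist_triangle y x₀ z, dist_comm x₀ z]
  have hL : ∀ y z, dist y x₀ < r → dist z x₀ < r → _ := fun y z hy hz =>
    (hdp y hy).JLstar_sub_le (hyz y z hy hz) (hseg y z hy hz)
  have hR : ∀ y z, dist y x₀ < r → dist z x₀ < r → _ := fun y z hy hz =>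
    (hdp y hy).JRstar_sub_le (hyz y z hy hz) (hseg y z hy hz) (hhid z hz)
  -- The gain of J_L* from y to z and that of J_R* from z to y are added. The two unit directions
  -- enter through their difference, whose norm is bounded away from 2.
  have hone : ∀ y z, dist y x₀ < r → dist z x₀ < r →
      (G.JLstar q z - G.JRstar q z) - (G.JLstar q y - G.JRstar q y) ≤
        2 * (√(1 - (D / (3 * D + 2 * Metric.diam G.T)) ^ 2) * (dist z y / G.ν)) := by
    intro y z hy hz
    obtain ⟨v, hv, h1⟩ := hL y z hy hz
    obtain ⟨w, hw, h2⟩ := hR z y hz hy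
    have h3 := G.norm_unit_sub_unit_le hD hx (hy.le.trans hr1) (hz.le.trans hr1) hv hw
    have h4 : inner ℝ (z - y) (‖v - y‖⁻¹ • (v - y)) + inner ℝ (y - z) (‖w - z‖⁻¹ • (w - z)) ≤
        dist z y * (2 * √(1 - (D / (3 * D + 2 * Metric.diam G.T)) ^ 2)) := by
      rw [← neg_sub z y, inner_neg_left, ← sub_eq_add_neg, ← inner_sub_right, dist_eq_norm]
      exact (real_inner_le_norm _ _).trans (by gcongr)
    have h5 := div_le_div_of_nonneg_right h4 G.ν_pos.le
    rw [add_div] at h5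
    calc _ ≤ dist z y * (2 * √(1 - (D / (3 * D + 2 * Metric.diam G.T)) ^ 2)) / G.ν := by linarith
      _ = _ := by ring
  refine ⟨r, fun y => q + (G.JLstar q y - G.JRstar q y + G.L) / 2, hr0, hnot, fun y hy =>
    (G.lift_of_not_visible (notMem_interior (hnot y hy)) (hhid y hy)).1, ?_, ?_⟩
  · intro y z hy hz
    have h1 := hone y z hy hz
    have h2 := hone z y hz hy
    rw [dist_comm y z] at h2
    rw [abs_le]
    constructor <;> linarith
  · intro σ hσ y z hy hz
    rw [(G.lift_of_not_visible (notMem_interior (hnot y hy)) (hhid y hy)).2,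
      (G.lift_of_not_visible (notMem_interior (hnot z hz)) (hhid z hz)).2]
    rcases hσ with rfl | rfl
    · obtain ⟨v, hv, h⟩ := hL y z hy hz
      exact ⟨v, hv, by linarith⟩
    · obtain ⟨v, hv, h⟩ := hR y z hy hz
      exact ⟨v, hv, by linarith⟩

end PerimeterGame

end

/-! ### Lipschitz bounds for the value -/

noncomputable section

theorem abs_sub_le_of_locally {f : ℝ → ℝ} {a b C : ℝ} (hab : a ≤ b)
    (h : ∀ t ∈ Icc a b, ∃ ε > 0, ∀ t' ∈ Icc a b, |t' - t| < ε → |f t' - f t| ≤ C * |t' - t|) :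
    |f b - f a| ≤ C * (b - a) := by
  have hcont : ContinuousOn f (Icc a b) := by
    intro t ht
    obtain ⟨ε, hε, h1⟩ := h t ht
    rw [ContinuousWithinAt, tendsto_iff_dist_tendsto_zero]
    have h2 : Tendsto (fun t' : ℝ => C * |t' - t|) (𝓝[Icc a b] t) (𝓝 0) := by
      have : Continuous fun t' : ℝ => C * |t' - t| := by fun_prop
      have h3 := (this.tendsto t).mono_left (nhdsWithin_le_nhds (s := Icc a b))
      simpa using h3
    refine squeeze_zero' (Eventually.of_forall fun _ => dist_nonneg) ?_ h2
    filter_upwards [self_mem_nhdsWithin, mem_nhdsWithin_of_mem_nhds (Metric.ball_mem_nhds t hε)]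
      with t' h3 h4
    rw [Real.dist_eq]
    exact h1 t' h3 (by rwa [Metric.mem_ball, Real.dist_eq] at h4)
  have hsub : Icc a b ⊆ {t | |f t - f a| ≤ C * (t - a)} := by
    apply IsClosed.Icc_subset_of_forall_exists_gt
    · have h1 : ContinuousOn (fun t => C * (t - a) - |f t - f a|) (Icc a b) := by fun_prop
      have h2 := h1.preimage_isClosed_of_isClosed isClosed_Icc (isClosed_Ici (a := (0 : ℝ)))
      convert h2 using 1
      ext t
      simp only [mem_inter_iff, mem_ofPred_eq, mem_preimage, mem_Ici, sub_nonneg]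
      tauto
    · simp
    · rintro t ⟨h1, h2⟩ y hy
      obtain ⟨ε, hε, h3⟩ := h t ⟨h2.1, h2.2.le⟩
      obtain ⟨t', h4, h5⟩ : ∃ t', t < t' ∧ t' < min (min y b) (t + ε) :=
        exists_between (lt_min (lt_min hy h2.2) (by linarith))
      have h6 : t' < y := h5.trans_le ((min_le_left _ _).trans (min_le_left _ _))
      have h7 : t' < b := h5.trans_le ((min_le_left _ _).trans (min_le_right _ _))
      have h8 : t' < t + ε := h5.trans_le (min_le_right _ _)
      refine ⟨t', ?_, h4, h6.le⟩
      have h9 := h3 t' ⟨by linarith [h2.1], h7.le⟩ (by rw [abs_of_pos (by linarith)]; linarith)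
      rw [abs_of_pos (by linarith : 0 < t' - t)] at h9
      rw [mem_ofPred_eq] at h1 ⊢
      have := abs_sub_le (f t') (f t) (f a)
      linarith
  exact hsub (right_mem_Icc.2 hab)

namespace PerimeterGame

variable {G : PerimeterGame}

theorem infDist_pos {x : Plane} (hx : x ∉ G.T) : 0 < Metric.infDist x G.T :=
  (G.compact.isClosed.notMem_iff_infDist_pos (G.interior_nonempty.mono interior_subset)).1 hx

theorem exists_localLift_at {x : Plane} (hx : x ∉ G.T) :
    ∃ c r M, c < 1 ∧ 0 < r ∧ G.LocalLift c r x M := by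
  obtain ⟨c, -, hc, h⟩ := G.exists_localLift (infDist_pos hx)
  obtain ⟨r, M, hr, hM⟩ := h x le_rfl
  exact ⟨c, r, M, hc, hr, hM⟩

theorem inner_unit_le (a v : Plane) : inner ℝ a (‖v‖⁻¹ • v) ≤ ‖a‖ := by
  refine (real_inner_le_norm _ _).trans (mul_le_of_le_one_right (norm_nonneg _) ?_)
  rw [norm_smul, norm_inv, norm_norm]
  exact inv_mul_le_one

theorem LocalLift.slope_le {c r : ℝ} {x₀ : Plane} {M : Plane → ℝ} (h : G.LocalLift c r x₀ M)
    {σ : ℝ} (hσ : σ = 1 ∨ σ = -1) {y z : Plane} (hy : dist y x₀ < r) (hz : dist z x₀ < r) :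
    (G.cc z + σ * M z) - (G.cc y + σ * M y) ≤ dist z y / G.ν := by
  obtain ⟨v, -, hle⟩ := h.slope σ hσ y z hy hz
  refine hle.trans (div_le_div_of_nonneg_right ?_ G.ν_pos.le)
  rw [dist_eq_norm]
  exact inner_unit_le _ _

/-- Of the two slope estimates, for cc + M and cc - M, the one matching the sign of the gap at z is
used. -/
theorem LocalLift.V_sub_le {c r : ℝ} {x₀ : Plane} {M : Plane → ℝ} (h : G.LocalLift c r x₀ M)
    {y z : Plane} (hy : dist y x₀ < r) (hz : dist z x₀ < r) (s : ℝ) :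
    G.V s z - G.V s y ≤ dist z y / G.ν := by
  rw [G.V_eq (notMem_interior (h.notMem y hy)), G.V_eq (notMem_interior (h.notMem z hz)),
    h.lift y hy, h.lift z hz]
  obtain ⟨g, hg, hn, -⟩ := G.exists_circle_rep ((s : AddCircle G.L) - (M y : ℝ))
  have hz' : ‖(s : AddCircle G.L) - (M z : ℝ)‖ ≤ |g + M y - M z| := by
    refine le_trans (le_of_eq ?_) (G.norm_circle_le _)
    rw [AddCircle.coe_sub, AddCircle.coe_add, hg, sub_add_cancel]
  rw [hn]
  rcases le_total 0 (g + M y - M z) with h0 | h0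
  · rw [abs_of_nonneg h0] at hz'
    linarith [h.slope_le (Or.inr rfl) hy hz, le_abs_self g]
  · rw [abs_of_nonpos h0] at hz'
    linarith [h.slope_le (Or.inl rfl) hy hz, neg_abs_le g]

theorem abs_V_sub_le {x y : Plane} (hxy : ∀ t : ℝ, 0 ≤ t → t ≤ 1 → x + t • (y - x) ∉ G.T) (s : ℝ) :
    |G.V s y - G.V s x| ≤ dist y x / G.ν := by
  have key := abs_sub_le_of_locally (f := fun t : ℝ => G.V s (x + t • (y - x)))
    (C := dist y x / G.ν) zero_le_one fun t ht => by
    obtain ⟨c, r, M, -, hr, hM⟩ := exists_localLift_at (hxy t ht.1 ht.2)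
    have hd : ∀ t', dist (x + t' • (y - x)) (x + t • (y - x)) = |t' - t| * dist y x := by
      intro t'
      rw [dist_add_left, dist_eq_norm, ← sub_smul, norm_smul, Real.norm_eq_abs, dist_eq_norm]
    refine ⟨r / (dist y x + 1), by positivity, fun t' ht' hlt => ?_⟩
    have hlt' : dist (x + t' • (y - x)) (x + t • (y - x)) < r := by
      rw [hd]
      rw [lt_div_iff₀ (by positivity)] at hlt
      nlinarith [abs_nonneg (t' - t)]
    have h0 : dist (x + t • (y - x)) (x + t • (y - x)) < r := by rwa [dist_self]
    have h1 := hM.V_sub_le h0 hlt' s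
    have h2 := hM.V_sub_le hlt' h0 s
    rw [dist_comm, hd] at h2
    rw [hd] at h1
    have e : dist y x / G.ν * |t' - t| = |t' - t| * dist y x / G.ν := by ring
    rw [e, abs_le]
    constructor <;> linarith
  simpa using key

theorem cc_le_V {x : Plane} (hx : x ∉ interior G.T) (s : ℝ) : G.cc x ≤ G.V s x := by
  rw [G.V_eq hx]; linarith [norm_nonneg ((s : AddCircle G.L) - G.mid x)]

theorem neg_infDist_le_cc {x v : Plane} (hx : x ∉ G.T) (hv : v ∈ G.T) :
    -(dist v x / G.ν) ≤ G.cc x := by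
  obtain ⟨b, t, h0, h1, hb, hvis⟩ := G.exists_first hx hv
  refine le_trans ?_ (G.neg_dist_le_cc hx hvis)
  rw [neg_le_neg_iff]
  refine div_le_div_of_nonneg_right ?_ G.ν_pos.le
  rw [hb, dist_eq_norm, add_sub_cancel_left, norm_smul, Real.norm_of_nonneg h0.le, dist_eq_norm]
  exact mul_le_of_le_one_left (norm_nonneg _) h1

/-! ### The distance to the region where the intruder wins -/

theorem intruderWinning_γ (s : ℝ) {ε : ℝ} (h0 : 0 < ε) (h1 : ε ≤ G.L / 2) :
    G.γ (s + ε) ∈ G.intruderWinning s := by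
  refine ⟨G.γ_notMem_interior _, ?_⟩
  rw [V_γ, AddCircle.coe_add, sub_add_cancel_left, norm_neg, G.norm_circle_of_nonneg h0.le h1]
  exact h0

/-- Boundary points next to the defender belong to the winning region. -/
theorem dbar_le_dist (s : ℝ) (x : Plane) : G.dbar s x ≤ dist x (G.γ s) := by
  refine le_of_forall_pos_le_add fun ε hε => ?_
  have hL := G.L_pos
  have h0 : 0 < min ε (G.L / 2) := lt_min hε (by linarith)
  refine (Metric.infDist_le_dist_of_mem
    (intruderWinning_γ s h0 (min_le_right _ _))).trans ?_
  refine (dist_triangle x (G.γ s) _).trans ?_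
  have := G.dist_γ_le s (s + min ε (G.L / 2))
  rw [sub_add_cancel_left, abs_neg, abs_of_pos h0] at this
  linarith [min_le_left ε (G.L / 2)]

theorem dbar_eq_zero {s : ℝ} {x : Plane} (hx : x ∉ interior G.T) (h : 0 < G.V s x) :
    G.dbar s x = 0 := Metric.infDist_zero_of_mem ⟨hx, h⟩

/-- On a segment off T the value grows at rate at most 1/ν. If the segment to a winning point meets
T, the first contact already bounds cc, and with it V, from below. -/
theorem neg_le_dbar {s : ℝ} {x : Plane} (hx : x ∉ interior G.T) :
    -(G.ν * G.V s x) ≤ G.dbar s x := by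
  have hν := G.ν_pos
  have hL := G.L_pos
  by_cases hxT : x ∈ G.T
  · obtain ⟨b, rfl⟩ := G.exists_γ_eq hxT hx
    rw [V_γ]
    have : 0 ≤ G.dbar s (G.γ b) := Metric.infDist_nonneg
    have : 0 ≤ G.ν * ‖(s : AddCircle G.L) - b‖ := by positivity
    linarith
  refine (Metric.le_infDist ⟨_, intruderWinning_γ s (ε := G.L / 2) (by linarith) le_rfl⟩).2 ?_
  rintro y ⟨hy, hVy⟩
  suffices h : -G.V s x ≤ dist y x / G.ν by
    rw [le_div_iff₀ hν] at h
    rw [dist_comm]; linarith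
  by_cases hseg : ∀ t : ℝ, 0 ≤ t → t ≤ 1 → x + t • (y - x) ∉ G.T
  · have := abs_le.1 (abs_V_sub_le hseg s)
    linarith
  · push Not at hseg
    obtain ⟨t, h0, h1, hv⟩ := hseg
    have hle := neg_infDist_le_cc hxT hv
    have h2 := cc_le_V hx s
    have h3 : dist (x + t • (y - x)) x ≤ dist y x := by
      rw [dist_eq_norm, add_sub_cancel_left, norm_smul, Real.norm_of_nonneg h0, dist_eq_norm]
      exact mul_le_of_le_one_left (norm_nonneg _) h1
    have := div_le_div_of_nonneg_right h3 hν.le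
    linarith

/-! ### Moving straight towards a breaching point -/

theorem isRightBreach_toward {x : Plane} (hx : x ∉ G.T) {s : ℝ} (hs : G.IsRightBreach x s) {t : ℝ}
    (h0 : 0 ≤ t) (h1 : t < 1) : G.IsRightBreach (x + t • (G.γ s - x)) s := by
  have hs' : G.mirror.IsLeftBreach (planeRefl x) (-s) := by
    rw [isLeftBreach_mirror, neg_neg]; exact hs
  have := (G.mirror.isLeftBreach_toward (G.planeRefl_mem_mirror.not.2 hx) hs' h0 h1).2.2
  rwa [mirror_γ, neg_neg, ← map_sub, ← map_smul, ← map_add, isLeftBreach_mirror, neg_neg] at this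

/-- The point q stays hidden on the whole way, but its depth may shrink, so the bound is proved near
each time and then joined. -/
theorem abs_Jstar_sub_le {x : Plane} {q b : ℝ} {ρ : ℝ} (hx : x ∉ G.T) (hρ : 0 < ρ)
    (hq : G.Deep ρ x q) (hb : b ∈ G.visible x) {t t' : ℝ} (h0 : 0 ≤ t) (htt : t ≤ t') (h1 : t' < 1) :
    |G.JLstar q (x + t' • (G.γ b - x)) - G.JLstar q (x + t • (G.γ b - x))| ≤
      dist (G.γ b) x / G.ν * (t' - t) ∧
    |G.JRstar q (x + t' • (G.γ b - x)) - G.JRstar q (x + t • (G.γ b - x))| ≤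
      dist (G.γ b) x / G.ν * (t' - t) := by
  have hfree := (G.mem_visible_iff hx).1 hb
  have hd : ∀ t t' : ℝ, dist (x + t' • (G.γ b - x)) (x + t • (G.γ b - x)) =
      |t' - t| * dist (G.γ b) x := by
    intro t t'
    rw [dist_add_left, dist_eq_norm, ← sub_smul, norm_smul, Real.norm_eq_abs, dist_eq_norm]
  have main : ∀ a ∈ Icc t t', ∃ ε > 0, ∀ a' ∈ Icc t t', |a' - a| < ε →
      (|G.JLstar q (x + a' • (G.γ b - x)) - G.JLstar q (x + a • (G.γ b - x))| ≤
        dist (G.γ b) x / G.ν * |a' - a| ∧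
      |G.JRstar q (x + a' • (G.γ b - x)) - G.JRstar q (x + a • (G.γ b - x))| ≤
        dist (G.γ b) x / G.ν * |a' - a|) := by
    intro a ha
    obtain ⟨ρ', hρ', hdp⟩ := hq.toward hρ (G.γ_mem b) (t := a) (by linarith [ha.1])
      (by linarith [ha.2])
    refine ⟨ρ' / 2 / (dist (G.γ b) x + 1), by positivity, fun a' ha' hlt => ?_⟩
    have hlt' : |a' - a| * dist (G.γ b) x < ρ' / 2 := by
      rw [lt_div_iff₀ (by positivity)] at hlt
      nlinarith [abs_nonneg (a' - a)]
    have hdp' := hdp.of_dist_le (y := x + a' • (G.γ b - x)) (r := ρ' / 2) (by rw [hd]; exact hlt'.le)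
    have hseg : ∀ a ∈ Icc t t', ∀ a' ∈ Icc t t', ∀ r : ℝ, 0 ≤ r → r ≤ 1 →
        x + a • (G.γ b - x) + r • (x + a' • (G.γ b - x) - (x + a • (G.γ b - x))) ∉ G.T := by
      intro a ha a' ha' r hr0 hr1
      have e : x + a • (G.γ b - x) + r • (x + a' • (G.γ b - x) - (x + a • (G.γ b - x))) =
          x + (a + r * (a' - a)) • (G.γ b - x) := by module
      rw [e]
      refine hfree _ ?_ ?_
      · nlinarith [ha.1, ha'.1]
      · nlinarith [ha.2, ha'.2]
    have hfr : ∀ a ∈ Icc t t', x + a • (G.γ b - x) ∉ G.T := fun a ha =>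
      hfree a (by linarith [ha.1]) (by linarith [ha.2])
    have hv := hdp.notMem_visible hρ' (hfr a ha)
    have hv' := hdp'.notMem_visible (by linarith) (hfr a' ha')
    have hd1 : dist (x + a • (G.γ b - x)) (x + a' • (G.γ b - x)) < ρ' := by
      rw [dist_comm, hd]; linarith
    have hd2 : dist (x + a' • (G.γ b - x)) (x + a • (G.γ b - x)) < ρ' - ρ' / 2 := by
      rw [hd]; linarith
    have bound : ∀ y z : Plane, ∀ J : Plane → ℝ, (∃ v ∈ G.T, J z - J y ≤
        inner ℝ (z - y) (‖v - y‖⁻¹ • (v - y)) / G.ν) → J z - J y ≤ dist z y / G.ν := by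
      rintro y z J ⟨v, -, hle⟩
      refine hle.trans (div_le_div_of_nonneg_right ?_ G.ν_pos.le)
      rw [dist_eq_norm]
      exact inner_unit_le _ _
    have e : dist (G.γ b) x / G.ν * |a' - a| = |a' - a| * dist (G.γ b) x / G.ν := by ring
    have b1 := bound _ _ (G.JLstar q) (hdp.JLstar_sub_le hd1 (hseg a ha a' ha'))
    have b2 := bound _ _ (G.JLstar q) (hdp'.JLstar_sub_le hd2 (hseg a' ha' a ha))
    have b3 := bound _ _ (G.JRstar q) (hdp.JRstar_sub_le hd1 (hseg a ha a' ha') hv')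
    have b4 := bound _ _ (G.JRstar q) (hdp'.JRstar_sub_le hd2 (hseg a' ha' a ha) hv)
    rw [hd] at b1 b2 b3 b4
    rw [abs_sub_comm] at b2 b4
    rw [e, abs_le, abs_le]
    refine ⟨⟨?_, ?_⟩, ?_, ?_⟩ <;> linarith
  constructor
  · refine abs_sub_le_of_locally (f := fun a : ℝ => G.JLstar q (x + a • (G.γ b - x))) htt
      fun a ha => ?_
    obtain ⟨ε, hε, h⟩ := main a ha
    exact ⟨ε, hε, fun a' ha' hlt => (h a' ha' hlt).1⟩
  · refine abs_sub_le_of_locally (f := fun a : ℝ => G.JRstar q (x + a • (G.γ b - x))) htt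
      fun a ha => ?_
    obtain ⟨ε, hε, h⟩ := main a ha
    exact ⟨ε, hε, fun a' ha' hlt => (h a' ha' hlt).2⟩

theorem offset_bounds_of_breach {x : Plane} {q l r : ℝ} (hq : q ∉ G.visible x)
    (hl : G.IsLeftBreach x l) (hr : G.IsRightBreach x r) :
    |(G.JLstar q x - G.JRstar q x + G.L) / 2 - (G.arc q l + G.arc q r) / 2| ≤
      (G.arc q l - G.arc q r) / 2 ∧
    |(G.JLstar q x - G.JRstar q x + G.L) / 2 - (G.arc q l + G.arc q r) / 2| ≤
      (G.L - (G.arc q l - G.arc q r)) / 2 := by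
  obtain ⟨h1, h2⟩ := G.arc_sR_le_arc_sL hq hl hr
  have h3 := (G.abs_dist_sub_dist_le hl hr).2
  rw [h2] at h3
  rw [G.JLstar_eq hq hl, G.JRstar_eq hq hr, JL, JR, G.arc_to_not_visible hq hr.1]
  have e : (G.arc q l - dist (G.γ l) x / G.ν - (G.L - G.arc q r - dist (G.γ r) x / G.ν) + G.L) / 2 -
      (G.arc q l + G.arc q r) / 2 = -((dist (G.γ l) x - dist (G.γ r) x) / G.ν / 2) := by ring
  have e2 : |(dist (G.γ l) x - dist (G.γ r) x) / G.ν / 2| =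
      |dist (G.γ l) x - dist (G.γ r) x| / G.ν / 2 := by
    rw [abs_div, abs_div, abs_of_pos G.ν_pos, abs_of_pos (by norm_num : (0 : ℝ) < 2)]
  rw [e, abs_neg, e2]
  constructor <;> linarith

/-- Moving straight towards a breaching point, the intruder gains at full rate. -/
theorem exists_toward {x : Plane} (hx : x ∉ G.T) {σ b : ℝ}
    (h : σ = 1 ∧ G.IsLeftBreach x b ∨ σ = -1 ∧ G.IsRightBreach x b) :
    ∃ Δ : ℝ → ℝ, Δ 0 = 0 ∧
      (∀ t, 0 ≤ t → t < 1 → x + t • (G.γ b - x) ∉ G.T ∧ Δ t ≤ G.L / 2 ∧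
        G.mid (x + t • (G.γ b - x)) = G.mid x + (σ * Δ t : ℝ) ∧
        G.cc (x + t • (G.γ b - x)) = G.cc x + t * (dist (G.γ b) x / G.ν) - Δ t) ∧
      ∀ t t', 0 ≤ t → t ≤ t' → t' < 1 → Δ t ≤ Δ t' ∧
        Δ t' - Δ t ≤ (t' - t) * (dist (G.γ b) x / G.ν) := by
  obtain ⟨ρ, q, hρ, hdeep⟩ := G.exists_deep hx
  have hb : b ∈ G.visible x := by rcases h with h | h <;> exact h.2.1
  have hfree := (G.mem_visible_iff hx).1 hb
  have hhid : ∀ t : ℝ, 0 ≤ t → t < 1 → q ∉ G.visible (x + t • (G.γ b - x)) := fun t h0 h1 => by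
    obtain ⟨ρ', hρ', hdp⟩ := hdeep.toward hρ (G.γ_mem b) h0 h1
    exact hdp.notMem_visible hρ' (hfree t h0 h1)
  have hlip := fun t t' : ℝ => abs_Jstar_sub_le hx hρ hdeep hb (t := t) (t' := t')
  have e0 : x + (0 : ℝ) • (G.γ b - x) = x := by simp
  have hlift := fun (t : ℝ) (h0 : 0 ≤ t) (h1 : t < 1) =>
    G.lift_of_not_visible (notMem_interior (hfree t h0 h1)) (hhid t h0 h1)
  have hlift0 := hlift 0 le_rfl zero_lt_one
  rw [e0] at hlift0
  have hdist : ∀ t : ℝ, t < 1 → dist (G.γ b) (x + t • (G.γ b - x)) = (1 - t) * dist (G.γ b) x := by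
    intro t ht
    rw [dist_eq_norm, dist_eq_norm, show G.γ b - (x + t • (G.γ b - x)) = (1 - t) • (G.γ b - x) by
      module, norm_smul, Real.norm_of_nonneg (by linarith)]
  have hx' := notMem_interior hx
  have hq0 := hdeep.notMem_visible hρ hx
  -- Δ is the shift of the midpoint in the direction σ. The critical value of the pursued breaching
  -- point, which is cc + σ mid up to a constant, gains exactly t d/ν, where d = dist (γ b) x. The
  -- other one changes by at most that, so Δ is nondecreasing and grows at most at the same rate.
  refine ⟨fun t => σ * ((G.JLstar q (x + t • (G.γ b - x)) - G.JRstar q (x + t • (G.γ b - x))) / 2 -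
    (G.JLstar q x - G.JRstar q x) / 2), ?_, ?_, ?_⟩
  · simp
  · intro t h0 h1
    have hy := hfree t h0 h1
    have hmid : G.mid (x + t • (G.γ b - x)) = G.mid x +
        (((G.JLstar q (x + t • (G.γ b - x)) - G.JRstar q (x + t • (G.γ b - x))) / 2 -
          (G.JLstar q x - G.JRstar q x) / 2 : ℝ) : AddCircle G.L) := by
      rw [(hlift t h0 h1).1, hlift0.1, ← AddCircle.coe_add]
      congr 1
      ring
    refine ⟨hy, ?_, ?_, ?_⟩
    -- The midpoint starts at most half a turn short of the pursued breaching point and never passes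
    -- it.
    · rcases h with ⟨rfl, hl⟩ | ⟨rfl, hr⟩
      · have h2 := (G.isLeftBreach_toward hx hl h0 h1).2.2
        obtain ⟨-, h3⟩ := offset_bounds_of_breach hq0 hl (G.sR_spec hx')
        obtain ⟨h4, -⟩ := offset_bounds_of_breach (hhid t h0 h1) h2
          (G.sR_spec (notMem_interior hy))
        rw [abs_le] at h3 h4
        linarith
      · have h2 := isRightBreach_toward hx hr h0 h1
        obtain ⟨-, h3⟩ := offset_bounds_of_breach hq0 (G.sL_spec hx') hr
        obtain ⟨h4, -⟩ := offset_bounds_of_breach (hhid t h0 h1)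
          (G.sL_spec (notMem_interior hy)) h2
        rw [abs_le] at h3 h4
        linarith
    · rw [hmid, ← mul_assoc]
      rcases h with ⟨rfl, -⟩ | ⟨rfl, -⟩ <;> norm_num
    · rw [(hlift t h0 h1).2, hlift0.2]
      rcases h with ⟨rfl, hl⟩ | ⟨rfl, hr⟩
      · have e1 := G.JLstar_eq hq0 hl
        have e2 := G.JLstar_eq (hhid t h0 h1) (G.isLeftBreach_toward hx hl h0 h1).2.2
        rw [JL] at e1
        rw [JL, hdist t h1, mul_div_assoc] at e2
        linarith
      · have e1 := G.JRstar_eq hq0 hr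
        have e2 := G.JRstar_eq (hhid t h0 h1) (isRightBreach_toward hx hr h0 h1)
        rw [JR] at e1
        rw [JR, hdist t h1, mul_div_assoc] at e2
        linarith
  · intro t t' h0 htt h1
    obtain ⟨hL, hR⟩ := hlip t t' h0 htt h1
    rw [abs_le] at hL hR
    rcases h with ⟨rfl, hl⟩ | ⟨rfl, hr⟩
    · have e1 := G.JLstar_eq (hhid t h0 (by linarith))
        (G.isLeftBreach_toward hx hl h0 (by linarith)).2.2
      have e2 := G.JLstar_eq (hhid t' (by linarith) h1)
        (G.isLeftBreach_toward hx hl (by linarith) h1).2.2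
      rw [JL, hdist t (by linarith), mul_div_assoc] at e1
      rw [JL, hdist t' h1, mul_div_assoc] at e2
      constructor <;> nlinarith
    · have e1 := G.JRstar_eq (hhid t h0 (by linarith))
        (isRightBreach_toward hx hr h0 (by linarith))
      have e2 := G.JRstar_eq (hhid t' (by linarith) h1)
        (isRightBreach_toward hx hr (by linarith) h1)
      rw [JR, hdist t (by linarith), mul_div_assoc] at e1
      rw [JR, hdist t' h1, mul_div_assoc] at e2
      constructor <;> nlinarith

/-- Against a defender standing still at the midpoint, running to a breaching point makes V positive
just beyond the distance -ν cc. If both breaching points are nearer than that, they coincide with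
the defender, and `dbar_le_dist` suffices. -/
theorem dbar_le_neg {x : Plane} (hx : x ∉ G.T) {s : ℝ} (hs : (s : AddCircle G.L) = G.mid x)
    (hc : G.cc x ≤ 0) : G.dbar s x ≤ -(G.ν * G.cc x) := by
  have hν := G.ν_pos
  have hx' := notMem_interior hx
  have hgo : ∀ σ b : ℝ, (σ = 1 ∧ G.IsLeftBreach x b ∨ σ = -1 ∧ G.IsRightBreach x b) →
      -(G.ν * G.cc x) < dist (G.γ b) x → G.dbar s x ≤ -(G.ν * G.cc x) := by
    intro σ b h hlt
    obtain ⟨Δ, hΔ0, hΔ, hmono⟩ := exists_toward hx h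
    have hd : 0 < dist (G.γ b) x := lt_of_le_of_lt (by nlinarith) hlt
    refine le_of_forall_gt_imp_ge_of_dense fun a ha => ?_
    obtain ⟨a', h1, h2⟩ := exists_between (lt_min ha hlt)
    have h3 : a' < a := h2.trans_le (min_le_left _ _)
    have h4 : a' < dist (G.γ b) x := h2.trans_le (min_le_right _ _)
    have h5 : 0 ≤ a' := by nlinarith
    obtain ⟨t, ht⟩ : ∃ t, t = a' / dist (G.γ b) x := ⟨_, rfl⟩
    have hta : t * dist (G.γ b) x = a' := by rw [ht, div_mul_cancel₀ _ hd.ne']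
    have ht0 : 0 ≤ t := by rw [ht]; positivity
    have ht1 : t < 1 := by rw [ht, div_lt_one hd]; exact h4
    obtain ⟨hy, hΔL, hm, hcc⟩ := hΔ t ht0 ht1
    have hΔ1 := (hmono 0 t le_rfl ht0 ht1).1
    rw [hΔ0] at hΔ1
    have hV : G.V s (x + t • (G.γ b - x)) = G.cc x + a' / G.ν := by
      rw [G.V_eq (notMem_interior hy), hcc, hm, hs, sub_add_cancel_left, norm_neg]
      have : ‖((σ * Δ t : ℝ) : AddCircle G.L)‖ = Δ t := by
        have habs : |σ * Δ t| = Δ t := by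
          rw [abs_mul, abs_of_nonneg hΔ1]
          rcases h with ⟨rfl, -⟩ | ⟨rfl, -⟩ <;> norm_num
        rw [G.norm_circle (by rw [habs]; exact hΔL), habs]
      rw [this, ← mul_div_assoc, hta]; ring
    have hw : x + t • (G.γ b - x) ∈ G.intruderWinning s := by
      refine ⟨notMem_interior hy, ?_⟩
      rw [hV]
      have : -G.cc x < a' / G.ν := by rw [lt_div_iff₀ hν]; linarith
      linarith
    refine (Metric.infDist_le_dist_of_mem hw).trans ?_
    rw [dist_comm, dist_eq_norm, add_sub_cancel_left, norm_smul, Real.norm_of_nonneg ht0,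
      ← dist_eq_norm, hta]
    exact h3.le
  by_cases h1 : -(G.ν * G.cc x) < dist (G.γ (G.sL x)) x
  · exact hgo 1 _ (Or.inl ⟨rfl, G.sL_spec hx'⟩) h1
  by_cases h2 : -(G.ν * G.cc x) < dist (G.γ (G.sR x)) x
  · exact hgo (-1) _ (Or.inr ⟨rfl, G.sR_spec hx'⟩) h2
  push Not at h1 h2
  have hcc : G.cc x = (G.arc (G.sR x) (G.sL x) - (dist (G.γ (G.sL x)) x +
    dist (G.γ (G.sR x)) x) / G.ν) / 2 := rfl
  have h3 : (dist (G.γ (G.sL x)) x + dist (G.γ (G.sR x)) x) / G.ν ≤ -(2 * G.cc x) := by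
    rw [div_le_iff₀ hν]; linarith
  have hℓ : G.arc (G.sR x) (G.sL x) = 0 :=
    le_antisymm (by linarith) (G.arc_nonneg _ _)
  have h4 := (G.offset_bounds hx').1
  rw [hℓ] at h4
  have h5 := abs_eq_zero.1 (le_antisymm h4 (abs_nonneg _))
  rw [mid, hℓ, h5, add_zero, zero_div, add_zero] at hs
  have h6 := dbar_le_dist (G := G) s x
  rw [G.γ_eq_of_circle_eq hs, dist_comm] at h6
  linarith

end PerimeterGame

end

noncomputable section

namespace PerimeterGame

variable {G : PerimeterGame}

/-! ### Motions -/

theorem Controls.intervalIntegrable_ω (c : G.Controls) (a b : ℝ) :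
    IntervalIntegrable c.ω volume a b :=
  (intervalIntegrable_const (c := (1 : ℝ))).mono_fun c.measurable_ω.aestronglyMeasurable
    (Eventually.of_forall fun t => by simpa using c.bound_ω t)

theorem Controls.intervalIntegrable_u (c : G.Controls) (a b : ℝ) :
    IntervalIntegrable c.u volume a b :=
  (intervalIntegrable_const (c := G.ν)).mono_fun c.measurable_u.aestronglyMeasurable
    (Eventually.of_forall fun t => by
      rw [Real.norm_of_nonneg G.ν_pos.le]; exact c.bound_u t)

theorem Controls.s_zero (c : G.Controls) (s₀ : ℝ) : c.s s₀ 0 = s₀ := by simp [Controls.s]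

theorem Controls.x_zero (c : G.Controls) (x₀ : Plane) : c.x x₀ 0 = x₀ := by simp [Controls.x]

theorem Controls.s_sub (c : G.Controls) (s₀ a b : ℝ) :
    c.s s₀ b - c.s s₀ a = ∫ τ in a..b, c.ω τ := by
  rw [Controls.s, Controls.s, add_sub_add_left_eq_sub,
    intervalIntegral.integral_interval_sub_left (c.intervalIntegrable_ω _ _)
      (c.intervalIntegrable_ω _ _)]

theorem Controls.x_sub (c : G.Controls) (x₀ : Plane) (a b : ℝ) :
    c.x x₀ b - c.x x₀ a = ∫ τ in a..b, c.u τ := by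
  rw [Controls.x, Controls.x, add_sub_add_left_eq_sub,
    intervalIntegral.integral_interval_sub_left (c.intervalIntegrable_u _ _)
      (c.intervalIntegrable_u _ _)]

theorem Controls.abs_s_sub_le (c : G.Controls) (s₀ a b : ℝ) :
    |c.s s₀ b - c.s s₀ a| ≤ |b - a| := by
  rw [c.s_sub, ← one_mul |b - a|, ← Real.norm_eq_abs]
  exact intervalIntegral.norm_integral_le_of_norm_le_const fun t _ => c.bound_ω t

theorem Controls.dist_x_le (c : G.Controls) (x₀ : Plane) (a b : ℝ) :
    dist (c.x x₀ b) (c.x x₀ a) ≤ G.ν * |b - a| := by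
  rw [dist_eq_norm, c.x_sub]
  exact intervalIntegral.norm_integral_le_of_norm_le_const fun t _ => c.bound_u t

theorem integral_eq_of_eqOn_Ico {E : Type*} [NormedAddCommGroup E] [NormedSpace ℝ E]
    [CompleteSpace E] {f : ℝ → E} {a b : ℝ} {v : E} (hab : a ≤ b) (h : ∀ t ∈ Ico a b, f t = v) :
    ∫ τ in a..b, f τ = (b - a) • v := by
  rw [← intervalIntegral.integral_const]
  refine intervalIntegral.integral_congr_ae ?_
  have : ∀ᵐ t : ℝ, t ≠ b := by simp [ae_iff]
  filter_upwards [this] with t ht ht'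
  rw [uIoc_of_le hab] at ht'
  exact h t ⟨ht'.1.le, lt_of_le_of_ne ht'.2 ht⟩

theorem IsSampling.exists_mem {δ : ℝ} {t : ℕ → ℝ} (h : IsSampling δ t) {a : ℝ} (ha : 0 ≤ a) :
    ∃ k, t k ≤ a ∧ a < t (k + 1) := by
  classical
  have hex : ∃ k, a < t k := (h.tendsto.eventually_gt_atTop a).exists
  have h1 := Nat.find_spec hex
  obtain ⟨k, hk⟩ : ∃ k, Nat.find hex = k + 1 := by
    refine Nat.exists_eq_succ_of_ne_zero fun h0 => ?_
    rw [h0, h.zero] at h1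
    linarith
  rw [hk] at h1
  exact ⟨k, not_lt.1 (Nat.find_min hex (by omega)), h1⟩

theorem IsSampling.nonneg {δ : ℝ} {t : ℕ → ℝ} (h : IsSampling δ t) (k : ℕ) : 0 ≤ t k := by
  rw [← h.zero]; exact h.strictMono.monotone (Nat.zero_le k)

/-- A continuous gap to the midpoint stays nonnegative until capture. -/
theorem nonneg_of_no_zero {g : ℝ → ℝ} {a b K : ℝ} (hab : a ≤ b) (ha : 0 ≤ g a)
    (hK : ∀ t ∈ Icc a b, ∀ t' ∈ Icc a b, |g t' - g t| ≤ K * |t' - t|)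
    (h0 : ∀ t ∈ Ico a b, g t ≠ 0) : 0 ≤ g b := by
  have hcont : ContinuousOn g (Icc a b) := by
    have : LipschitzOnWith (Real.toNNReal K) g (Icc a b) :=
      LipschitzOnWith.of_dist_le_mul fun t' ht' t ht => by
        rw [Real.dist_eq, Real.dist_eq]
        exact (hK t ht t' ht').trans
          (mul_le_mul_of_nonneg_right (Real.le_coe_toNNReal K) (abs_nonneg _))
    exact this.continuousOn
  by_contra hneg
  push Not at hneg
  obtain ⟨t, ht, hgt⟩ := intermediate_value_Icc' hab hcont ⟨hneg.le, ha⟩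
  refine h0 t ⟨ht.1, ht.2.lt_of_ne ?_⟩ hgt
  rintro rfl
  linarith

/-! ### The guarantee of the intruder -/

/-- One sampling interval of the intruder's strategy before capture. -/
theorem uStar_step {c : G.Controls} {s₀ : ℝ} {x₀ : Plane} {a b δ : ℝ} (hab : a ≤ b)
    (hδ : b - a ≤ δ)
    (hu : ∀ τ ∈ Ico a b, c.u τ = G.uStar.toFun (c.s s₀ a) (c.x x₀ a))
    (hT : ∀ τ ∈ Icc a b, c.x x₀ τ ∉ G.T)
    (haff : ∀ τ ∈ Ico a b, c.x x₀ τ ∉ G.afferentSurface (c.s s₀ τ)) :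
    G.cc (c.x x₀ a) ≤ G.cc (c.x x₀ b) ∧
      min (G.V (c.s s₀ a) (c.x x₀ a)) (G.cc (c.x x₀ a) + G.L / 2 - 2 * δ) ≤
        G.V (c.s s₀ b) (c.x x₀ b) := by
  have hν := G.ν_pos
  rcases hab.eq_or_lt with rfl | hlt
  · exact ⟨le_rfl, min_le_left _ _⟩
  obtain ⟨x, hx⟩ : ∃ x, x = c.x x₀ a := ⟨_, rfl⟩
  have hxT : x ∉ G.T := hx ▸ hT a ⟨le_rfl, hab⟩
  have hx' := notMem_interior hxT
  obtain ⟨σ, p, g, hσb, hg0, hgL, hmid, hV, hctl⟩ : ∃ σ p g : ℝ,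
      (σ = 1 ∧ G.IsLeftBreach x p ∨ σ = -1 ∧ G.IsRightBreach x p) ∧ 0 ≤ g ∧ g ≤ G.L / 2 ∧
      G.mid x = (c.s s₀ a + σ * g : ℝ) ∧ G.V (c.s s₀ a) x = G.cc x + g ∧
      G.uStar.toFun (c.s s₀ a) x = G.ν • (‖G.γ p - x‖⁻¹ • (G.γ p - x)) := by
    rcases G.state_cases hx' (c.s s₀ a) with ⟨h, g, h0, h1, h2, h3⟩ | ⟨h, g, h0, h1, h2, h3, -⟩
    · refine ⟨1, _, g, Or.inl ⟨rfl, G.sL_spec hx'⟩, h0.le, h1, ?_, h3, ?_⟩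
      · rw [h2, one_mul, AddCircle.coe_add]
      · rw [uStar]; simp only [h, if_true]
    · refine ⟨-1, _, g, Or.inr ⟨rfl, G.sR_spec hx'⟩, h0, h1, ?_, h3, ?_⟩
      · rw [h2, neg_one_mul, AddCircle.coe_add, AddCircle.coe_neg, sub_eq_add_neg]
      · rw [uStar]; simp only [h, if_false]
  have hσ : σ = 1 ∨ σ = -1 := by rcases hσb with h | h <;> simp [h.1]
  have hσ2 : σ * σ = 1 := by rcases hσ with rfl | rfl <;> norm_num
  have hσa : |σ| = 1 := by rcases hσ with rfl | rfl <;> norm_num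
  obtain ⟨Δ, hΔ0, hΔ, hmono⟩ := exists_toward hxT hσb
  obtain ⟨d, hd⟩ : ∃ d, d = dist (G.γ p) x := ⟨_, rfl⟩
  rw [← hd] at hΔ hmono
  have hd0 : 0 < d := by
    rw [hd, dist_pos]
    rintro rfl
    exact hxT (G.γ_mem p)
  have hpath : ∀ τ ∈ Icc a b, c.x x₀ τ = x + (G.ν * (τ - a) / d) • (G.γ p - x) := by
    intro τ hτ
    have h1 := c.x_sub x₀ a τ
    rw [integral_eq_of_eqOn_Ico hτ.1 (fun t ht => hu t ⟨ht.1, ht.2.trans_le hτ.2⟩), ← hx, hctl,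
      smul_smul, smul_smul, ← dist_eq_norm, ← hd] at h1
    rw [← sub_eq_iff_eq_add', h1]
    congr 1
    field_simp
  -- The intruder cannot overrun the breaching point, since it would be on T before.
  have hlam : ∀ τ ∈ Icc a b, G.ν * (τ - a) / d < 1 := by
    intro τ hτ
    by_contra hc
    push Not at hc
    rw [le_div_iff₀ hd0, one_mul] at hc
    have h1 : a + d / G.ν ∈ Icc a b := by
      have h2 : d / G.ν ≤ τ - a := by rw [div_le_iff₀ hν]; linarith
      have h3 : 0 < d / G.ν := by positivity
      exact ⟨by linarith, by linarith [hτ.2]⟩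
    have h2 := hpath _ h1
    have h3 : G.ν * (a + d / G.ν - a) / d = 1 := by field_simp; ring
    rw [h3, one_smul, add_sub_cancel] at h2
    exact hT _ h1 (h2 ▸ G.γ_mem p)
  have hlam0 : ∀ τ ∈ Icc a b, 0 ≤ G.ν * (τ - a) / d := fun τ hτ =>
    div_nonneg (mul_nonneg hν.le (by linarith [hτ.1])) hd0.le
  have hrate : ∀ τ τ' : ℝ, (G.ν * (τ' - a) / d - G.ν * (τ - a) / d) * (d / G.ν) = τ' - τ := by
    intro τ τ'
    field_simp
    ring
  have hmono' : ∀ τ ∈ Icc a b, ∀ τ' ∈ Icc a b, τ ≤ τ' →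
      Δ (G.ν * (τ - a) / d) ≤ Δ (G.ν * (τ' - a) / d) ∧
      Δ (G.ν * (τ' - a) / d) - Δ (G.ν * (τ - a) / d) ≤ τ' - τ := by
    intro τ hτ τ' hτ' hle
    have := hmono _ _ (hlam0 τ hτ) (by gcongr) (hlam τ' hτ')
    rwa [hrate] at this
  obtain ⟨gap, hgap⟩ : ∃ gap : ℝ → ℝ, ∀ τ, gap τ =
      g + Δ (G.ν * (τ - a) / d) - σ * (c.s s₀ τ - c.s s₀ a) := ⟨_, fun _ => rfl⟩
  have hmidτ : ∀ τ ∈ Icc a b, G.mid (c.x x₀ τ) = (c.s s₀ τ + σ * gap τ : ℝ) := by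
    intro τ hτ
    rw [hpath τ hτ, (hΔ _ (hlam0 τ hτ) (hlam τ hτ)).2.2.1, hmid, ← AddCircle.coe_add, hgap]
    congr 1
    linear_combination (c.s s₀ τ - c.s s₀ a) * hσ2
  have hlam_a : G.ν * (a - a) / d = 0 := by simp
  have hgapb : 0 ≤ gap b := by
    refine nonneg_of_no_zero (K := 2) hab ?_ ?_ ?_
    · rw [hgap, hlam_a, hΔ0]; simpa using hg0
    · have hone : ∀ τ ∈ Icc a b, ∀ τ' ∈ Icc a b, τ ≤ τ' → |gap τ' - gap τ| ≤ 2 * |τ' - τ| := by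
        intro τ hτ τ' hτ' hle
        obtain ⟨h1, h2⟩ := hmono' τ hτ τ' hτ' hle
        have h3 := c.abs_s_sub_le s₀ τ τ'
        have h4 : |σ * (c.s s₀ τ' - c.s s₀ τ)| ≤ |τ' - τ| := by rwa [abs_mul, hσa, one_mul]
        rw [abs_of_nonneg (by linarith : 0 ≤ τ' - τ)] at h4 ⊢
        rw [abs_le] at h4 ⊢
        rw [hgap, hgap]
        constructor <;> linarith
      intro τ hτ τ' hτ'
      rcases le_total τ τ' with h | h
      · exact hone τ hτ τ' hτ' h
      · rw [abs_sub_comm, abs_sub_comm τ']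
        exact hone τ' hτ' τ hτ h
    · intro τ hτ h0
      refine haff τ hτ ((G.mem_afferentSurface_iff).2
        ⟨notMem_interior (hT τ ⟨hτ.1, hτ.2.le⟩), ?_⟩)
      rw [hmidτ τ ⟨hτ.1, hτ.2.le⟩, h0, mul_zero, add_zero]
  have hb : b ∈ Icc a b := ⟨hab, le_rfl⟩
  obtain ⟨h1, h2⟩ := hmono' a ⟨le_rfl, hab⟩ b hb hab
  rw [hlam_a, hΔ0] at h1 h2
  have hccb : G.cc (c.x x₀ b) = G.cc x + (b - a) - Δ (G.ν * (b - a) / d) := by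
    rw [hpath b hb, (hΔ _ (hlam0 b hb) (hlam b hb)).2.2.2]
    have := hrate a b
    rw [hlam_a, sub_zero] at this
    rw [this]
  have hs : |σ * (c.s s₀ b - c.s s₀ a)| ≤ b - a := by
    rw [abs_mul, hσa, one_mul]
    have := c.abs_s_sub_le s₀ a b
    rwa [abs_of_nonneg (by linarith : 0 ≤ b - a)] at this
  rw [abs_le] at hs
  have hVb : G.V (c.s s₀ b) (c.x x₀ b) = G.cc (c.x x₀ b) + ‖(gap b : AddCircle G.L)‖ := by
    rw [G.V_eq (notMem_interior (hT b hb)), hmidτ b hb, AddCircle.coe_add, sub_add_cancel_left,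
      norm_neg]
    rcases hσ with rfl | rfl
    · rw [one_mul]
    · rw [neg_one_mul, AddCircle.coe_neg, norm_neg]
  have hgb := hgap b
  rw [← hx]
  refine ⟨by linarith, ?_⟩
  -- The signed gap cannot change sign without a capture, but it may exceed half a turn. It grows by
  -- at most 2δ, so the circular distance is then still at least L/2 - 2δ.
  rcases le_total (gap b) (G.L / 2) with h | h
  · refine (min_le_left _ _).trans ?_
    rw [hVb, hV, G.norm_circle_of_nonneg hgapb h]
    linarith
  · refine (min_le_right _ _).trans ?_
    have h3 : G.L / 2 - 2 * δ ≤ ‖(gap b : AddCircle G.L)‖ := by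
      rcases le_total 0 (G.L - gap b) with h4 | h4
      · have h5 : (gap b : AddCircle G.L) = -((G.L - gap b : ℝ) : AddCircle G.L) := by
          rw [AddCircle.coe_sub, AddCircle.coe_period, zero_sub, neg_neg]
        rw [h5, norm_neg, G.norm_circle_of_nonneg h4 (by linarith)]
        linarith
      · linarith [norm_nonneg (gap b : AddCircle G.L)]
    rw [hVb]
    linarith

theorem mem_afferentSurface_of_nonpos {s : ℝ} {x : Plane} (hx : x ∉ interior G.T) (hxT : x ∈ G.T)
    (hV : G.V s x ≤ 0) : x ∈ G.afferentSurface s := by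
  obtain ⟨b, rfl⟩ := G.exists_γ_eq hxT hx
  rw [V_γ] at hV
  refine (G.mem_afferentSurface_iff).2 ⟨hx, ?_⟩
  rw [(G.frontier_values hx hxT rfl).2, ← sub_eq_zero, ← norm_le_zero_iff]
  exact hV

theorem le_neg_dbar_of_captured {c : G.Controls} {s₀ : ℝ} {x₀ : Plane} {δ t : ℝ}
    (hδ : 0 < δ) (hx₀ : x₀ ∉ interior G.T) (hV : G.V s₀ x₀ ≤ 0)
    (hc : c.IntruderFollows s₀ x₀ G.uStar δ)
    (ht : c.CapturedAt s₀ x₀ t) :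
    G.ν * (G.V s₀ x₀ - 2 * δ) ≤ -G.dbar (c.s s₀ t) (c.x x₀ t) := by
  have hν := G.ν_pos
  obtain ⟨ht0, haff, hbefore⟩ := ht
  obtain ⟨hxi, hst⟩ := (G.mem_afferentSurface_iff).1 haff
  by_cases hxT : c.x x₀ t ∈ G.T
  · obtain ⟨b, hb⟩ := G.exists_γ_eq hxT hxi
    have h1 := dbar_le_dist (G := G) (c.s s₀ t) (c.x x₀ t)
    rw [(G.frontier_values hxi hxT hb).2] at hst
    rw [G.γ_eq_of_circle_eq hst, hb, dist_self] at h1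
    nlinarith
  have hT : ∀ τ, 0 ≤ τ → τ ≤ t → c.x x₀ τ ∉ G.T := fun τ h0 h1 => by
    rcases h1.eq_or_lt with rfl | h
    · exact hxT
    · exact (hbefore τ h0 h).2
  obtain ⟨ts, hts, hu⟩ := hc
  have hx₀' : x₀ ∉ G.T := by
    have := hT 0 le_rfl ht0
    rwa [c.x_zero] at this
  have hVcc : G.V s₀ x₀ ≤ G.cc x₀ + G.L / 2 := by
    rw [G.V_eq hx₀]
    linarith [G.norm_circle_le_half ((s₀ : AddCircle G.L) - G.mid x₀)]
  have step : ∀ k, ∀ τ, ts k ≤ τ → τ ≤ ts (k + 1) → τ ≤ t →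
      (G.cc x₀ ≤ G.cc (c.x x₀ (ts k)) ∧
        G.V s₀ x₀ - 2 * δ ≤ G.V (c.s s₀ (ts k)) (c.x x₀ (ts k))) →
      G.cc x₀ ≤ G.cc (c.x x₀ τ) ∧ G.V s₀ x₀ - 2 * δ ≤ G.V (c.s s₀ τ) (c.x x₀ τ) := by
    intro k τ h1 h2 h3 ⟨h4, h5⟩
    have hk := hts.nonneg k
    obtain ⟨h6, h7⟩ := uStar_step (c := c) (s₀ := s₀) (x₀ := x₀) (δ := δ) h1
      (by linarith [hts.mesh k])
      (fun r hr => hu k r ⟨hr.1, hr.2.trans_le h2⟩)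
      (fun r hr => hT r (by linarith [hr.1]) (by linarith [hr.2]))
      (fun r hr => (hbefore r (by linarith [hr.1]) (by linarith [hr.2])).1)
    -- The loss of 2δ does not accumulate: the second entry of the minimum is bounded through cc₀ +
    -- L/2 ≥ V₀, afresh in each interval.
    refine ⟨h4.trans h6, le_trans (le_min h5 ?_) h7⟩
    linarith
  have hall : ∀ k, ts k ≤ t → G.cc x₀ ≤ G.cc (c.x x₀ (ts k)) ∧
      G.V s₀ x₀ - 2 * δ ≤ G.V (c.s s₀ (ts k)) (c.x x₀ (ts k)) := by
    intro k
    induction k with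
    | zero =>
      intro _
      rw [hts.zero, c.x_zero, c.s_zero]
      exact ⟨le_rfl, by linarith⟩
    | succ k ih =>
      intro hk
      have h1 : ts k ≤ ts (k + 1) := (hts.strictMono (Nat.lt_succ_self k)).le
      exact step k _ h1 le_rfl hk (ih (h1.trans hk))
  obtain ⟨k, hk1, hk2⟩ := hts.exists_mem ht0
  have hfin := (step k t hk1 hk2.le le_rfl (hall k hk1)).2
  have hVt : G.V (c.s s₀ t) (c.x x₀ t) = G.cc (c.x x₀ t) := by
    rw [G.V_eq hxi, hst, sub_self, norm_zero, add_zero]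
  rcases le_or_gt (G.cc (c.x x₀ t)) 0 with h | h
  · have := dbar_le_neg hxT hst h
    rw [hVt] at hfin
    have := mul_le_mul_of_nonneg_left hfin hν.le
    linarith
  · rw [dbar_eq_zero hxi (by rw [hVt]; exact h)]
    nlinarith

end PerimeterGame

end

noncomputable section

/-- Apply the local hypothesis at the supremum of the times where P holds: it carries P from just
before to just after. No closedness of P is needed. -/
theorem chain_induction {P : ℝ → Prop} {a b : ℝ} (hab : a ≤ b) (ha : P a)
    (h : ∀ t ∈ Icc a b, ∃ ε > 0, ∀ t₁ ∈ Icc a b, ∀ t₂ ∈ Icc a b, |t₁ - t| < ε → |t₂ - t| < ε →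
      t₁ ≤ t₂ → P t₁ → P t₂) : P b := by
  have hne : ({t | t ∈ Icc a b ∧ P t}).Nonempty := ⟨a, ⟨le_rfl, hab⟩, ha⟩
  have hbdd : BddAbove {t | t ∈ Icc a b ∧ P t} := ⟨b, fun t ht => ht.1.2⟩
  obtain ⟨m, hm⟩ : ∃ m, m = sSup {t | t ∈ Icc a b ∧ P t} := ⟨_, rfl⟩
  have hmb : m ≤ b := hm ▸ csSup_le hne fun t ht => ht.1.2
  have ham : a ≤ m := hm ▸ le_csSup hbdd ⟨⟨le_rfl, hab⟩, ha⟩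
  obtain ⟨ε, hε, h1⟩ := h m ⟨ham, hmb⟩
  obtain ⟨t₁, ⟨ht₁, hP⟩, hlt⟩ := exists_lt_of_lt_csSup hne (b := m - ε) (by rw [← hm]; linarith)
  have ht₁m : t₁ ≤ m := hm ▸ le_csSup hbdd ⟨ht₁, hP⟩
  have h2 : ∀ t₂ ∈ Icc a b, m ≤ t₂ → t₂ < m + ε → P t₂ := fun t₂ ht₂ h3 h4 =>
    h1 t₁ ht₁ t₂ ht₂ (by rw [abs_lt]; constructor <;> linarith)
      (by rw [abs_lt]; constructor <;> linarith) (ht₁m.trans h3) hP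
  rcases hmb.eq_or_lt with h3 | h3
  · exact h3 ▸ h2 m ⟨ham, hmb⟩ le_rfl (by linarith)
  · exfalso
    have h4 : m < min b (m + ε / 2) := lt_min h3 (by linarith)
    have h5 : min b (m + ε / 2) ∈ Icc a b := ⟨ham.trans h4.le, min_le_left _ _⟩
    have h6 := le_csSup hbdd ⟨h5, h2 _ h5 h4.le ((min_le_right _ _).trans_lt (by linarith))⟩
    rw [← hm] at h6
    linarith

namespace PerimeterGame

variable {G : PerimeterGame}

/-! ### The guarantee of the defender -/

theorem Controls.s_eq_of_const {c : G.Controls} {s₀ σ a b : ℝ} (hab : a ≤ b)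
    (hω : ∀ τ ∈ Ico a b, c.ω τ = σ) : c.s s₀ b = c.s s₀ a + σ * (b - a) := by
  have := c.s_sub s₀ a b
  rw [integral_eq_of_eqOn_Ico hab hω, smul_eq_mul] at this
  linarith

/-- The gap between defender and midpoint while the defender approaches it, locally. -/
theorem LocalLift.step {κ r : ℝ} {y : Plane} {M : Plane → ℝ} (hM : G.LocalLift κ r y M)
    (hκ : 0 ≤ κ) {c : G.Controls} {s₀ : ℝ} {x₀ : Plane} {σ a b g : ℝ} (hσ : σ = 1 ∨ σ = -1)
    (hab : a ≤ b) (hω : ∀ τ ∈ Ico a b, c.ω τ = σ)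
    (hnear : ∀ τ ∈ Icc a b, dist (c.x x₀ τ) y < r)
    (haff : ∀ τ ∈ Ico a b, c.x x₀ τ ∉ G.afferentSurface (c.s s₀ τ))
    (hg : 0 ≤ g) (hmid : G.mid (c.x x₀ a) = (c.s s₀ a + σ * g : ℝ)) :
    ∃ g', 0 ≤ g' ∧ g' ≤ g - (1 - κ) * (b - a) ∧
      G.mid (c.x x₀ b) = (c.s s₀ b + σ * g' : ℝ) ∧
      ∃ v ∈ G.T, (G.cc (c.x x₀ b) + g') - (G.cc (c.x x₀ a) + g) ≤
        inner ℝ (c.x x₀ b - c.x x₀ a) (‖v - c.x x₀ a‖⁻¹ • (v - c.x x₀ a)) / G.ν - (b - a) := by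
  have hν := G.ν_pos
  have hσ2 : σ * σ = 1 := by rcases hσ with rfl | rfl <;> norm_num
  have hσa : |σ| = 1 := by rcases hσ with rfl | rfl <;> norm_num
  have haI : a ∈ Icc a b := ⟨le_rfl, hab⟩
  have hbI : b ∈ Icc a b := ⟨hab, le_rfl⟩
  have hlip : ∀ τ ∈ Icc a b, ∀ τ' ∈ Icc a b,
      |σ * (M (c.x x₀ τ') - M (c.x x₀ τ))| ≤ κ * |τ' - τ| := by
    intro τ hτ τ' hτ'
    rw [abs_mul, hσa, one_mul]
    refine (hM.contr _ _ (hnear τ hτ) (hnear τ' hτ')).trans ?_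
    refine mul_le_mul_of_nonneg_left ?_ hκ
    rw [div_le_iff₀ hν, mul_comm]
    exact c.dist_x_le x₀ τ τ'
  -- The defender runs at unit speed in the direction σ while the midpoint moves at speed at most κ;
  -- a zero of the gap would be a capture.
  obtain ⟨gap, hgap⟩ : ∃ gap : ℝ → ℝ, ∀ τ, gap τ =
      g + σ * (M (c.x x₀ τ) - M (c.x x₀ a)) - (τ - a) := ⟨_, fun _ => rfl⟩
  have hmidτ : ∀ τ ∈ Icc a b, G.mid (c.x x₀ τ) = (c.s s₀ τ + σ * gap τ : ℝ) := by
    intro τ hτ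
    have h1 : G.mid (c.x x₀ τ) = G.mid (c.x x₀ a) +
        ((M (c.x x₀ τ) - M (c.x x₀ a) : ℝ) : AddCircle G.L) := by
      rw [hM.lift _ (hnear τ hτ), hM.lift _ (hnear a haI), ← AddCircle.coe_add, add_sub_cancel]
    rw [h1, hmid, ← AddCircle.coe_add, hgap,
      c.s_eq_of_const hτ.1 (fun t ht => hω t ⟨ht.1, ht.2.trans_le hτ.2⟩)]
    congr 1
    linear_combination (-(M (c.x x₀ τ) - M (c.x x₀ a))) * hσ2
  have hgapb : 0 ≤ gap b := by
    refine nonneg_of_no_zero (K := κ + 1) hab ?_ ?_ ?_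
    · rw [hgap]; simpa using hg
    · intro τ hτ τ' hτ'
      have h1 := hlip τ hτ τ' hτ'
      have e : gap τ' - gap τ = σ * (M (c.x x₀ τ') - M (c.x x₀ τ)) - (τ' - τ) := by
        rw [hgap, hgap]; ring
      rw [e]
      refine (abs_sub _ _).trans ?_
      linarith
    · intro τ hτ h0
      have hτ' : τ ∈ Icc a b := ⟨hτ.1, hτ.2.le⟩
      refine haff τ hτ ((G.mem_afferentSurface_iff).2
        ⟨notMem_interior (hM.notMem _ (hnear τ hτ')), ?_⟩)
      rw [hmidτ τ hτ', h0, mul_zero, add_zero]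
  refine ⟨gap b, hgapb, ?_, hmidτ b hbI, ?_⟩
  · have h1 := (abs_le.1 (hlip a haI b hbI)).2
    rw [abs_of_nonneg (by linarith : 0 ≤ b - a)] at h1
    rw [hgap]; linarith
  · obtain ⟨v, hv, hle⟩ := hM.slope σ hσ _ _ (hnear a haI) (hnear b hbI)
    refine ⟨v, hv, ?_⟩
    rw [hgap]; linarith

theorem inner_unit_x_le (c : G.Controls) (x₀ : Plane) {a b : ℝ} (hab : a ≤ b) (w : Plane) :
    inner ℝ (c.x x₀ b - c.x x₀ a) (‖w‖⁻¹ • w) / G.ν ≤ b - a := by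
  rw [div_le_iff₀ G.ν_pos, mul_comm]
  refine (inner_unit_le _ _).trans ?_
  have := c.dist_x_le x₀ a b
  rwa [dist_eq_norm, abs_of_nonneg (by linarith)] at this

/-- The gap between defender and midpoint while the defender approaches it. -/
theorem advance {D κ : ℝ} (hκ : 0 ≤ κ)
    (hlift : ∀ y, D ≤ Metric.infDist y G.T → ∃ r M, 0 < r ∧ G.LocalLift κ r y M)
    {c : G.Controls} {s₀ : ℝ} {x₀ : Plane} {σ a b g : ℝ} (hσ : σ = 1 ∨ σ = -1)
    (hab : a ≤ b) (hω : ∀ τ ∈ Ico a b, c.ω τ = σ)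
    (hD : ∀ τ ∈ Icc a b, D ≤ Metric.infDist (c.x x₀ τ) G.T)
    (haff : ∀ τ ∈ Ico a b, c.x x₀ τ ∉ G.afferentSurface (c.s s₀ τ))
    (hg : 0 ≤ g) (hmid : G.mid (c.x x₀ a) = (c.s s₀ a + σ * g : ℝ)) :
    ∃ g', 0 ≤ g' ∧ g' ≤ g - (1 - κ) * (b - a) ∧
      G.mid (c.x x₀ b) = (c.s s₀ b + σ * g' : ℝ) ∧
      G.cc (c.x x₀ b) + g' ≤ G.cc (c.x x₀ a) + g := by
  refine chain_induction (P := fun t => ∃ g', 0 ≤ g' ∧ g' ≤ g - (1 - κ) * (t - a) ∧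
      G.mid (c.x x₀ t) = (c.s s₀ t + σ * g' : ℝ) ∧
      G.cc (c.x x₀ t) + g' ≤ G.cc (c.x x₀ a) + g) hab ⟨g, hg, by simp, hmid, le_rfl⟩ ?_
  intro t ht
  obtain ⟨r, M, hr, hM⟩ := hlift _ (hD t ht)
  have hν := G.ν_pos
  refine ⟨r / G.ν, by positivity, ?_⟩
  rintro t₁ ht₁ t₂ ht₂ h1 h2 h12 ⟨g₁, hg0, hgle, hm, hc⟩
  rw [abs_lt] at h1 h2
  obtain ⟨g', h3, h4, h5, v, -, h6⟩ := hM.step hκ (c := c) (s₀ := s₀) (x₀ := x₀) hσ h12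
    (fun τ hτ => hω τ ⟨ht₁.1.trans hτ.1, hτ.2.trans_le ht₂.2⟩)
    (fun τ hτ => by
      refine (c.dist_x_le x₀ t τ).trans_lt ?_
      rw [← lt_div_iff₀' hν, abs_lt]
      constructor <;> linarith [hτ.1, hτ.2])
    (fun τ hτ => haff τ ⟨ht₁.1.trans hτ.1, hτ.2.trans_le ht₂.2⟩) hg0 hm
  refine ⟨g', h3, by linarith, h5, ?_⟩
  linarith [inner_unit_x_le c x₀ h12 (v - c.x x₀ t₁)]

theorem Controls.continuous_x (c : G.Controls) (x₀ : Plane) : Continuous (c.x x₀) := by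
  have : LipschitzWith (Real.toNNReal G.ν) (c.x x₀) := LipschitzWith.of_dist_le_mul fun b a => by
    rw [Real.coe_toNNReal _ G.ν_pos.le, Real.dist_eq]
    exact c.dist_x_le x₀ a b
  exact this.continuous

theorem exists_infDist_bound {c : G.Controls} {x₀ : Plane} {b : ℝ}
    (hT : ∀ τ ∈ Icc 0 b, c.x x₀ τ ∉ G.T) :
    ∃ D > 0, ∀ τ ∈ Icc 0 b, D ≤ Metric.infDist (c.x x₀ τ) G.T := by
  rcases (Icc (0 : ℝ) b).eq_empty_or_nonempty with h | h
  · exact ⟨1, one_pos, by simp [h]⟩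
  · obtain ⟨t, ht, hmin⟩ := isCompact_Icc.exists_isMinOn h
      ((Metric.continuous_infDist_pt G.T).comp (c.continuous_x x₀)).continuousOn
    exact ⟨_, infDist_pos (hT t ht), fun τ hτ => hmin hτ⟩

/-- Until capture the defender's strategy is constant and its gap to the midpoint shrinks. -/
theorem omegaStar_gap {c : G.Controls} {s₀ : ℝ} {x₀ : Plane} {δ σ g b : ℝ}
    (hb : 0 ≤ b) (hc : c.DefenderFollows s₀ x₀ G.omegaStar δ)
    (hT : ∀ τ ∈ Icc 0 b, c.x x₀ τ ∉ G.T)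
    (haff : ∀ τ ∈ Ico 0 b, c.x x₀ τ ∉ G.afferentSurface (c.s s₀ τ))
    (hg : 0 ≤ g) (hgL : g ≤ G.L / 2) (hmid : G.mid x₀ = (s₀ + σ * g : ℝ))
    (hσ : σ = 1 ∧ x₀ ∈ G.leftRegion s₀ ∨ σ = -1 ∧ x₀ ∉ G.leftRegion s₀) :
    (∀ τ ∈ Ico 0 b, c.ω τ = σ) ∧ ∃ g', 0 ≤ g' ∧ g' ≤ g ∧
      G.mid (c.x x₀ b) = (c.s s₀ b + σ * g' : ℝ) ∧ G.cc (c.x x₀ b) + g' ≤ G.cc x₀ + g := by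
  obtain ⟨D, hD0, hD⟩ := exists_infDist_bound hT
  obtain ⟨κ, hκ0, hκ1, hlift⟩ := G.exists_localLift hD0
  have hσ' : σ = 1 ∨ σ = -1 := by rcases hσ with h | h <;> simp [h.1]
  obtain ⟨ts, hts, hω⟩ := hc
  have hF : ∀ t g', 0 ≤ t → t < b → 0 ≤ g' → g' ≤ g - (1 - κ) * t →
      G.mid (c.x x₀ t) = (c.s s₀ t + σ * g' : ℝ) →
      G.omegaStar.toFun (c.s s₀ t) (c.x x₀ t) = σ := by
    intro t g' h0 h1 h2 h3 h4
    have hxi := notMem_interior (hT t ⟨h0, h1.le⟩)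
    have hres : σ = 1 ∧ c.x x₀ t ∈ G.leftRegion (c.s s₀ t) ∨
        σ = -1 ∧ c.x x₀ t ∉ G.leftRegion (c.s s₀ t) := by
      rcases h0.eq_or_lt with rfl | h0
      · rwa [c.x_zero, c.s_zero]
      have h5 : g' ≠ 0 := fun h => haff t ⟨h0.le, h1⟩ ((G.mem_afferentSurface_iff).2
        ⟨hxi, by rw [h4, h, mul_zero, add_zero]⟩)
      -- After time 0 the gap is strictly below half a turn, so the feedback cannot flip at the
      -- antipode. At time 0 the sign is given.
      have h6 : g' < G.L / 2 := by
        have : 0 < (1 - κ) * t := mul_pos (by linarith) h0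
        linarith
      rcases hσ' with rfl | rfl
      · exact Or.inl ⟨rfl, G.mem_leftRegion_of_lt hxi (h2.lt_of_ne' h5) h6
          (by rw [h4, one_mul, AddCircle.coe_add])⟩
      · exact Or.inr ⟨rfl, G.notMem_leftRegion_of_lt hxi (h2.lt_of_ne' h5) h6
          (by rw [h4, neg_one_mul, AddCircle.coe_add, AddCircle.coe_neg, sub_eq_add_neg])⟩
    rw [omegaStar]
    rcases hres with ⟨rfl, h⟩ | ⟨rfl, h⟩
    · simp only [h, if_true]
    · simp only [h, if_false]
  have step : ∀ k, ∀ t, ts k ≤ t → t ≤ ts (k + 1) → t ≤ b → ts k < b →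
      ((∀ τ ∈ Ico 0 (ts k), c.ω τ = σ) ∧ ∃ g', 0 ≤ g' ∧ g' ≤ g - (1 - κ) * ts k ∧
        G.mid (c.x x₀ (ts k)) = (c.s s₀ (ts k) + σ * g' : ℝ) ∧
        G.cc (c.x x₀ (ts k)) + g' ≤ G.cc x₀ + g) →
      ((∀ τ ∈ Ico 0 t, c.ω τ = σ) ∧ ∃ g', 0 ≤ g' ∧ g' ≤ g - (1 - κ) * t ∧
        G.mid (c.x x₀ t) = (c.s s₀ t + σ * g' : ℝ) ∧
        G.cc (c.x x₀ t) + g' ≤ G.cc x₀ + g) := by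
    rintro k t h1 h2 h3 h4 ⟨h5, g', h6, h7, h8, h9⟩
    have hk := hts.nonneg k
    have hω' : ∀ τ ∈ Ico (ts k) t, c.ω τ = σ := fun τ hτ => by
      rw [hω k τ ⟨hτ.1, hτ.2.trans_le h2⟩]
      exact hF _ g' hk h4 h6 h7 h8
    obtain ⟨g'', h10, h11, h12, h13⟩ := advance hκ0 hlift (c := c) (s₀ := s₀) (x₀ := x₀) hσ' h1 hω'
      (fun τ hτ => hD τ ⟨hk.trans hτ.1, hτ.2.trans h3⟩)
      (fun τ hτ => haff τ ⟨hk.trans hτ.1, hτ.2.trans_le h3⟩) h6 h8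
    refine ⟨fun τ hτ => ?_, g'', h10, by linarith, h12, by linarith⟩
    rcases lt_or_ge τ (ts k) with h | h
    · exact h5 τ ⟨hτ.1, h⟩
    · exact hω' τ ⟨h, hτ.2⟩
  have hall : ∀ k, ts k ≤ b →
      ((∀ τ ∈ Ico 0 (ts k), c.ω τ = σ) ∧ ∃ g', 0 ≤ g' ∧ g' ≤ g - (1 - κ) * ts k ∧
        G.mid (c.x x₀ (ts k)) = (c.s s₀ (ts k) + σ * g' : ℝ) ∧
        G.cc (c.x x₀ (ts k)) + g' ≤ G.cc x₀ + g) := by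
    intro k
    induction k with
    | zero =>
      intro _
      rw [hts.zero, c.x_zero, c.s_zero]
      exact ⟨by simp, g, hg, by simp, hmid, le_rfl⟩
    | succ k ih =>
      intro hk
      have h1 : ts k < ts (k + 1) := hts.strictMono (Nat.lt_succ_self k)
      exact step k _ h1.le le_rfl hk (h1.trans_le hk) (ih (h1.le.trans hk))
  obtain ⟨k, hk1, hk2⟩ := hts.exists_mem hb
  have hfin : ((∀ τ ∈ Ico 0 b, c.ω τ = σ) ∧ ∃ g', 0 ≤ g' ∧ g' ≤ g - (1 - κ) * b ∧
        G.mid (c.x x₀ b) = (c.s s₀ b + σ * g' : ℝ) ∧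
        G.cc (c.x x₀ b) + g' ≤ G.cc x₀ + g) := by
    rcases hk1.eq_or_lt with h | h
    · have := hall k h.le
      rwa [h] at this
    · exact step k b hk1 hk2.le le_rfl h (hall k hk1)
  obtain ⟨h1, g', h2, h3, h4, h5⟩ := hfin
  refine ⟨h1, g', h2, ?_, h4, h5⟩
  have : 0 ≤ (1 - κ) * b := mul_nonneg (by linarith) hb
  linarith

theorem exists_signed_gap {s₀ : ℝ} {x₀ : Plane} (hx₀ : x₀ ∉ interior G.T) :
    ∃ σ g, 0 ≤ g ∧ g ≤ G.L / 2 ∧ G.mid x₀ = (s₀ + σ * g : ℝ) ∧ G.V s₀ x₀ = G.cc x₀ + g ∧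
      (σ = 1 ∧ x₀ ∈ G.leftRegion s₀ ∨ σ = -1 ∧ x₀ ∉ G.leftRegion s₀) := by
  rcases G.state_cases hx₀ s₀ with ⟨h, g, h0, h1, h2, h3⟩ | ⟨h, g, h0, h1, h2, h3, -⟩
  · exact ⟨1, g, h0.le, h1, by rw [h2, one_mul, AddCircle.coe_add], h3, Or.inl ⟨rfl, h⟩⟩
  · exact ⟨-1, g, h0, h1,
      by rw [h2, neg_one_mul, AddCircle.coe_add, AddCircle.coe_neg, sub_eq_add_neg], h3,
      Or.inr ⟨rfl, h⟩⟩

theorem norm_signed {σ g : ℝ} (hσ : σ = 1 ∨ σ = -1) : ‖((σ * g : ℝ) : AddCircle G.L)‖ =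
    ‖(g : AddCircle G.L)‖ := by
  rcases hσ with rfl | rfl
  · rw [one_mul]
  · rw [neg_one_mul, AddCircle.coe_neg, norm_neg]

/-- The first time at which the state is on the afferent surface or the intruder is on the target
is a capture, and the value has not increased by then. -/
theorem omegaStar_first {c : G.Controls} {s₀ : ℝ} {x₀ : Plane} {δ t : ℝ}
    (hx₀ : x₀ ∉ interior G.T) (hV : G.V s₀ x₀ ≤ 0)
    (hc : c.DefenderFollows s₀ x₀ G.omegaStar δ) (ht0 : 0 ≤ t)
    (ht : c.x x₀ t ∈ G.afferentSurface (c.s s₀ t) ∨ c.x x₀ t ∈ G.T)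
    (hbefore : ∀ τ, 0 ≤ τ → τ < t →
      c.x x₀ τ ∉ G.afferentSurface (c.s s₀ τ) ∧ c.x x₀ τ ∉ G.T) :
    c.x x₀ t ∈ G.afferentSurface (c.s s₀ t) ∧ G.V (c.s s₀ t) (c.x x₀ t) ≤ G.V s₀ x₀ := by
  have hν := G.ν_pos
  rcases ht0.eq_or_lt with rfl | htpos
  · rw [c.x_zero, c.s_zero] at ht ⊢
    refine ⟨ht.elim id fun h => mem_afferentSurface_of_nonpos hx₀ h hV, le_rfl⟩
  obtain ⟨σ, g, hg0, hgL, hmid, hVg, hσ⟩ := exists_signed_gap (s₀ := s₀) hx₀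
  have hσ' : σ = 1 ∨ σ = -1 := by rcases hσ with h | h <;> simp [h.1]
  by_cases hxT : c.x x₀ t ∈ G.T
  -- Shortly before contact, cc ≥ -(t - b) and cc + gap ≤ 0, so gap and distance from the midpoint
  -- to the contact point are of order t - b. The triangle inequality over γ at time b and over p
  -- adds up to at most 5(t - b); letting b tend to t, the defender stands at the contact point.
  · have key : ∀ b, 0 ≤ b → b < t → -(t - b) ≤ G.V s₀ x₀ ∧
        dist (G.γ (c.s s₀ t)) (c.x x₀ t) ≤ 5 * (t - b) := by
      intro b hb0 hbt
      have hbT := (hbefore b hb0 hbt).2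
      obtain ⟨-, g', h1, -, h2, h3⟩ := omegaStar_gap hb0 hc
        (fun τ hτ => (hbefore τ hτ.1 (hτ.2.trans_lt hbt)).2)
        (fun τ hτ => (hbefore τ hτ.1 (hτ.2.trans hbt)).1) hg0 hgL hmid hσ
      have hd := c.dist_x_le x₀ b t
      rw [abs_of_pos (by linarith : 0 < t - b)] at hd
      have hd' : dist (c.x x₀ t) (c.x x₀ b) / G.ν ≤ t - b := by
        rw [div_le_iff₀ hν]; linarith
      have h4 := neg_infDist_le_cc hbT hxT
      refine ⟨by linarith, ?_⟩
      obtain ⟨p, l, hl0, hl1, hp, hvis⟩ := G.exists_first hbT hxT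
      have hpd : dist (G.γ p) (c.x x₀ b) ≤ dist (c.x x₀ t) (c.x x₀ b) := by
        rw [hp, dist_eq_norm, add_sub_cancel_left, norm_smul, Real.norm_of_nonneg hl0.le,
          dist_eq_norm]
        exact mul_le_of_le_one_left (norm_nonneg _) hl1
      have h5 := G.norm_mid_sub_le hbT hvis (by linarith)
      have h6 : dist (G.γ p) (c.x x₀ b) / G.ν ≤ t - b :=
        (div_le_div_of_nonneg_right hpd hν.le).trans hd'
      have h7 : dist (G.γ (c.s s₀ b)) (G.γ p) ≤ 2 * (t - b) := by
        refine (G.dist_γ_le_norm _ _).trans ?_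
        have h8 : (c.s s₀ b : AddCircle G.L) - p =
            (G.mid (c.x x₀ b) - p) - ((σ * g' : ℝ) : AddCircle G.L) := by
          rw [h2, AddCircle.coe_add]; abel
        rw [h8]
        refine (norm_sub_le _ _).trans ?_
        rw [norm_signed hσ']
        have h9 := G.norm_circle_le g'
        rw [abs_of_nonneg h1] at h9
        linarith
      have h8 : dist (G.γ (c.s s₀ t)) (G.γ (c.s s₀ b)) ≤ t - b := by
        refine (G.dist_γ_le _ _).trans ?_
        have := c.abs_s_sub_le s₀ b t
        rwa [abs_of_pos (by linarith : 0 < t - b)] at this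
      have h9 : G.ν * (t - b) ≤ t - b := mul_le_of_le_one_left (by linarith) G.ν_le_one
      have h10 := dist_triangle (G.γ (c.s s₀ t)) (G.γ (c.s s₀ b)) (c.x x₀ t)
      have h11 := dist_triangle (G.γ (c.s s₀ b)) (G.γ p) (c.x x₀ t)
      have h12 : dist (G.γ p) (c.x x₀ t) ≤ dist (c.x x₀ t) (c.x x₀ b) := by
        rw [hp, dist_eq_norm, dist_eq_norm]
        rw [show c.x x₀ b + l • (c.x x₀ t - c.x x₀ b) - c.x x₀ t =
          -((1 - l) • (c.x x₀ t - c.x x₀ b)) by module, norm_neg, norm_smul,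
          Real.norm_of_nonneg (by linarith)]
        exact mul_le_of_le_one_left (norm_nonneg _) (by linarith)
      linarith
    have hlim : ∀ A : ℝ, (∀ b, 0 ≤ b → b < t → A ≤ 5 * (t - b)) → A ≤ 0 := by
      intro A hA
      by_contra hneg
      push Not at hneg
      have h1 := hA (max 0 (t - A / 10)) (le_max_left _ _) (max_lt htpos (by linarith))
      linarith [le_max_right 0 (t - A / 10)]
    have hγ : G.γ (c.s s₀ t) = c.x x₀ t :=
      dist_le_zero.1 (hlim _ fun b h0 h1 => (key b h0 h1).2)
    have hV0 : -G.V s₀ x₀ ≤ 0 := hlim _ fun b h0 h1 => by linarith [(key b h0 h1).1]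
    have h0 : G.V (c.s s₀ t) (c.x x₀ t) = 0 := by
      rw [← hγ, V_γ, sub_self, norm_zero]
    refine ⟨mem_afferentSurface_of_nonpos ?_ hxT h0.le, by linarith⟩
    rw [← hγ]
    exact G.γ_notMem_interior _
  · have haff := ht.resolve_right hxT
    obtain ⟨-, g', h1, -, h2, h3⟩ := omegaStar_gap ht0 hc
      (fun τ hτ => by
        rcases hτ.2.eq_or_lt with rfl | h
        · exact hxT
        · exact (hbefore τ hτ.1 h).2)
      (fun τ hτ => (hbefore τ hτ.1 hτ.2).1) hg0 hgL hmid hσ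
    refine ⟨haff, ?_⟩
    obtain ⟨h4, h5⟩ := (G.mem_afferentSurface_iff).1 haff
    rw [G.V_eq h4, h5, sub_self, norm_zero]
    linarith

/-- Off T the midpoint has a local Lipschitz lift. Including all times on T avoids any continuity
question there; closedness yields a first time. -/
theorem captured_set_closed (c : G.Controls) (s₀ : ℝ) (x₀ : Plane) :
    IsClosed {t | c.x x₀ t ∈ G.T ∨ G.mid (c.x x₀ t) = (c.s s₀ t : AddCircle G.L)} := by
  rw [← isOpen_compl_iff, isOpen_iff_mem_nhds]
  intro t ht
  simp only [mem_compl_iff, mem_ofPred_eq, not_or] at ht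
  obtain ⟨hT, hne⟩ := ht
  obtain ⟨κ, r, M, -, hr, hM⟩ := exists_localLift_at hT
  have hball : ∀ᶠ t' in 𝓝 t, dist (c.x x₀ t') (c.x x₀ t) < r :=
    (c.continuous_x x₀).continuousAt.eventually (Metric.ball_mem_nhds _ hr)
  have hpos : 0 < ‖G.mid (c.x x₀ t) - (c.s s₀ t : AddCircle G.L)‖ := by
    rw [norm_pos_iff, sub_ne_zero]; exact hne
  have hsmall : ∀ᶠ t' in 𝓝 t, (|κ| + 1) * |t' - t| <
      ‖G.mid (c.x x₀ t) - (c.s s₀ t : AddCircle G.L)‖ := by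
    have h1 : Continuous fun t' => (|κ| + 1) * |t' - t| := by fun_prop
    refine (h1.tendsto t).eventually_lt_const ?_
    rw [sub_self, abs_zero, mul_zero]
    exact hpos
  filter_upwards [hball, hsmall] with t' h1 h2
  simp only [mem_compl_iff, mem_ofPred_eq, not_or]
  refine ⟨hM.notMem _ h1, fun h => ?_⟩
  have h0 : dist (c.x x₀ t) (c.x x₀ t) < r := by rwa [dist_self]
  have h3 : G.mid (c.x x₀ t) - (c.s s₀ t : AddCircle G.L) =
      ((M (c.x x₀ t) - M (c.x x₀ t') + (c.s s₀ t' - c.s s₀ t) : ℝ) : AddCircle G.L) := by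
    rw [AddCircle.coe_add, AddCircle.coe_sub, AddCircle.coe_sub, ← hM.lift _ h0, ← hM.lift _ h1, h]
    abel
  rw [h3] at h2
  have h4 := G.norm_circle_le (M (c.x x₀ t) - M (c.x x₀ t') + (c.s s₀ t' - c.s s₀ t))
  have h5 := hM.contr _ _ h1 h0
  have h6 := c.abs_s_sub_le s₀ t t'
  have h7 := abs_add_le (M (c.x x₀ t) - M (c.x x₀ t')) (c.s s₀ t' - c.s s₀ t)
  have h8 : κ * (dist (c.x x₀ t) (c.x x₀ t') / G.ν) ≤ |κ| * |t' - t| := by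
    refine mul_le_mul (le_abs_self κ) ?_ (div_nonneg dist_nonneg G.ν_pos.le) (abs_nonneg _)
    rw [div_le_iff₀ G.ν_pos, mul_comm, dist_comm]
    exact c.dist_x_le x₀ t t'
  linarith

end PerimeterGame

end

/-! ### Termination of the play and the value of the game -/

noncomputable section

namespace PerimeterGame

variable {G : PerimeterGame}

/-- The equality case of the triangle inequality: a motion that covers the greatest possible
distance between two times has no slack to leave the line. -/
theorem eq_add_smul_of_full_speed {X : ℝ → Plane} {ν a b τ : ℝ} {u : Plane}
    (hX : ∀ a b, dist (X b) (X a) ≤ ν * |b - a|) (hν : 0 ≤ ν) (hu : ‖u‖ = ν)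
    (hb : X b = X a + (b - a) • u) (h1 : a ≤ τ) (h2 : τ ≤ b) : X τ = X a + (τ - a) • u := by
  have hp := hX a τ
  have hq := hX τ b
  rw [abs_of_nonneg (by linarith), dist_eq_norm] at hp hq
  have hsum : X τ - X a = (b - a) • u - (X b - X τ) := by rw [hb]; abel
  have hqu : inner ℝ (X b - X τ) u ≤ ν * (b - τ) * ν := by
    refine (real_inner_le_norm _ _).trans ?_
    rw [hu]
    gcongr
  have hpu : ν ^ 2 * (τ - a) ≤ inner ℝ (X τ - X a) u := by
    rw [hsum, inner_sub_left, inner_smul_left, real_inner_self_eq_norm_sq, hu]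
    simp only [conj_trivial]
    linarith
  have hsq : ‖X τ - X a - (τ - a) • u‖ ^ 2 ≤ 0 := by
    rw [norm_sub_sq_real, norm_smul, inner_smul_right, hu, Real.norm_of_nonneg (by linarith)]
    have h3 := pow_le_pow_left₀ (norm_nonneg _) hp 2
    have h4 := mul_le_mul_of_nonneg_left hpu (by linarith : 0 ≤ τ - a)
    nlinarith
  have h0 : ‖X τ - X a - (τ - a) • u‖ = 0 := by
    have := pow_eq_zero_iff (two_ne_zero) |>.1 (le_antisymm hsq (sq_nonneg _))
    exact this
  rw [norm_eq_zero, sub_eq_zero, sub_eq_iff_eq_add'] at h0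
  exact h0

/-- A motion that near any time runs straight at full speed is straight. -/
theorem eq_add_smul_of_locally {X : ℝ → Plane} {ν : ℝ}
    (hX : ∀ a b, dist (X b) (X a) ≤ ν * |b - a|) (hν : 0 ≤ ν) {P : ℝ → Plane → Prop}
    (hloc : ∀ t, 0 ≤ t → ∃ a b u, 0 ≤ a ∧ (a < t ∨ t = 0 ∧ a = 0) ∧ t < b ∧ ‖u‖ = ν ∧
      X b = X a + (b - a) • u ∧ P t u) :
    ∃ u, ‖u‖ = ν ∧ ∀ t, 0 ≤ t → X t = X 0 + t • u ∧ P t u := by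
  have hline : ∀ {a b : ℝ} {u : Plane}, ‖u‖ = ν → X b = X a + (b - a) • u →
      ∀ t₁ t₂, a ≤ t₁ → t₁ ≤ b → a ≤ t₂ → t₂ ≤ b → X t₂ = X t₁ + (t₂ - t₁) • u := by
    intro a b u hu hb t₁ t₂ h1 h2 h3 h4
    rw [eq_add_smul_of_full_speed hX hν hu hb h1 h2, eq_add_smul_of_full_speed hX hν hu hb h3 h4]
    module
  have hdir : ∀ {t₁ b ε : ℝ} {u u' : Plane}, t₁ < b → 0 < ε →
      (∀ τ, t₁ ≤ τ → τ ≤ b → X τ = X t₁ + (τ - t₁) • u) →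
      (∀ τ, t₁ ≤ τ → τ < t₁ + ε → X τ = X t₁ + (τ - t₁) • u') → u = u' := by
    intro t₁ b ε u u' h1 h2 h3 h4
    obtain ⟨τ, h5, h6⟩ := exists_between (lt_min h1 (by linarith : t₁ < t₁ + ε))
    have h7 := h3 τ h5.le (h6.le.trans (min_le_left _ _))
    rw [h4 τ h5.le (h6.trans_le (min_le_right _ _)), add_right_inj] at h7
    exact (smul_right_injective _ (by linarith : τ - t₁ ≠ 0) h7).symm
  obtain ⟨a₀, b₀, u, ha₀, ha₀', hb₀, hu, hX₀, hP₀⟩ := hloc 0 le_rfl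
  have ha₀0 : a₀ = 0 := by
    rcases ha₀' with h | h
    · linarith
    · exact h.2
  rw [ha₀0] at hX₀
  have main : ∀ t, 0 ≤ t → (X t = X 0 + t • u ∧
      ∃ ε > 0, ∀ τ, t ≤ τ → τ < t + ε → X τ = X t + (τ - t) • u) := by
    intro B hB
    refine chain_induction (P := fun t => X t = X 0 + t • u ∧
      ∃ ε > 0, ∀ τ, t ≤ τ → τ < t + ε → X τ = X t + (τ - t) • u) hB ?_ ?_
    · refine ⟨by simp, b₀, hb₀, fun τ h1 h2 => ?_⟩
      exact hline hu hX₀ 0 τ le_rfl hb₀.le h1 (by linarith)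
    · intro t ht
      obtain ⟨a, b, w, ha, ha', hb, hw, hXb, -⟩ := hloc t ht.1
      have hε : ∃ ε > 0, ε ≤ b - t ∧ ∀ τ, 0 ≤ τ → |τ - t| < ε → a ≤ τ := by
        rcases ha' with h | ⟨h, h'⟩
        · refine ⟨min (b - t) (t - a), lt_min (by linarith) (by linarith), min_le_left _ _,
            fun τ _ hτ => ?_⟩
          have := (abs_lt.1 (hτ.trans_le (min_le_right _ _))).1
          linarith
        · exact ⟨b - t, by linarith, le_rfl, fun τ h0 _ => by linarith⟩
      obtain ⟨ε, hε0, hεb, hεa⟩ := hε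
      refine ⟨ε, hε0, ?_⟩
      rintro t₁ ht₁ t₂ ht₂ h1 h2 h12 ⟨hX1, ε₁, hε₁, hloc1⟩
      have ha1 := hεa t₁ ht₁.1 h1
      have ha2 := hεa t₂ ht₂.1 h2
      have hb1 : t₁ < b := by have := (abs_lt.1 h1).2; linarith
      have hb2 : t₂ < b := by have := (abs_lt.1 h2).2; linarith
      have hwu : w = u := hdir hb1 hε₁
        (fun τ h3 h4 => hline hw hXb t₁ τ ha1 hb1.le (ha1.trans h3) h4) hloc1
      rw [hwu] at hw hXb
      refine ⟨?_, b - t₂, by linarith, fun τ h3 h4 => ?_⟩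
      · rw [hline hw hXb t₁ t₂ ha1 hb1.le ha2 hb2.le, hX1]; module
      · exact hline hw hXb t₂ τ ha2 hb2.le (ha2.trans h3) (by linarith)
  refine ⟨u, hu, fun t ht => ⟨(main t ht).1, ?_⟩⟩
  obtain ⟨a, b, w, ha, ha', hb, hw, hXb, hP⟩ := hloc t ht
  have hat : a ≤ t := by rcases ha' with h | h <;> linarith [h]
  obtain ⟨-, ε, hε, hτ⟩ := main t ht
  have hwu : w = u := hdir hb hε (fun τ h3 h4 => hline hw hXb t τ hat hb.le (hat.trans h3) h4) hτ
  rwa [hwu] at hP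

/-- Against the defender's strategy the play ends. -/
theorem omegaStar_ends {c : G.Controls} {s₀ : ℝ} {x₀ : Plane} {δ : ℝ}
    (hx₀ : x₀ ∉ interior G.T) (hV : G.V s₀ x₀ ≤ 0)
    (hc : c.DefenderFollows s₀ x₀ G.omegaStar δ) :
    ∃ t, 0 ≤ t ∧ (c.x x₀ t ∈ G.afferentSurface (c.s s₀ t) ∨ c.x x₀ t ∈ G.T) := by
  by_contra hno
  push Not at hno
  have hν := G.ν_pos
  obtain ⟨σ, g, hg0, hgL, hmid, hVg, hσ⟩ := exists_signed_gap (s₀ := s₀) hx₀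
  have hσ' : σ = 1 ∨ σ = -1 := by rcases hσ with h | h <;> simp [h.1]
  have hgap := fun (b : ℝ) (hb : 0 ≤ b) => omegaStar_gap hb hc (fun τ hτ => (hno τ hτ.1).2)
    (fun τ hτ => (hno τ hτ.1).1) hg0 hgL hmid hσ
  have hω : ∀ τ, 0 ≤ τ → c.ω τ = σ := fun τ hτ => (hgap (τ + 1) (by linarith)).1 τ ⟨hτ, by linarith⟩
  obtain ⟨N, hN⟩ : ∃ N : ℝ → ℝ, ∀ t, N t = ‖G.mid (c.x x₀ t) - (c.s s₀ t : AddCircle G.L)‖ :=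
    ⟨_, fun _ => rfl⟩
  have hNeq : ∀ t g', 0 ≤ g' → g' ≤ G.L / 2 → G.mid (c.x x₀ t) = (c.s s₀ t + σ * g' : ℝ) →
      N t = g' := by
    intro t g' h1 h2 h3
    rw [hN, h3, AddCircle.coe_add, add_sub_cancel_left, norm_signed hσ',
      G.norm_circle_of_nonneg h1 h2]
  have hNt : ∀ t, 0 ≤ t → N t ≤ G.L / 2 ∧ G.mid (c.x x₀ t) = (c.s s₀ t + σ * N t : ℝ) ∧
      G.cc (c.x x₀ t) + N t ≤ 0 := by
    intro t ht
    obtain ⟨-, g', h1, h2, h3, h4⟩ := hgap t ht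
    rw [hNeq t g' h1 (h2.trans hgL) h3]
    exact ⟨h2.trans hgL, h3, by linarith⟩
  have hN0 : ∀ t, 0 ≤ N t := fun t => by rw [hN]; exact norm_nonneg _
  -- Once cc + N ≤ -η it remains so, and cc ≥ -d/ν keeps the intruder at distance d ≥ νη from T. A
  -- uniform κ then forces the gap below zero in finite time.
  by_cases hneg : ∃ t₁, 0 ≤ t₁ ∧ G.cc (c.x x₀ t₁) + N t₁ < 0
  · obtain ⟨t₁, ht₁, hlt⟩ := hneg
    obtain ⟨η, hη⟩ : ∃ η, η = -(G.cc (c.x x₀ t₁) + N t₁) := ⟨_, rfl⟩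
    have hη0 : 0 < η := by linarith
    have hfar : ∀ t, t₁ ≤ t → G.ν * η ≤ Metric.infDist (c.x x₀ t) G.T := by
      intro t ht
      obtain ⟨D, hD0, hD⟩ := exists_infDist_bound (c := c) (x₀ := x₀) (b := t)
        (fun τ hτ => (hno τ hτ.1).2)
      obtain ⟨κ, hκ0, -, hlift⟩ := G.exists_localLift hD0
      obtain ⟨g', h1, -, -, h2⟩ := advance hκ0 hlift (c := c) (s₀ := s₀) (x₀ := x₀) hσ' ht
        (fun τ hτ => hω τ (ht₁.trans hτ.1)) (fun τ hτ => hD τ ⟨ht₁.trans hτ.1, hτ.2⟩)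
        (fun τ hτ => (hno τ (ht₁.trans hτ.1)).1) (hN0 t₁) (hNt t₁ ht₁).2.1
      refine (Metric.le_infDist (G.interior_nonempty.mono interior_subset)).2 fun v hv => ?_
      have h3 := neg_infDist_le_cc (hno t (ht₁.trans ht)).2 hv
      have h4 : η ≤ dist v (c.x x₀ t) / G.ν := by linarith
      rw [le_div_iff₀ hν] at h4
      rw [dist_comm]; linarith
    obtain ⟨κ, hκ0, hκ1, hlift⟩ := G.exists_localLift (mul_pos hν hη0)
    have hκ : 0 < 1 - κ := by linarith
    obtain ⟨g', h1, h2, -, -⟩ := advance hκ0 hlift (c := c) (s₀ := s₀) (x₀ := x₀) hσ'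
      (a := t₁) (b := t₁ + (N t₁ + 1) / (1 - κ))
      (by have := hN0 t₁; have : 0 ≤ (N t₁ + 1) / (1 - κ) := by positivity
          linarith)
      (fun τ hτ => hω τ (ht₁.trans hτ.1)) (fun τ hτ => hfar τ hτ.1)
      (fun τ hτ => (hno τ (ht₁.trans hτ.1)).1) (hN0 t₁) (hNt t₁ ht₁).2.1
    rw [add_sub_cancel_left, mul_div_cancel₀ _ hκ.ne'] at h2
    linarith
  · push Not at hneg
    -- In the remaining case no value is ever lost, so each first-order estimate is an equality:
    -- near any time the intruder runs at full speed straight towards a point of T.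
    have hzero : ∀ t, 0 ≤ t → G.cc (c.x x₀ t) + N t = 0 := fun t ht =>
      le_antisymm (hNt t ht).2.2 (hneg t ht)
    have hloc : ∀ t, 0 ≤ t → ∃ a b u, 0 ≤ a ∧ (a < t ∨ t = 0 ∧ a = 0) ∧ t < b ∧ ‖u‖ = G.ν ∧
        c.x x₀ b = c.x x₀ a + (b - a) • u ∧
        ∃ r l : ℝ, 0 ≤ r ∧ t - 1 ≤ r ∧ 0 ≤ l ∧ c.x x₀ r + l • u ∈ G.T := by
      intro t ht
      obtain ⟨D, hD⟩ : ∃ D, D = Metric.infDist (c.x x₀ t) G.T := ⟨_, rfl⟩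
      have hD0 : 0 < D := hD ▸ infDist_pos (hno t ht).2
      obtain ⟨κ, hκ0, hκ1, hlift⟩ := G.exists_localLift hD0
      obtain ⟨r, M, hr, hM⟩ := hlift _ hD.le
      obtain ⟨ε, hε⟩ : ∃ ε, ε = min (r / G.ν) 1 / 2 := ⟨_, rfl⟩
      have hε0 : 0 < ε := by rw [hε]; positivity
      have hε1 : ε < 1 := by rw [hε]; linarith [min_le_right (r / G.ν) 1]
      have hεr : ε < r / G.ν := by
        have : 0 < r / G.ν := by positivity
        rw [hε]; linarith [min_le_left (r / G.ν) 1]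
      obtain ⟨a, ha⟩ : ∃ a, a = max 0 (t - ε) := ⟨_, rfl⟩
      have ha0 : 0 ≤ a := ha ▸ le_max_left _ _
      have ha1 : t - ε ≤ a := ha ▸ le_max_right _ _
      have hat : a ≤ t := by rw [ha]; exact max_le ht (by linarith)
      obtain ⟨b, hb⟩ : ∃ b, b = t + ε := ⟨_, rfl⟩
      have hab : a < b := by linarith
      obtain ⟨g', h1, h2, h3, v, hv, h4⟩ := hM.step hκ0 (c := c) (s₀ := s₀) (x₀ := x₀) hσ' hab.le
        (fun τ hτ => hω τ (ha0.trans hτ.1))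
        (fun τ hτ => by
          refine (c.dist_x_le x₀ t τ).trans_lt ?_
          rw [← lt_div_iff₀' hν, abs_lt]
          constructor <;> linarith [hτ.1, hτ.2])
        (fun τ hτ => (hno τ (ha0.trans hτ.1)).1) (hN0 a) (hNt a ha0).2.1
      have h5 : 0 ≤ (1 - κ) * (b - a) := mul_nonneg (by linarith) (by linarith)
      rw [← hNeq b g' h1 (by linarith [(hNt a ha0).1]) h3, hzero a ha0,
        hzero b (by linarith)] at h4
      obtain ⟨u, hu⟩ : ∃ u, u = ‖v - c.x x₀ a‖⁻¹ • (v - c.x x₀ a) := ⟨_, rfl⟩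
      have hva : 0 < ‖v - c.x x₀ a‖ := by
        rw [norm_pos_iff, sub_ne_zero]
        rintro rfl
        exact (hno a ha0).2 hv
      have hu1 : ‖u‖ = 1 := by
        rw [hu, norm_smul, norm_inv, norm_norm, inv_mul_cancel₀ hva.ne']
      rw [← hu] at h4
      have h6 : G.ν * (b - a) ≤ inner ℝ (c.x x₀ b - c.x x₀ a) u := by
        have h7 : b - a ≤ inner ℝ (c.x x₀ b - c.x x₀ a) u / G.ν := by linarith
        rw [le_div_iff₀ hν] at h7
        linarith
      have hnorm := c.dist_x_le x₀ a b
      rw [abs_of_pos (by linarith), dist_eq_norm] at hnorm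
      have hsq : ‖c.x x₀ b - c.x x₀ a - (G.ν * (b - a)) • u‖ ^ 2 ≤ 0 := by
        have hpos : 0 ≤ G.ν * (b - a) := mul_nonneg hν.le (by linarith)
        rw [norm_sub_sq_real, norm_smul, inner_smul_right, hu1, Real.norm_of_nonneg hpos]
        have h7 := pow_le_pow_left₀ (norm_nonneg _) hnorm 2
        have h8 := mul_le_mul_of_nonneg_left h6 hpos
        nlinarith
      have h9 := pow_eq_zero_iff (two_ne_zero) |>.1 (le_antisymm hsq (sq_nonneg _))
      rw [norm_eq_zero, sub_eq_zero, sub_eq_iff_eq_add'] at h9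
      refine ⟨a, b, G.ν • u, ha0, ?_, by linarith, ?_, ?_, a, ‖v - c.x x₀ a‖ / G.ν, ha0,
        by linarith, by positivity, ?_⟩
      · rcases ht.eq_or_lt with h | h
        · right
          refine ⟨h.symm, ?_⟩
          rw [ha, ← h]; exact max_eq_left (by linarith)
        · left
          rw [ha]; exact max_lt h (by linarith)
      · rw [norm_smul, hu1, mul_one, Real.norm_of_nonneg hν.le]
      · rw [h9, smul_smul, mul_comm]
      · rw [smul_smul, div_mul_cancel₀ _ hν.ne', hu, smul_smul, mul_inv_cancel₀ hva.ne', one_smul,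
          add_sub_cancel]
        exact hv
    obtain ⟨u, hu, hline⟩ := eq_add_smul_of_locally (c.dist_x_le x₀) hν.le hloc
    -- A straight run at full speed is eventually farther from its start than all of T, yet a point
    -- of T should still lie ahead.
    obtain ⟨R, hR⟩ := G.compact.isBounded.subset_closedBall (c.x x₀ 0)
    have hR0 : 0 ≤ |R| := abs_nonneg R
    obtain ⟨-, r, l, hr0, hr1, hl, hmem⟩ := hline (1 + (|R| + 1) / G.ν) (by positivity)
    have h1 := Metric.mem_closedBall.1 (hR hmem)
    rw [(hline r hr0).1, add_assoc, ← add_smul, dist_eq_norm, add_sub_cancel_left, norm_smul, hu,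
      Real.norm_of_nonneg (by linarith)] at h1
    have h2 : |R| + 1 ≤ (r + l) * G.ν := by
      rw [← div_le_iff₀ hν]; linarith
    linarith [le_abs_self R]

theorem omegaStar_captures {c : G.Controls} {s₀ : ℝ} {x₀ : Plane} {δ : ℝ}
    (hx₀ : x₀ ∉ interior G.T) (hV : G.V s₀ x₀ ≤ 0)
    (hc : c.DefenderFollows s₀ x₀ G.omegaStar δ) : ∃ t, c.CapturedAt s₀ x₀ t := by
  obtain ⟨K, hK⟩ : ∃ K, K = Ici (0 : ℝ) ∩
    {t | c.x x₀ t ∈ G.T ∨ G.mid (c.x x₀ t) = (c.s s₀ t : AddCircle G.L)} := ⟨_, rfl⟩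
  have hclosed : IsClosed K := hK ▸ isClosed_Ici.inter (captured_set_closed c s₀ x₀)
  have hmem : ∀ t, t ∈ K ↔ 0 ≤ t ∧ (c.x x₀ t ∈ G.afferentSurface (c.s s₀ t) ∨ c.x x₀ t ∈ G.T) := by
    intro t
    rw [hK]
    simp only [mem_inter_iff, mem_Ici, mem_ofPred_eq, mem_afferentSurface_iff]
    refine and_congr_right fun _ => ⟨?_, ?_⟩
    · rintro (h | h)
      · exact Or.inr h
      · by_cases hT : c.x x₀ t ∈ G.T
        · exact Or.inr hT
        · exact Or.inl ⟨notMem_interior hT, h.symm⟩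
    · rintro (h | h)
      · exact Or.inr h.2.symm
      · exact Or.inl h
  have hne : K.Nonempty := by
    obtain ⟨t, h⟩ := omegaStar_ends hx₀ hV hc
    exact ⟨t, (hmem t).2 h⟩
  have hbdd : BddBelow K := ⟨0, fun t ht => ((hmem t).1 ht).1⟩
  have hinf := (hmem _).1 (hclosed.csInf_mem hne hbdd)
  have hbefore : ∀ τ, 0 ≤ τ → τ < sInf K →
      c.x x₀ τ ∉ G.afferentSurface (c.s s₀ τ) ∧ c.x x₀ τ ∉ G.T := by
    intro τ h0 h1
    have h2 := mt (hmem τ).2 (notMem_of_lt_csInf h1 hbdd)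
    push Not at h2
    exact h2 h0
  exact ⟨_, hinf.1, (omegaStar_first hx₀ hV hc hinf.1 hinf.2 hbefore).1, hbefore⟩

theorem payoff_le {c : G.Controls} {s₀ : ℝ} {x₀ : Plane} {δ : ℝ}
    (hx₀ : x₀ ∉ interior G.T) (hV : G.V s₀ x₀ ≤ 0)
    (hc : c.DefenderFollows s₀ x₀ G.omegaStar δ) :
    c.payoff s₀ x₀ ≤ ((G.ν * G.V s₀ x₀ : ℝ) : EReal) := by
  have h := omegaStar_captures hx₀ hV hc
  rw [Controls.payoff, dif_pos h, EReal.coe_le_coe_iff]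
  obtain ⟨h0, h1, h2⟩ := h.choose_spec
  have h3 := (omegaStar_first hx₀ hV hc h0 (Or.inl h1) h2).2
  have h4 := neg_le_dbar (s := c.s s₀ h.choose) ((G.mem_afferentSurface_iff).1 h1).1
  have h5 := mul_le_mul_of_nonneg_left h3 G.ν_pos.le
  linarith

theorem le_payoff {c : G.Controls} {s₀ : ℝ} {x₀ : Plane} {δ : ℝ} (hδ : 0 < δ)
    (hx₀ : x₀ ∉ interior G.T) (hV : G.V s₀ x₀ ≤ 0)
    (hc : c.IntruderFollows s₀ x₀ G.uStar δ) :
    ((G.ν * (G.V s₀ x₀ - 2 * δ) : ℝ) : EReal) ≤ c.payoff s₀ x₀ := by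
  rw [Controls.payoff]
  split_ifs with h
  · rw [EReal.coe_le_coe_iff]
    exact le_neg_dbar_of_captured hδ hx₀ hV hc h.choose_spec
  · exact le_top

/-! ### Guarantees and limits -/

variable (G)

theorem isSampling_nat_mul {δ : ℝ} (hδ : 0 < δ) : IsSampling δ fun k : ℕ => k * δ where
  zero := by simp
  strictMono := fun a b h => by
    have : (a : ℝ) < b := by exact_mod_cast h
    exact mul_lt_mul_of_pos_right this hδ
  mesh k := by push_cast; linarith
  tendsto := tendsto_natCast_atTop_atTop.atTop_mul_const hδ

/-- The states of a joint play at the sampling times. -/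
def sampledState (s₀ : ℝ) (x₀ : Plane) (F : G.DefenderStrategy) (U : G.IntruderStrategy) (δ : ℝ) :
    ℕ → ℝ × Plane
  | 0 => (s₀, x₀)
  | k + 1 =>
    let z := sampledState s₀ x₀ F U δ k
    (z.1 + δ * F.toFun z.1 z.2, z.2 + δ • U.toFun z.1 z.2)

/-- Without such a play the infima and suprema over joint plays would be over empty sets, and the
lower payoff could exceed the upper one. -/
theorem exists_play (s₀ : ℝ) (x₀ : Plane) (F : G.DefenderStrategy) (U : G.IntruderStrategy)
    {δ : ℝ} (hδ : 0 < δ) : ∃ c : G.Controls,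
      c.DefenderFollows s₀ x₀ F δ ∧ c.IntruderFollows s₀ x₀ U δ := by
  obtain ⟨z, hz⟩ : ∃ z, z = G.sampledState s₀ x₀ F U δ := ⟨_, rfl⟩
  have hfloor : Measurable fun τ : ℝ => ⌊τ / δ⌋₊ :=
    Nat.measurable_floor.comp (measurable_id.div_const δ)
  let c : G.Controls :=
    { ω := fun τ => F.toFun (z ⌊τ / δ⌋₊).1 (z ⌊τ / δ⌋₊).2
      u := fun τ => U.toFun (z ⌊τ / δ⌋₊).1 (z ⌊τ / δ⌋₊).2
      measurable_ω := (measurable_from_nat (f := fun k => F.toFun (z k).1 (z k).2)).comp hfloor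
      measurable_u := (measurable_from_nat (f := fun k => U.toFun (z k).1 (z k).2)).comp hfloor
      bound_ω := fun _ => F.bound _ _
      bound_u := fun _ => U.bound _ _ }
  have hfl : ∀ (k : ℕ), ∀ τ ∈ Ico (k * δ : ℝ) ((k + 1 : ℕ) * δ), ⌊τ / δ⌋₊ = k := by
    intro k τ hτ
    have h0 : 0 ≤ τ / δ := div_nonneg (le_trans (by positivity) hτ.1) hδ.le
    rw [Nat.floor_eq_iff h0, le_div_iff₀ hδ, div_lt_iff₀ hδ]
    have h2 := hτ.2
    push_cast at h2
    exact ⟨hτ.1, h2⟩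
  have hω : ∀ (k : ℕ), ∀ τ ∈ Ico (k * δ : ℝ) ((k + 1 : ℕ) * δ),
      c.ω τ = F.toFun (z k).1 (z k).2 := fun k τ hτ => by
    simp only [c, hfl k τ hτ]
  have hu : ∀ (k : ℕ), ∀ τ ∈ Ico (k * δ : ℝ) ((k + 1 : ℕ) * δ),
      c.u τ = U.toFun (z k).1 (z k).2 := fun k τ hτ => by
    simp only [c, hfl k τ hτ]
  have hle : ∀ k : ℕ, (k * δ : ℝ) ≤ (k + 1 : ℕ) * δ := fun k => by push_cast; linarith
  have hstate : ∀ k : ℕ, c.s s₀ (k * δ) = (z k).1 ∧ c.x x₀ (k * δ) = (z k).2 := by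
    intro k
    induction k with
    | zero =>
      rw [Nat.cast_zero, zero_mul, c.s_zero, c.x_zero, hz]
      exact ⟨rfl, rfl⟩
    | succ k ih =>
      have h1 := c.s_sub s₀ (k * δ) ((k + 1 : ℕ) * δ)
      have h2 := c.x_sub x₀ (k * δ) ((k + 1 : ℕ) * δ)
      rw [integral_eq_of_eqOn_Ico (hle k) (hω k), smul_eq_mul] at h1
      rw [integral_eq_of_eqOn_Ico (hle k) (hu k)] at h2
      have e : ((k + 1 : ℕ) * δ - k * δ : ℝ) = δ := by push_cast; ring
      rw [e, sub_eq_iff_eq_add', ih.1] at h1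
      rw [e, sub_eq_iff_eq_add', ih.2] at h2
      rw [h1, h2, hz]
      exact ⟨rfl, rfl⟩
  refine ⟨c, ⟨_, isSampling_nat_mul hδ, fun k τ hτ => ?_⟩,
    ⟨_, isSampling_nat_mul hδ, fun k τ hτ => ?_⟩⟩
  · rw [hω k τ hτ, (hstate k).1, (hstate k).2]
  · rw [hu k τ hτ, (hstate k).1, (hstate k).2]

variable {G}

theorem IsSampling.mono {δ δ' : ℝ} {t : ℕ → ℝ} (h : IsSampling δ t) (hle : δ ≤ δ') :
    IsSampling δ' t :=
  ⟨h.zero, h.strictMono, fun k => (h.mesh k).trans hle, h.tendsto⟩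

theorem Controls.DefenderFollows.mono {c : G.Controls} {s₀ : ℝ} {x₀ : Plane}
    {F : G.DefenderStrategy} {δ δ' : ℝ} (h : c.DefenderFollows s₀ x₀ F δ) (hle : δ ≤ δ') :
    c.DefenderFollows s₀ x₀ F δ' := by
  obtain ⟨t, ht, h'⟩ := h
  exact ⟨t, ht.mono hle, h'⟩

theorem Controls.IntruderFollows.mono {c : G.Controls} {s₀ : ℝ} {x₀ : Plane}
    {U : G.IntruderStrategy} {δ δ' : ℝ} (h : c.IntruderFollows s₀ x₀ U δ) (hle : δ ≤ δ') :
    c.IntruderFollows s₀ x₀ U δ' := by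
  obtain ⟨t, ht, h'⟩ := h
  exact ⟨t, ht.mono hle, h'⟩

theorem intruderGuarantee_le_lowerPayoff (s₀ : ℝ) (x₀ : Plane) (F : G.DefenderStrategy)
    (U : G.IntruderStrategy) : G.intruderGuarantee s₀ x₀ U ≤ G.lowerPayoff s₀ x₀ F U :=
  iSup₂_mono fun _ _ => le_iInf₂ fun c hc => iInf₂_le c hc.2

theorem upperPayoff_le_defenderGuarantee (s₀ : ℝ) (x₀ : Plane) (F : G.DefenderStrategy)
    (U : G.IntruderStrategy) : G.upperPayoff s₀ x₀ F U ≤ G.defenderGuarantee s₀ x₀ F :=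
  iInf₂_mono fun _ _ => iSup₂_le fun c hc => le_iSup₂_of_le c hc.1 le_rfl

theorem lowerPayoff_le_upperPayoff (s₀ : ℝ) (x₀ : Plane) (F : G.DefenderStrategy)
    (U : G.IntruderStrategy) : G.lowerPayoff s₀ x₀ F U ≤ G.upperPayoff s₀ x₀ F U := by
  refine iSup₂_le fun δ hδ => le_iInf₂ fun δ' hδ' => ?_
  obtain ⟨c, h1, h2⟩ := G.exists_play s₀ x₀ F U (lt_min hδ hδ')
  exact (iInf₂_le c ⟨h1.mono (min_le_left _ _), h2.mono (min_le_left _ _)⟩).trans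
    (le_iSup₂_of_le c ⟨h1.mono (min_le_right _ _), h2.mono (min_le_right _ _)⟩ le_rfl)

theorem defenderGuarantee_omegaStar_le {s₀ : ℝ} {x₀ : Plane} (hx₀ : x₀ ∉ interior G.T)
    (hV : G.V s₀ x₀ ≤ 0) :
    G.defenderGuarantee s₀ x₀ G.omegaStar ≤ ((G.ν * G.V s₀ x₀ : ℝ) : EReal) :=
  (iInf₂_le 1 one_pos).trans (iSup₂_le fun _ hc => payoff_le hx₀ hV hc)

theorem le_intruderGuarantee_uStar {s₀ : ℝ} {x₀ : Plane} (hx₀ : x₀ ∉ interior G.T)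
    (hV : G.V s₀ x₀ ≤ 0) :
    ((G.ν * G.V s₀ x₀ : ℝ) : EReal) ≤ G.intruderGuarantee s₀ x₀ G.uStar := by
  have hlim : Tendsto (fun δ : ℝ => ((G.ν * (G.V s₀ x₀ - 2 * δ) : ℝ) : EReal)) (𝓝[>] 0)
      (𝓝 ((G.ν * G.V s₀ x₀ : ℝ) : EReal)) := by
    have h1 : Continuous fun δ : ℝ => ((G.ν * (G.V s₀ x₀ - 2 * δ) : ℝ) : EReal) :=
      continuous_coe_real_ereal.comp (by fun_prop)
    have h2 := (h1.tendsto 0).mono_left (nhdsWithin_le_nhds (s := Ioi 0))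
    simpa using h2
  refine le_of_tendsto hlim ?_
  filter_upwards [self_mem_nhdsWithin] with δ hδ
  exact le_iSup₂_of_le δ hδ (le_iInf₂ fun _ hc => le_payoff hδ hx₀ hV hc)

end PerimeterGame

end

theorem mainTheorem3 (G : PerimeterGame) (s₀ : ℝ) (x₀ : Plane)
    (hout : x₀ ∉ interior G.T) (hx₀ : x₀ ∉ G.intruderWinning s₀) :
    -- equilibrium: no unilateral deviation from `(ω_D*, u_A*)` helps, even to an arbitrary control
    (G.upperPayoff s₀ x₀ G.omegaStar G.uStar = ((G.ν * G.V s₀ x₀ : ℝ) : EReal) ∧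
      G.lowerPayoff s₀ x₀ G.omegaStar G.uStar = ((G.ν * G.V s₀ x₀ : ℝ) : EReal) ∧
      G.defenderGuarantee s₀ x₀ G.omegaStar = ((G.ν * G.V s₀ x₀ : ℝ) : EReal) ∧
      G.intruderGuarantee s₀ x₀ G.uStar = ((G.ν * G.V s₀ x₀ : ℝ) : EReal)) ∧
    -- value: the min-max and the max-min over feedback strategies are attained and agree
    IsLeast (Set.range fun F : G.DefenderStrategy =>
      ⨆ U : G.IntruderStrategy, G.upperPayoff s₀ x₀ F U) ((G.ν * G.V s₀ x₀ : ℝ) : EReal) ∧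
    IsGreatest (Set.range fun U : G.IntruderStrategy =>
      ⨅ F : G.DefenderStrategy, G.lowerPayoff s₀ x₀ F U) ((G.ν * G.V s₀ x₀ : ℝ) : EReal) := by
  have hV : G.V s₀ x₀ ≤ 0 := not_lt.1 fun h => hx₀ ⟨hout, h⟩
  have hD := PerimeterGame.defenderGuarantee_omegaStar_le hout hV
  have hI := PerimeterGame.le_intruderGuarantee_uStar hout hV
  have h1 := PerimeterGame.intruderGuarantee_le_lowerPayoff (G := G) s₀ x₀
  have h2 := PerimeterGame.lowerPayoff_le_upperPayoff (G := G) s₀ x₀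
  have h3 := PerimeterGame.upperPayoff_le_defenderGuarantee (G := G) s₀ x₀
  have h12 := fun F U => (h1 F U).trans (h2 F U)
  have h23 := fun F U => (h2 F U).trans (h3 F U)
  -- For all F and U: guarantee of U ≤ lower payoff ≤ upper payoff ≤ guarantee of F. Since u_A*
  -- guarantees at least νV and ω_D* at most νV, every claim follows by sandwiching.
  refine ⟨⟨?_, ?_, ?_, ?_⟩, ⟨⟨G.omegaStar, ?_⟩, ?_⟩, ⟨⟨G.uStar, ?_⟩, ?_⟩⟩
  · exact le_antisymm ((h3 _ _).trans hD) (hI.trans (h12 _ _))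
  · exact le_antisymm ((h23 _ _).trans hD) (hI.trans (h1 _ _))
  · exact le_antisymm hD (hI.trans ((h12 _ _).trans (h3 _ _)))
  · exact le_antisymm ((h1 _ _).trans ((h23 _ _).trans hD)) hI
  · exact le_antisymm (iSup_le fun U => (h3 _ U).trans hD)
      (le_iSup_of_le G.uStar (hI.trans (h12 _ _)))
  · rintro _ ⟨F, rfl⟩
    exact le_iSup_of_le G.uStar (hI.trans (h12 F _))
  · exact le_antisymm (iInf_le_of_le G.omegaStar ((h23 _ _).trans hD))
      (le_iInf fun F => hI.trans (h1 F _))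
  · rintro _ ⟨U, rfl⟩
    exact iInf_le_of_le G.omegaStar ((h23 _ U).trans hD)
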